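/- Let $\mathcal H$ be a separable complex Hilbert space, $\mathcal B$ and $\mathcal T_1$ denote bounded and trace-class operators, $X^T\varphi=\varphi\circ X$ the transpose on $\mathcal H^*$, and $\mathrm{supp}(A)$ the closure of the range of $A$. A quantum channel is a completely positive, trace-preserving linear map between spaces of trace-class operators. Let $\rho,\omega$ be states on $\mathcal H$ (positive trace-class operators of trace one) and let $\Phi:\mathcal T_1(\mathrm{supp}(\rho))\to\mathcal T_1(\mathcal H)$ be a quantum channel with $\Phi(\rho)=\omega$. Let $\Phi^\dagger:\mathcal B(\mathcal H)\to\mathcal B(\mathrm{supp}(\rho))$ be defined by $\mathrm{tr}[\Phi(X)A]=\mathrm{tr}[X\Phi^\dagger(A)]$ for all $X\in\mathcal T_1(\mathrm{supp}(\rho))$, $A\in\mathcal B(\mathcal H)$. Let $$\Pi_\Phi=(\Phi\otimes\mathrm{id}_{\mathcal T_1(\mathcal H^*)})\big(|\sqrt\rho\rangle\rangle\langle\langle\sqrt\rho|\big)\in\mathcal T_1(\mathcal H\otimes\mathcal H^*),$$ where $|\sqrt\rho\rangle\rangle\in\mathrm{supp}(\rho)\otimes\mathcal H^*$ is the vector corresponding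 to $\sqrt\rho$ under the identification of $\psi\otimes\eta$ with the operator $x\mapsto\eta(x)\psi$, and $\Phi\otimes\mathrm{id}$ is the trace-norm continuous linear map with $X\otimes Y\mapsto\Phi(X)\otimes Y$. Let $\Phi_{rec}:\mathcal T_1(\mathrm{supp}(\omega))\to\mathcal T_1(\mathcal H)$ be the Petz recovery map, that is, the trace-norm continuous linear map with $$\Phi_{rec}(X)=\rho^{1/2}\,\Phi^\dagger\big(\omega^{-1/2}X\omega^{-1/2}\big)\,\rho^{1/2}$$ for all $X$ in the span of the operators $|g\rangle\langle g'|$ with $g,g'$ eigenvectors of $\omega$ for positive eigenvalues; here $\omega^{-1/2}$ is the pseudo-inverse of $\omega^{1/2}$, and operators on $\mathrm{supp}(\rho)$ or $\mathrm{supp}(\omega)$ are extended by zero to $\mathcal H$. (The span is dense in $\mathcal T_1(\mathrm{supp}(\omega))$, and equal to it if $\omega$ has finite rank.) Let $\Pi_{rec}=(\Phi_{rec}\otimes\mathrm{id}_{\mathcal T_1(\mathcal H^*)})(|\sqrt\omega\rangle\rangle\langle\langle\sqrt\omega|)$, and let $(\cdot)^{ST}$ be the swap transposition on $\mathcal T_1(\mathcal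 H\otimes\mathcal H^*)$, that is, the trace-norm continuous linear map with $X\otimes Y^T\mapsto Y\otimes X^T$ for $X,Y\in\mathcal T_1(\mathcal H)$. Then all these objects exist and are unique; $\Phi_{rec}$ is a quantum channel with $\Phi_{rec}(\omega)=\rho$; $\Pi_\Phi$ is a coupling of $\rho$ and $\omega$, that is, a state on $\mathcal H\otimes\mathcal H^*$ with $\mathrm{tr}_{\mathcal H^*}[\Pi_\Phi]=\omega$ and $\mathrm{tr}_{\mathcal H}[\Pi_\Phi]=\rho^T$; likewise $\Pi_{rec}$ is a coupling of $\omega$ and $\rho$; and $$(\Pi_\Phi)^{ST}=\Pi_{rec}.$$ -/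

import Mathlib

open scoped InnerProductSpace TensorProduct ComplexOrder ENNReal NNReal

set_option linter.unusedSectionVars false

namespace QuantumTransport

section TraceClass

variable {H : Type*} [NormedAddCommGroup H] [InnerProductSpace ℂ H] [CompleteSpace H]
variable {K : Type*} [NormedAddCommGroup K] [InnerProductSpace ℂ K] [CompleteSpace K]

/-- An orthonormal Hilbert basis of `H`, fixed once and for all. -/
noncomputable def onb (H : Type*) [NormedAddCommGroup H] [InnerProductSpace ℂ H]
    [CompleteSpace H] : HilbertBasis (exists_hilbertBasis ℂ H).choose ℂ H :=
  (exists_hilbertBasis ℂ H).choose_spec.choose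

/-- The trace norm `tr √(X* X)`, with values in `[0, ∞]`. -/
noncomputable def traceNorm (X : H →L[ℂ] H) : ℝ≥0∞ :=
  ∑' i, ENNReal.ofReal (⟪onb H i, CFC.abs X (onb H i)⟫_ℂ).re

/-- The trace `∑ ⟨eᵢ, X eᵢ⟩` of an operator. -/
noncomputable def trace (X : H →L[ℂ] H) : ℂ := ∑' i, ⟪onb H i, X (onb H i)⟫_ℂ

theorem abs_sq_apply (T : H →L[ℂ] H) (x : H) :
    CFC.abs T (CFC.abs T x) = T.adjoint (T x) := by
  exact congrArg (fun S : H →L[ℂ] H => S x) (CFC.abs_mul_abs T)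

theorem abs_isPositive (T : H →L[ℂ] H) : (CFC.abs T).IsPositive :=
  (ContinuousLinearMap.nonneg_iff_isPositive _).1 (CFC.abs_nonneg T)

theorem abs_eq_of_sq (T P : H →L[ℂ] H) (hP : P.IsPositive)
    (h : ∀ x, P (P x) = T.adjoint (T x)) : CFC.abs T = P := by
  refine CFC.sqrt_unique ?_ ((ContinuousLinearMap.nonneg_iff_isPositive _).2 hP)
  ext x
  exact h x

theorem norm_abs_apply (T : H →L[ℂ] H) (x : H) : ‖CFC.abs T x‖ = ‖T x‖ := by
  have h1 : ⟪CFC.abs T x, CFC.abs T x⟫_ℂ = ⟪T x, T x⟫_ℂ := by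
    rw [(abs_isPositive T).inner_left_eq_inner_right, abs_sq_apply,
      ContinuousLinearMap.adjoint_inner_right]
  have h2 : ‖CFC.abs T x‖ ^ 2 = ‖T x‖ ^ 2 := by
    rw [@norm_sq_eq_re_inner ℂ, @norm_sq_eq_re_inner ℂ, h1]
  exact (sq_eq_sq₀ (norm_nonneg _) (norm_nonneg _)).1 h2

/-- An approximate polar decomposition. -/
theorem approx_polar (T : H →L[ℂ] H) {ε : ℝ} (hε : 0 < ε) :
    ∃ U : H →L[ℂ] H, (∀ x, ‖U x‖ ≤ ‖x‖) ∧
      (∀ x, ‖CFC.abs T x - U.adjoint (T x)‖ ≤ ε * ‖x‖) ∧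
      (∀ x, ‖T x - U (CFC.abs T x)‖ ≤ ε * ‖x‖) := by
  set P := CFC.abs T with hP
  have hPp : P.IsPositive := abs_isPositive T
  set Q : H →L[ℂ] H := P + (ε : ℂ) • 1 with hQ
  have hQp : Q.IsPositive := hPp.add
    (ContinuousLinearMap.isPositive_one.smul_of_nonneg (by exact_mod_cast hε.le))
  have hin : ∀ x, ε * ‖x‖ ^ 2 ≤ (⟪Q x, x⟫_ℂ).re := by
    intro x
    have h1 := hPp.re_inner_nonneg_left x
    have h2 : (⟪Q x, x⟫_ℂ).re = (⟪P x, x⟫_ℂ).re + ε * ‖x‖ ^ 2 := by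
      simp only [hQ, add_apply, smul_apply, inner_add_left, inner_smul_left,
        one_apply_eq_self, inner_self_eq_norm_sq_to_K]
      simp [← Complex.ofReal_pow]
    have h1' : 0 ≤ (⟪P x, x⟫_ℂ).re := h1
    linarith
  have hunit : IsUnit Q := by
    apply ContinuousLinearMap.isUnit_of_forall_le_norm_inner_map Q (c := ⟨ε, hε.le⟩) hε
    intro x
    have := (hin x).trans (Complex.re_le_norm _)
    rw [mul_comm] at this
    exact this
  obtain ⟨u, hu⟩ := hunit
  set G : H →L[ℂ] H := ↑u⁻¹ with hG
  have hQG : Q * G = 1 := by rw [← hu, hG]; simp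
  have hGQ : G * Q = 1 := by rw [← hu, hG]; simp
  have hcomm : P * G = G * P := by
    have h1 : P * Q = Q * P := by simp [hQ, mul_add, add_mul]
    calc P * G = (G * Q) * (P * G) := by rw [hGQ, one_mul]
      _ = G * (Q * P) * G := by simp only [mul_assoc]
      _ = G * P * (Q * G) := by rw [← h1]; simp only [mul_assoc]
      _ = G * P := by rw [hQG, mul_one]
  have hQsa : star Q = Q := hQp.isSelfAdjoint
  have hGsa : star G = G := by
    calc star G = star G * (Q * G) := by rw [hQG, mul_one]
      _ = star (Q * G) * G := by rw [star_mul, hQsa, mul_assoc]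
      _ = G := by rw [hQG]; simp
  have hnorm : ∀ x, ‖P x‖ ≤ ‖Q x‖ := by
    intro x
    have h2 : ‖Q x‖ ^ 2 = ‖P x‖ ^ 2 + 2 * (ε * (⟪P x, x⟫_ℂ).re) + ‖(ε : ℂ) • x‖ ^ 2 := by
      have : Q x = P x + (ε : ℂ) • x := by simp [hQ]
      rw [this, @norm_add_sq ℂ, inner_smul_right]
      simp
    have h1 : 0 ≤ (⟪P x, x⟫_ℂ).re := hPp.re_inner_nonneg_left x
    have h3 : ‖P x‖ ^ 2 ≤ ‖Q x‖ ^ 2 := by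
      rw [h2]; nlinarith [mul_nonneg hε.le h1, sq_nonneg ‖(ε : ℂ) • x‖]
    exact (sq_le_sq₀ (norm_nonneg _) (norm_nonneg _)).1 h3
  have hPG : ∀ x, ‖P (G x)‖ ≤ ‖x‖ := by
    intro x
    have h := hnorm (G x)
    have : Q (G x) = x := congrArg (fun S : H →L[ℂ] H => S x) hQG
    rwa [this] at h
  have hU : ∀ x, ‖(T * G) x‖ ≤ ‖x‖ := by
    intro x
    have h := norm_abs_apply T (G x)
    have h' := hPG x
    rw [hP, h] at h'
    exact h'
  refine ⟨T * G, hU, fun x => ?_, fun x => ?_⟩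
  · have h1 : (T * G).adjoint (T x) = (G * (P * P)) x := by
      have : (T * G).adjoint = star G * star T := by
        rw [← star_mul]; rfl
      rw [this, hGsa, hP, CFC.abs_mul_abs]
      simp
    have h2 : P - G * (P * P) = (ε : ℂ) • (P * G) := by
      calc P - G * (P * P) = (G * Q) * P - G * (P * P) := by rw [hGQ, one_mul]
        _ = (ε : ℂ) • (P * G) := by
          rw [hcomm]; simp [hQ, mul_add, add_mul, mul_assoc]
    have h3 : P x - (T * G).adjoint (T x) = (ε : ℂ) • P (G x) := by
      rw [h1]; exact congrArg (fun S : H →L[ℂ] H => S x) h2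
    rw [h3, norm_smul]
    simp only [Complex.norm_real, Real.norm_eq_abs, abs_of_pos hε]
    gcongr
    exact hPG x
  · have h2 : T - (T * G) * P = (ε : ℂ) • (T * G) := by
      calc T - (T * G) * P = T * (G * Q) - (T * G) * P := by rw [hGQ, mul_one]
        _ = (ε : ℂ) • (T * G) := by simp [hQ, mul_add, mul_assoc]
    have h3 : T x - (T * G) (P x) = (ε : ℂ) • (T * G) x :=
      congrArg (fun S : H →L[ℂ] H => S x) h2
    rw [h3, norm_smul]
    simp only [Complex.norm_real, Real.norm_eq_abs, abs_of_pos hε]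
    gcongr
    exact hU x

/-- Parseval's identity. -/
theorem enorm_sq_eq_tsum {ι : Type*} (b : HilbertBasis ι ℂ H) (x : H) :
    ‖x‖ₑ ^ 2 = ∑' i, ‖⟪b i, x⟫_ℂ‖ₑ ^ 2 := by
  have h1 : HasSum (fun i => ‖⟪b i, x⟫_ℂ‖ ^ 2) (‖x‖ ^ 2) := by
    have h := Complex.hasSum_re (b.hasSum_inner_mul_inner x x)
    have e1 : (⟪x, x⟫_ℂ).re = ‖x‖ ^ 2 := inner_self_eq_norm_sq (𝕜 := ℂ) x
    have e2 : ∀ i, (⟪x, b i⟫_ℂ * ⟪b i, x⟫_ℂ).re = ‖⟪b i, x⟫_ℂ‖ ^ 2 := by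
      intro i
      rw [← inner_conj_symm x (b i), Complex.conj_mul', ← Complex.ofReal_pow, Complex.ofReal_re]
    simp only [e1, e2] at h
    exact h
  have h2 : ∀ r : ℝ, 0 ≤ r → ENNReal.ofReal (r ^ 2) = ENNReal.ofReal r ^ 2 := fun r hr =>
    ENNReal.ofReal_pow hr 2
  have h3 := ENNReal.ofReal_tsum_of_nonneg (fun i => sq_nonneg ‖⟪b i, x⟫_ℂ‖) h1.summable
  rw [h1.tsum_eq, h2 _ (norm_nonneg _), ofReal_norm] at h3
  rw [h3]
  refine tsum_congr fun i => ?_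
  rw [h2 _ (norm_nonneg _), ofReal_norm]

/-- Bessel's inequality. -/
theorem tsum_enorm_inner_sq_le {ι : Type*} {e : ι → K} (he : Orthonormal ℂ e) (x : K) :
    ∑' i, ‖⟪e i, x⟫_ℂ‖ₑ ^ 2 ≤ ‖x‖ₑ ^ 2 := by
  have h1 := ENNReal.ofReal_tsum_of_nonneg (fun i => sq_nonneg ‖⟪e i, x⟫_ℂ‖)
    (he.inner_products_summable x)
  have h2 : ∀ r : ℝ, 0 ≤ r → ENNReal.ofReal (r ^ 2) = ENNReal.ofReal r ^ 2 := fun r hr =>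
    ENNReal.ofReal_pow hr 2
  simp only [h2 _ (norm_nonneg _), ofReal_norm] at h1
  rw [← h1, ← ofReal_norm, ← h2 _ (norm_nonneg _)]
  exact ENNReal.ofReal_le_ofReal (he.tsum_inner_products_le x)

/-- Sums of squares over an orthonormal family are at most those of the adjoint over a basis. -/
theorem tsum_enorm_sq_le {ι κ : Type*} (A : K →L[ℂ] H) {e : ι → K} (he : Orthonormal ℂ e)
    (b : HilbertBasis κ ℂ H) :
    ∑' i, ‖A (e i)‖ₑ ^ 2 ≤ ∑' j, ‖A.adjoint (b j)‖ₑ ^ 2 := by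
  calc ∑' i, ‖A (e i)‖ₑ ^ 2 = ∑' i, ∑' j, ‖⟪b j, A (e i)⟫_ℂ‖ₑ ^ 2 := by
        simp_rw [enorm_sq_eq_tsum b]
    _ = ∑' j, ∑' i, ‖⟪b j, A (e i)⟫_ℂ‖ₑ ^ 2 := ENNReal.tsum_comm
    _ ≤ _ := by
      refine ENNReal.tsum_le_tsum fun j => ?_
      have : ∀ i, ‖⟪b j, A (e i)⟫_ℂ‖ₑ = ‖⟪e i, A.adjoint (b j)⟫_ℂ‖ₑ := by
        intro i
        rw [← ContinuousLinearMap.adjoint_inner_left, ← inner_conj_symm, RCLike.enorm_conj]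
      simp_rw [this]
      exact tsum_enorm_inner_sq_le he _

/-- The square root of the absolute value. -/
theorem exists_sqrt_abs (X : H →L[ℂ] H) :
    ∃ R : H →L[ℂ] H, R.adjoint = R ∧ (∀ x, R (R x) = CFC.abs X x) ∧
      traceNorm X = ∑' i, ‖R (onb H i)‖ₑ ^ 2 := by
  refine ⟨CFC.sqrt (CFC.abs X), ?_, ?_, ?_⟩
  · exact ((ContinuousLinearMap.nonneg_iff_isPositive _).1
      (CFC.sqrt_nonneg (CFC.abs X))).isSelfAdjoint
  · intro x
    exact congrArg (fun S : H →L[ℂ] H => S x)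
      (CFC.sqrt_mul_sqrt_self (CFC.abs X) (CFC.abs_nonneg X))
  · refine tsum_congr fun i => ?_
    have h1 := ((ContinuousLinearMap.nonneg_iff_isPositive _).1
      (CFC.sqrt_nonneg (CFC.abs X)))
    have h2 : CFC.abs X (onb H i) = CFC.sqrt (CFC.abs X) (CFC.sqrt (CFC.abs X) (onb H i)) :=
      (congrArg (fun S : H →L[ℂ] H => S (onb H i))
        (CFC.sqrt_mul_sqrt_self (CFC.abs X) (CFC.abs_nonneg X))).symm
    rw [h2, ← h1.inner_left_eq_inner_right, ← ofReal_norm,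
      ← ENNReal.ofReal_pow (norm_nonneg _)]
    congr 1
    exact inner_self_eq_norm_sq (𝕜 := ℂ) _

/-- Matrix elements of an operator with finite trace norm are absolutely summable. -/
theorem sum_enorm_inner_le {ι : Type*} (X : H →L[ℂ] H) {e : ι → K} (he : Orthonormal ℂ e)
    (V W : K →L[ℂ] H) (F : Finset ι) :
    2 * ∑ i ∈ F, ‖⟪V (e i), X (W (e i))⟫_ℂ‖ₑ ≤ (‖V‖ₑ ^ 2 + ‖W‖ₑ ^ 2) * traceNorm X := by
  obtain ⟨R, hRa, hRR, hRt⟩ := exists_sqrt_abs X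
  have hs : ∀ A : K →L[ℂ] H, ∑ i ∈ F, ‖R (A (e i))‖ₑ ^ 2 ≤ ‖A‖ₑ ^ 2 * traceNorm X := by
    intro A
    calc ∑ i ∈ F, ‖R (A (e i))‖ₑ ^ 2 ≤ ∑' i, ‖(R ∘L A) (e i)‖ₑ ^ 2 :=
          ENNReal.sum_le_tsum F
      _ ≤ ∑' j, ‖(R ∘L A).adjoint (onb H j)‖ₑ ^ 2 := tsum_enorm_sq_le _ he _
      _ ≤ ∑' j, ‖A‖ₑ ^ 2 * ‖R (onb H j)‖ₑ ^ 2 := by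
          refine ENNReal.tsum_le_tsum fun j => ?_
          rw [ContinuousLinearMap.adjoint_comp, hRa, ← mul_pow]
          gcongr
          refine (ContinuousLinearMap.le_opENorm A.adjoint (R (onb H j))).trans ?_
          rw [LinearIsometryEquiv.enorm_map]
      _ = _ := by rw [ENNReal.tsum_mul_left, hRt]
  refine ENNReal.le_of_forall_pos_le_add fun δ hδ _ => ?_
  set c : ℝ := 2 * (F.card * (‖V‖ * ‖W‖)) + 1 with hc
  have hc0 : 0 < c := by positivity
  obtain ⟨U, hU1, -, hU3⟩ := approx_polar X (ε := δ / c) (by positivity)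
  have hUn : ‖U‖ₑ ≤ 1 := by
    have : ‖U‖ ≤ 1 := U.opNorm_le_bound zero_le_one (by simpa using hU1)
    rw [← ofReal_norm]
    exact ENNReal.ofReal_le_one.2 this
  have hV : ‖U.adjoint ∘L V‖ₑ ≤ ‖V‖ₑ := by
    refine (ContinuousLinearMap.opENorm_comp_le _ _).trans ?_
    rw [LinearIsometryEquiv.enorm_map]
    calc ‖U‖ₑ * ‖V‖ₑ ≤ 1 * ‖V‖ₑ := by gcongr
      _ = _ := one_mul _
  have hterm : ∀ i, 2 * ‖⟪V (e i), X (W (e i))⟫_ℂ‖ₑ ≤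
      (‖R ((U.adjoint ∘L V) (e i))‖ₑ ^ 2 + ‖R (W (e i))‖ₑ ^ 2) +
        ENNReal.ofReal (2 * (‖V‖ * ‖W‖ * (δ / c))) := by
    intro i
    have e1 : ⟪V (e i), U (CFC.abs X (W (e i)))⟫_ℂ =
        ⟪R ((U.adjoint ∘L V) (e i)), R (W (e i))⟫_ℂ := by
      conv_rhs => rw [← ContinuousLinearMap.adjoint_inner_right, hRa, hRR]
      exact (ContinuousLinearMap.adjoint_inner_left U _ _).symm
    have e2 : ‖⟪V (e i), X (W (e i)) - U (CFC.abs X (W (e i)))⟫_ℂ‖ ≤ ‖V‖ * ‖W‖ * (δ / c) := by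
      have hei := he.norm_eq_one i
      have a1 := V.le_opNorm (e i)
      have a2 := W.le_opNorm (e i)
      rw [hei, mul_one] at a1 a2
      calc _ ≤ ‖V (e i)‖ * ‖X (W (e i)) - U (CFC.abs X (W (e i)))‖ := norm_inner_le_norm _ _
        _ ≤ ‖V‖ * (δ / c * ‖W‖) := by
            refine mul_le_mul a1 ((hU3 _).trans ?_) (norm_nonneg _) (norm_nonneg _)
            gcongr
        _ = _ := by ring
    have e3 : 2 * ‖⟪V (e i), X (W (e i))⟫_ℂ‖ ≤ ‖R ((U.adjoint ∘L V) (e i))‖ ^ 2 +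
        ‖R (W (e i))‖ ^ 2 + 2 * (‖V‖ * ‖W‖ * (δ / c)) := by
      have h1 : ⟪V (e i), X (W (e i))⟫_ℂ = ⟪R ((U.adjoint ∘L V) (e i)), R (W (e i))⟫_ℂ +
          ⟪V (e i), X (W (e i)) - U (CFC.abs X (W (e i)))⟫_ℂ := by
        rw [← e1, ← inner_add_right]; simp
      have h2 := norm_add_le (⟪R ((U.adjoint ∘L V) (e i)), R (W (e i))⟫_ℂ)
          (⟪V (e i), X (W (e i)) - U (CFC.abs X (W (e i)))⟫_ℂ)
      rw [← h1] at h2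
      have h3 := norm_inner_le_norm (𝕜 := ℂ) (R ((U.adjoint ∘L V) (e i))) (R (W (e i)))
      nlinarith [sq_nonneg (‖R ((U.adjoint ∘L V) (e i))‖ - ‖R (W (e i))‖)]
    have e4 := ENNReal.ofReal_le_ofReal e3
    rw [ENNReal.ofReal_add (by positivity) (by positivity),
      ENNReal.ofReal_add (by positivity) (by positivity), ENNReal.ofReal_mul (by norm_num),
      ENNReal.ofReal_pow (norm_nonneg _), ENNReal.ofReal_pow (norm_nonneg _)] at e4
    simpa only [ofReal_norm, ENNReal.ofReal_ofNat] using e4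
  rw [Finset.mul_sum]
  refine (Finset.sum_le_sum fun i _ => hterm i).trans ?_
  rw [Finset.sum_add_distrib, Finset.sum_add_distrib, add_mul]
  refine add_le_add (add_le_add ((hs _).trans ?_) (hs W)) ?_
  · gcongr
  · rw [Finset.sum_const, nsmul_eq_mul, ← ENNReal.ofReal_natCast, ← ENNReal.ofReal_mul (by positivity),
      ← ENNReal.ofReal_coe_nnreal]
    refine ENNReal.ofReal_le_ofReal ?_
    have : (F.card : ℝ) * (2 * (‖V‖ * ‖W‖ * (δ / c))) = (2 * (F.card * (‖V‖ * ‖W‖))) / c * δ := by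
      ring
    rw [this]
    have h1 : (2 * (F.card * (‖V‖ * ‖W‖))) / c ≤ 1 := by
      rw [div_le_one hc0]; linarith
    calc _ ≤ 1 * (δ : ℝ) := by gcongr
      _ = δ := one_mul _

/-- Bounded matrix elements against contractions bound the trace norm. -/
theorem traceNorm_le_of_forall (T : H →L[ℂ] H) (C : ℝ≥0∞)
    (h : ∀ U : H →L[ℂ] H, ‖U‖ₑ ≤ 1 → ∀ F : Finset (exists_hilbertBasis ℂ H).choose,
      ∑ i ∈ F, ‖⟪U (onb H i), T (onb H i)⟫_ℂ‖ₑ ≤ C) :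
    traceNorm T ≤ C := by
  rw [traceNorm, ENNReal.tsum_eq_iSup_sum]
  refine iSup_le fun F => ?_
  refine ENNReal.le_of_forall_pos_le_add fun δ hδ _ => ?_
  obtain ⟨U, hU1, hU2, -⟩ := approx_polar T (ε := δ / (F.card + 1)) (by positivity)
  have hUn : ‖U‖ₑ ≤ 1 := by
    have : ‖U‖ ≤ 1 := U.opNorm_le_bound zero_le_one (by simpa using hU1)
    rw [← ofReal_norm]
    exact ENNReal.ofReal_le_one.2 this
  have hterm : ∀ i, ENNReal.ofReal (⟪onb H i, CFC.abs T (onb H i)⟫_ℂ).re ≤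
      ‖⟪U (onb H i), T (onb H i)⟫_ℂ‖ₑ + ENNReal.ofReal (δ / (F.card + 1)) := by
    intro i
    rw [← ofReal_norm, ← ENNReal.ofReal_add (norm_nonneg _) (by positivity)]
    refine ENNReal.ofReal_le_ofReal ?_
    have hei := (onb H).orthonormal.norm_eq_one i
    have h1 : ⟪onb H i, CFC.abs T (onb H i)⟫_ℂ = ⟪U (onb H i), T (onb H i)⟫_ℂ +
        ⟪onb H i, CFC.abs T (onb H i) - U.adjoint (T (onb H i))⟫_ℂ := by
      rw [← ContinuousLinearMap.adjoint_inner_right, ← inner_add_right]; simp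
    have h2 := norm_inner_le_norm (𝕜 := ℂ) (onb H i)
      (CFC.abs T (onb H i) - U.adjoint (T (onb H i)))
    have h3 := hU2 (onb H i)
    rw [hei, one_mul] at h2
    rw [hei, mul_one] at h3
    calc _ ≤ ‖⟪onb H i, CFC.abs T (onb H i)⟫_ℂ‖ := Complex.re_le_norm _
      _ ≤ _ := by rw [h1]; exact (norm_add_le _ _).trans (by linarith)
  refine (Finset.sum_le_sum fun i _ => hterm i).trans ?_
  rw [Finset.sum_add_distrib]
  refine add_le_add (h U hUn F) ?_
  rw [Finset.sum_const, nsmul_eq_mul, ← ENNReal.ofReal_natCast,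
    ← ENNReal.ofReal_mul (by positivity), ← ENNReal.ofReal_coe_nnreal]
  refine ENNReal.ofReal_le_ofReal ?_
  rw [mul_div_left_comm]
  have h1 : (F.card : ℝ) / (F.card + 1) ≤ 1 := by
    rw [div_le_one (by positivity)]; linarith
  calc _ ≤ (δ : ℝ) * 1 := by gcongr
    _ = δ := mul_one _

/-- The trace norm is finite on two-sided products with a trace-class operator. -/
theorem traceNorm_comp_lt_top {X : H →L[ℂ] H} (hX : traceNorm X < ∞) (A : H →L[ℂ] K)
    (B : K →L[ℂ] H) : traceNorm (A ∘L X ∘L B) < ∞ := by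
  refine (traceNorm_le_of_forall _ ((‖A‖ₑ ^ 2 + ‖B‖ₑ ^ 2) * traceNorm X) ?_).trans_lt ?_
  · intro U hU F
    have h1 := sum_enorm_inner_le X (onb K).orthonormal (A.adjoint ∘L U) B F
    have h2 : ‖A.adjoint ∘L U‖ₑ ≤ ‖A‖ₑ := by
      refine (ContinuousLinearMap.opENorm_comp_le _ _).trans ?_
      rw [LinearIsometryEquiv.enorm_map]
      calc ‖A‖ₑ * ‖U‖ₑ ≤ ‖A‖ₑ * 1 := by gcongr
        _ = _ := mul_one _
    calc _ = ∑ i ∈ F, ‖⟪(A.adjoint ∘L U) (onb K i), X (B (onb K i))⟫_ℂ‖ₑ := by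
          refine Finset.sum_congr rfl fun i _ => ?_
          congr 1
          exact (ContinuousLinearMap.adjoint_inner_left A _ _).symm
      _ ≤ 2 * _ := le_mul_of_one_le_left' one_le_two
      _ ≤ _ := h1
      _ ≤ _ := by gcongr
  · exact ENNReal.mul_lt_top (ENNReal.add_lt_top.2
      ⟨ENNReal.pow_lt_top enorm_lt_top, ENNReal.pow_lt_top enorm_lt_top⟩) hX

theorem traceNorm_add_le (X Y : H →L[ℂ] H) : traceNorm (X + Y) ≤ traceNorm X + traceNorm Y := by
  refine traceNorm_le_of_forall _ _ fun U hU F => ?_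
  have key : ∀ Z : H →L[ℂ] H, ∑ i ∈ F, ‖⟪U (onb H i), Z (onb H i)⟫_ℂ‖ₑ ≤ traceNorm Z := by
    intro Z
    have h1 := sum_enorm_inner_le Z (onb H).orthonormal U (ContinuousLinearMap.id ℂ H) F
    have h2 : ‖ContinuousLinearMap.id ℂ H‖ₑ ≤ 1 := by
      rw [← ofReal_norm]
      exact ENNReal.ofReal_le_one.2 ContinuousLinearMap.norm_id_le
    have h3 : ‖U‖ₑ ^ 2 + ‖ContinuousLinearMap.id ℂ H‖ₑ ^ 2 ≤ 2 := by
      calc _ ≤ (1 : ℝ≥0∞) ^ 2 + 1 ^ 2 := by gcongr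
        _ = 2 := by norm_num
    have h4 := h1.trans (mul_le_mul_left h3 _)
    exact (ENNReal.mul_le_mul_iff_right (by norm_num) (by norm_num)).1 h4
  refine le_trans ?_ (add_le_add (key X) (key Y))
  rw [← Finset.sum_add_distrib]
  refine Finset.sum_le_sum fun i _ => ?_
  rw [add_apply, inner_add_right]
  exact enorm_add_le _ _

/-- Trace-class operators: the bounded operators of finite trace norm. -/
noncomputable def traceClass (H : Type*) [NormedAddCommGroup H] [InnerProductSpace ℂ H]
    [CompleteSpace H] : Submodule ℂ (H →L[ℂ] H) where
  carrier := {X | traceNorm X < ∞}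
  zero_mem' := by simp [traceNorm]
  add_mem' := fun {X Y} hX hY =>
    (traceNorm_add_le X Y).trans_lt (ENNReal.add_lt_top.2 ⟨hX, hY⟩)
  smul_mem' := by
    intro c X hX
    have h := traceNorm_comp_lt_top hX (c • ContinuousLinearMap.id ℂ H)
      (ContinuousLinearMap.id ℂ H)
    have e : (c • ContinuousLinearMap.id ℂ H) ∘L X ∘L ContinuousLinearMap.id ℂ H = c • X := by
      ext x; simp
    rwa [e] at h

/-- The compression `P X P` of a trace-class operator to a closed subspace `S`. -/
noncomputable def compress (S : Submodule ℂ H) [CompleteSpace S] (X : traceClass H) :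
    traceClass S :=
  ⟨S.orthogonalProjectionOnto ∘L X.1 ∘L S.subtypeL, traceNorm_comp_lt_top X.2 _ _⟩

/-- The operator `A ⊕ 0` on `H` for an operator `A` on a closed subspace `S`. -/
noncomputable def extendZero (S : Submodule ℂ H) [CompleteSpace S] (A : S →L[ℂ] S) :
    H →L[ℂ] H :=
  S.subtypeL ∘L A ∘L S.orthogonalProjectionOnto

/-- The rank-one operator `|v⟩⟨v|`. -/
noncomputable def ketBra (v : H) : traceClass H :=
  ⟨InnerProductSpace.rankOne ℂ v v, by
    change traceNorm _ < ∞
    have h0 : CFC.abs (InnerProductSpace.rankOne ℂ v v) = InnerProductSpace.rankOne ℂ v v :=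
      CFC.abs_of_nonneg _ ((ContinuousLinearMap.nonneg_iff_isPositive _).2
        (InnerProductSpace.isPositive_rankOne_self v))
    have h1 : traceNorm (InnerProductSpace.rankOne ℂ v v) = ‖v‖ₑ ^ 2 := by
      rw [enorm_sq_eq_tsum (onb H), traceNorm, h0]
      refine tsum_congr fun i => ?_
      rw [← ofReal_norm, ← ENNReal.ofReal_pow (norm_nonneg _)]
      congr 1
      rw [InnerProductSpace.rankOne_apply, inner_smul_right, ← inner_conj_symm v, Complex.conj_mul',
        ← Complex.ofReal_pow, Complex.ofReal_re]
    rw [h1]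
    exact ENNReal.pow_lt_top enorm_lt_top⟩

end TraceClass

section Dual

variable {H : Type*} [NormedAddCommGroup H] [InnerProductSpace ℂ H] [CompleteSpace H]

/-- The dual `H*` is a Hilbert space with `⟪⟨x|, ⟨y|⟫ = ⟪y, x⟫`. -/
noncomputable instance dualInnerProductSpace : InnerProductSpace ℂ (StrongDual ℂ H) where
  inner φ ψ := ⟪(InnerProductSpace.toDual ℂ H).symm ψ, (InnerProductSpace.toDual ℂ H).symm φ⟫_ℂ
  norm_sq_eq_re_inner φ := by
    rw [← LinearIsometryEquiv.norm_map (InnerProductSpace.toDual ℂ H).symm φ]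
    exact norm_sq_eq_re_inner (𝕜 := ℂ) _
  conj_inner_symm φ ψ := inner_conj_symm _ _
  add_left φ ψ χ := by simp
  smul_left φ ψ c := by rw [map_smulₛₗ, inner_smul_right]

/-- The transpose `Xᵀ φ = φ ∘ X` on the dual space. -/
noncomputable def transpose (X : H →L[ℂ] H) : StrongDual ℂ H →L[ℂ] StrongDual ℂ H :=
  (ContinuousLinearMap.compL ℂ H H ℂ).flip X

theorem transpose_apply (X : H →L[ℂ] H) (φ : StrongDual ℂ H) (x : H) :
    transpose X φ x = φ (X x) := rfl

/-- The transpose of a trace-class operator. -/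
noncomputable def transposeT (X : traceClass H) : traceClass (StrongDual ℂ H) :=
  ⟨transpose X.1, by
    set J := InnerProductSpace.toDual ℂ H with hJ
    have hinner : ∀ φ ψ : StrongDual ℂ H, ⟪φ, ψ⟫_ℂ = ⟪J.symm ψ, J.symm φ⟫_ℂ := fun _ _ => rfl
    set b := onb (StrongDual ℂ H) with hb
    have he : Orthonormal ℂ fun i => J.symm (b i) := by
      refine ⟨fun i => ?_, fun i j hij => ?_⟩
      · rw [LinearIsometryEquiv.norm_map, b.orthonormal.norm_eq_one]
      · change ⟪J.symm (b i), J.symm (b j)⟫_ℂ = 0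
        rw [← hinner]; exact b.orthonormal.2 hij.symm
    refine (traceNorm_le_of_forall _ (2 * traceNorm X.1) ?_).trans_lt
      (ENNReal.mul_lt_top (by norm_num) X.2)
    intro U hU F
    let U' : H →L[ℂ] H := J.symm.toContinuousLinearEquiv.toContinuousLinearMap.comp
      (U.comp J.toContinuousLinearEquiv.toContinuousLinearMap)
    have hU'e : ∀ i, U' (J.symm (b i)) = J.symm (U (b i)) := fun i => by simp [U']
    have hUn : ‖U‖ ≤ 1 := by
      rw [← ofReal_norm] at hU
      exact ENNReal.ofReal_le_one.1 hU
    have hU' : ‖U'‖ₑ ≤ 1 := by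
      have : ‖U'‖ ≤ 1 := by
        refine U'.opNorm_le_bound zero_le_one fun x => ?_
        have : U' x = J.symm (U (J x)) := rfl
        rw [this, LinearIsometryEquiv.norm_map]
        refine (U.le_of_opNorm_le hUn _).trans ?_
        rw [LinearIsometryEquiv.norm_map]
      rw [← ofReal_norm]
      exact ENNReal.ofReal_le_one.2 this
    have h2 : ‖ContinuousLinearMap.id ℂ H‖ₑ ≤ 1 := by
      rw [← ofReal_norm]
      exact ENNReal.ofReal_le_one.2 ContinuousLinearMap.norm_id_le
    have h3 : ‖ContinuousLinearMap.id ℂ H‖ₑ ^ 2 + ‖U'‖ₑ ^ 2 ≤ 2 := by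
      calc _ ≤ (1 : ℝ≥0∞) ^ 2 + 1 ^ 2 := by gcongr
        _ = 2 := by norm_num
    have h1 := sum_enorm_inner_le X.1 he (ContinuousLinearMap.id ℂ H) U' F
    calc ∑ i ∈ F, ‖⟪U (b i), transpose X.1 (b i)⟫_ℂ‖ₑ
        = ∑ i ∈ F, ‖⟪J.symm (b i), X.1 (U' (J.symm (b i)))⟫_ℂ‖ₑ := by
          refine Finset.sum_congr rfl fun i _ => ?_
          rw [hinner, hU'e, hJ, InnerProductSpace.toDual_symm_apply,
            InnerProductSpace.toDual_symm_apply, transpose_apply]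
      _ ≤ 2 * _ := le_mul_of_one_le_left' one_le_two
      _ ≤ _ := h1
      _ ≤ _ := by gcongr⟩

end Dual

section Tensor

variable {H K L M : Type*}
  [NormedAddCommGroup H] [InnerProductSpace ℂ H] [CompleteSpace H]
  [NormedAddCommGroup K] [InnerProductSpace ℂ K] [CompleteSpace K]
  [NormedAddCommGroup L] [InnerProductSpace ℂ L] [CompleteSpace L]
  [NormedAddCommGroup M] [InnerProductSpace ℂ M] [CompleteSpace M]

/-- The Hilbert space tensor product. -/
def HTensor (K L : Type*) [NormedAddCommGroup K] [InnerProductSpace ℂ K]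
    [NormedAddCommGroup L] [InnerProductSpace ℂ L] : Type _ :=
  UniformSpace.Completion (K ⊗[ℂ] L)

noncomputable instance : NormedAddCommGroup (HTensor K L) :=
  inferInstanceAs (NormedAddCommGroup (UniformSpace.Completion (K ⊗[ℂ] L)))

noncomputable instance : InnerProductSpace ℂ (HTensor K L) :=
  inferInstanceAs (InnerProductSpace ℂ (UniformSpace.Completion (K ⊗[ℂ] L)))

instance : CompleteSpace (HTensor K L) :=
  inferInstanceAs (CompleteSpace (UniformSpace.Completion (K ⊗[ℂ] L)))

/-- The isometric, dense embedding of the algebraic tensor product. -/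
noncomputable def toHTensor (K L : Type*) [NormedAddCommGroup K] [InnerProductSpace ℂ K]
    [NormedAddCommGroup L] [InnerProductSpace ℂ L] : K ⊗[ℂ] L →L[ℂ] HTensor K L :=
  UniformSpace.Completion.toComplL

/-- The simple tensor `x ⊗ y` in the Hilbert space tensor product. -/
noncomputable def htmul (x : K) (y : L) : HTensor K L := toHTensor K L (x ⊗ₜ[ℂ] y)

theorem inner_htmul (x x' : K) (y y' : L) :
    ⟪htmul x y, htmul x' y'⟫_ℂ = ⟪x, x'⟫_ℂ * ⟪y, y'⟫_ℂ :=
  (UniformSpace.Completion.inner_coe (𝕜 := ℂ) (x ⊗ₜ[ℂ] y) (x' ⊗ₜ[ℂ] y')).trans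
    (by simp)

theorem norm_htmul (x : K) (y : L) : ‖htmul x y‖ = ‖x‖ * ‖y‖ :=
  (UniformSpace.Completion.norm_coe (x ⊗ₜ[ℂ] y)).trans (TensorProduct.norm_tmul x y)

/-- The tensor product `A ⊗ B` of bounded operators. -/
noncomputable def opTensor (A : K →L[ℂ] H) (B : L →L[ℂ] M) : HTensor K L →L[ℂ] HTensor H M :=
  (TensorProduct.mapL A B).completion

theorem opTensor_htmul (A : K →L[ℂ] H) (B : L →L[ℂ] M) (x : K) (y : L) :
    opTensor A B (htmul x y) = htmul (A x) (B y) :=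
  ContinuousLinearMap.completion_apply_coe (TensorProduct.mapL A B) (x ⊗ₜ[ℂ] y)

/-- Continuous linear maps on the tensor product agree if they agree on simple tensors. -/
theorem ext_htmul {E : Type*} [NormedAddCommGroup E] [NormedSpace ℂ E]
    {S T : HTensor K L →L[ℂ] E} (h : ∀ x y, S (htmul x y) = T (htmul x y)) : S = T := by
  refine ContinuousLinearMap.ext fun v => ?_
  refine UniformSpace.Completion.induction_on (p := fun v : HTensor K L => S v = T v) v ?_ ?_
  · exact isClosed_eq S.continuous T.continuous
  · intro a
    change S (toHTensor K L a) = T (toHTensor K L a)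
    induction a using TensorProduct.induction_on with
    | zero => simp
    | tmul x y => exact h x y
    | add a b ha hb => rw [map_add, map_add, map_add, ha, hb]

theorem ext_inner_htmul {v w : HTensor K L}
    (h : ∀ x y, ⟪v, htmul x y⟫_ℂ = ⟪w, htmul x y⟫_ℂ) : v = w := by
  have : innerSL ℂ v = innerSL ℂ w := ext_htmul fun x y => h x y
  exact (innerSL_inj (𝕜 := ℂ)).1 this

theorem adjoint_opTensor (A : K →L[ℂ] H) (B : L →L[ℂ] M) :
    (opTensor A B).adjoint = opTensor A.adjoint B.adjoint := by
  refine ext_htmul fun x y => ext_inner_htmul fun k l => ?_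
  rw [ContinuousLinearMap.adjoint_inner_left, opTensor_htmul, opTensor_htmul, inner_htmul,
    inner_htmul, ContinuousLinearMap.adjoint_inner_left, ContinuousLinearMap.adjoint_inner_left]

theorem clm_eq_zero_of_basis {ι E : Type*} [NormedAddCommGroup E] [NormedSpace ℂ E]
    (b : HilbertBasis ι ℂ K) (S : K →L[ℂ] E) (h : ∀ i, S (b i) = 0) : S = 0 := by
  refine ContinuousLinearMap.ext_on (s := Set.range b) ?_ ?_
  · rw [Submodule.dense_iff_topologicalClosure_eq_top]
    exact b.dense_span
  · rintro _ ⟨i, rfl⟩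
    rw [h i]; rfl

/-- The product of two Hilbert bases. -/
theorem exists_tensor_basis {ι κ : Type*} (e : HilbertBasis ι ℂ K) (f : HilbertBasis κ ℂ L) :
    ∃ g : HilbertBasis (ι × κ) ℂ (HTensor K L), ∀ p, g p = htmul (e p.1) (f p.2) := by
  classical
  have ho : Orthonormal ℂ fun p : ι × κ => (htmul (e p.1) (f p.2) : HTensor K L) := by
    rw [orthonormal_iff_ite]
    rintro ⟨i, j⟩ ⟨i', j'⟩
    rw [inner_htmul, orthonormal_iff_ite.1 e.orthonormal, orthonormal_iff_ite.1 f.orthonormal]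
    by_cases h1 : i = i' <;> by_cases h2 : j = j' <;> simp [h1, h2]
  refine ⟨HilbertBasis.mkOfOrthogonalEqBot ho ?_, fun p => by
    rw [HilbertBasis.coe_mkOfOrthogonalEqBot]⟩
  rw [eq_bot_iff]
  intro v hv
  rw [Submodule.mem_bot]
  have hv' : ∀ i j, ⟪v, htmul (e i) (f j)⟫_ℂ = 0 := fun i j =>
    Submodule.inner_left_of_mem_orthogonal
      (Submodule.subset_span (Set.mem_range_self (i, j))) hv
  let S : K →L[ℂ] L →L[ℂ] ℂ :=
    (ContinuousLinearMap.compL ℂ L (K ⊗[ℂ] L) ℂ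
      ((innerSL ℂ v).comp (toHTensor K L))).comp (TensorProduct.mkL ℂ K L)
  have hS : ∀ x y, S x y = ⟪v, htmul x y⟫_ℂ := fun x y => rfl
  have hS0 : S = 0 := clm_eq_zero_of_basis e S fun i =>
    clm_eq_zero_of_basis f (S (e i)) fun j => hv' i j
  refine ext_inner_htmul fun x y => ?_
  rw [← hS, hS0]
  simp

/-- The tensor product of trace-class operators. -/
noncomputable def tensorT (X : traceClass K) (Y : traceClass L) : traceClass (HTensor K L) :=
  ⟨opTensor X.1 Y.1, by
    obtain ⟨R, hR, hRR, hRt⟩ := exists_sqrt_abs X.1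
    obtain ⟨Q, hQ, hQQ, hQt⟩ := exists_sqrt_abs Y.1
    have hadj : (opTensor R Q).adjoint = opTensor R Q := by rw [adjoint_opTensor, hR, hQ]
    have habs : CFC.abs (opTensor X.1 Y.1) = opTensor R Q ∘L opTensor R Q := by
      refine abs_eq_of_sq _ _ ?_ fun v => ?_
      · have := ContinuousLinearMap.isPositive_self_comp_adjoint (opTensor R Q)
        rwa [hadj] at this
      · have : (opTensor R Q ∘L opTensor R Q) ∘L (opTensor R Q ∘L opTensor R Q) =
            (opTensor X.1 Y.1).adjoint ∘L opTensor X.1 Y.1 := by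
          rw [adjoint_opTensor]
          refine ext_htmul fun x y => ?_
          simp only [ContinuousLinearMap.comp_apply, opTensor_htmul, hRR, hQQ, abs_sq_apply]
        exact congrArg (fun S : HTensor K L →L[ℂ] HTensor K L => S v) this
    obtain ⟨g, hg⟩ := exists_tensor_basis (onb K) (onb L)
    have h1 : traceNorm (opTensor X.1 Y.1) = ∑' i, ‖opTensor R Q (onb (HTensor K L) i)‖ₑ ^ 2 := by
      refine tsum_congr fun i => ?_
      rw [habs, ContinuousLinearMap.comp_apply, ← ContinuousLinearMap.adjoint_inner_left, hadj,
        ← ofReal_norm, ← ENNReal.ofReal_pow (norm_nonneg _)]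
      congr 1
      exact inner_self_eq_norm_sq (𝕜 := ℂ) _
    have h2 := tsum_enorm_sq_le (opTensor R Q) (onb (HTensor K L)).orthonormal g
    have h3 : ∑' p, ‖(opTensor R Q).adjoint (g p)‖ₑ ^ 2 = traceNorm X.1 * traceNorm Y.1 := by
      rw [hRt, hQt, ENNReal.tsum_prod', ← ENNReal.tsum_mul_right]
      refine tsum_congr fun i => ?_
      rw [← ENNReal.tsum_mul_left]
      refine tsum_congr fun j => ?_
      rw [hadj, hg, opTensor_htmul, ← ofReal_norm, norm_htmul,
        ENNReal.ofReal_mul (norm_nonneg _), ofReal_norm, ofReal_norm, mul_pow]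
    change traceNorm _ < ∞
    rw [h1]
    refine h2.trans_lt ?_
    rw [h3]
    exact ENNReal.mul_lt_top X.2 Y.2⟩

end Tensor

section Channels

variable {H K L : Type*}
  [NormedAddCommGroup H] [InnerProductSpace ℂ H] [CompleteSpace H]
  [NormedAddCommGroup K] [InnerProductSpace ℂ K] [CompleteSpace K]
  [NormedAddCommGroup L] [InnerProductSpace ℂ L] [CompleteSpace L]

/-- States: positive trace-class operators of unit trace. -/
def IsState (ρ : traceClass H) : Prop := ρ.1.IsPositive ∧ trace ρ.1 = 1

/-- The support of a bounded operator: the closure of its range. -/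
def supp (A : H →L[ℂ] H) : Submodule ℂ H := A.range.topologicalClosure

instance (A : H →L[ℂ] H) : CompleteSpace (supp A) :=
  Submodule.topologicalClosure.completeSpace _

/-- Boundedness (equivalently, continuity) with respect to the trace norms. -/
def IsTraceNormBounded (Φ : traceClass K →ₗ[ℂ] traceClass H) : Prop :=
  ∃ C : ℝ≥0, ∀ X, traceNorm (Φ X).1 ≤ C * traceNorm X.1

/-- Complete positivity: for every `n`, applying `Φ` entrywise sends positive `n × n` block
operators to positive block operators. -/
def IsCompletelyPositive (Φ : traceClass K →ₗ[ℂ] traceClass H) : Prop :=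
  ∀ (n : ℕ) (X : Fin n → Fin n → traceClass K),
    (∀ v : Fin n → K, 0 ≤ ∑ i, ∑ j, ⟪v i, (X i j).1 (v j)⟫_ℂ) →
      ∀ w : Fin n → H, 0 ≤ ∑ i, ∑ j, ⟪w i, (Φ (X i j)).1 (w j)⟫_ℂ

/-- Quantum channels: completely positive and trace preserving linear maps. -/
def IsChannel (Φ : traceClass K →ₗ[ℂ] traceClass H) : Prop :=
  IsCompletelyPositive Φ ∧ ∀ X, trace (Φ X).1 = trace X.1

/-- `D = Φ†`, that is, `tr (Φ(X) A) = tr (X Φ†(A))` for all trace-class `X` and bounded `A`. -/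
def IsAdjointMap (Φ : traceClass K →ₗ[ℂ] traceClass H)
    (D : (H →L[ℂ] H) →ₗ[ℂ] (K →L[ℂ] K)) : Prop :=
  ∀ (X : traceClass K) (A : H →L[ℂ] H), trace ((Φ X).1 ∘L A) = trace (X.1 ∘L D A)

/-- `Ψ = Φ ⊗ id`: the trace-norm continuous linear map with `Ψ(X ⊗ Y) = Φ(X) ⊗ Y`. -/
def IsTensorId (Φ : traceClass K →ₗ[ℂ] traceClass H)
    (Ψ : traceClass (HTensor K L) →ₗ[ℂ] traceClass (HTensor H L)) : Prop :=
  IsTraceNormBounded Ψ ∧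
    ∀ (X : traceClass K) (Y : traceClass L), Ψ (tensorT X Y) = tensorT (Φ X) Y

/-- `v ∈ K ⊗ H*` is the vector `|T⟫` corresponding to the Hilbert–Schmidt operator `T : H → K`
under the isomorphism that identifies `ψ ⊗ η` with the operator `x ↦ η(x) ψ`; equivalently,
`⟪ψ ⊗ ⟨x|, v⟫ = ⟪ψ, T x⟫` for all `ψ ∈ K` and `x ∈ H`. -/
def IsVectorOf (T : H →L[ℂ] K) (v : HTensor K (StrongDual ℂ H)) : Prop :=
  ∀ (ψ : K) (x : H), ⟪htmul ψ (InnerProductSpace.toDual ℂ H x), v⟫_ℂ = ⟪ψ, T x⟫_ℂ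

/-- `P = P_Φ = (Φ ⊗ id)(|√ρ⟫⟪√ρ|)` for a map `Φ` on the trace-class operators on `supp ρ`, where
`√ρ` is regarded as an operator from `H` to `supp ρ`. -/
def IsCouplingOfChannel (ρ : traceClass H) (Φ : traceClass (supp ρ.1) →ₗ[ℂ] traceClass H)
    (P : traceClass (HTensor H (StrongDual ℂ H))) : Prop :=
  ∃ (v : HTensor (supp ρ.1) (StrongDual ℂ H))
    (Ψ : traceClass (HTensor (supp ρ.1) (StrongDual ℂ H)) →ₗ[ℂ]
      traceClass (HTensor H (StrongDual ℂ H))),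
    IsVectorOf ((supp ρ.1).orthogonalProjectionOnto ∘L CFC.sqrt ρ.1) v ∧
      IsTensorId Φ Ψ ∧ P = Ψ (ketBra v)

/-- `P ∈ C(ρ, ω)`: a state on `H ⊗ H*` with partial traces `tr_{H*} P = ω` and `tr_H P = ρᵀ`. -/
def IsCoupling (ρ ω : traceClass H) (P : traceClass (HTensor H (StrongDual ℂ H))) : Prop :=
  IsState P ∧
    (∀ x y : H, HasSum (fun i => ⟪htmul x (onb (StrongDual ℂ H) i),
      P.1 (htmul y (onb (StrongDual ℂ H) i))⟫_ℂ) ⟪x, ω.1 y⟫_ℂ) ∧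
    (∀ φ ψ : StrongDual ℂ H, HasSum (fun i => ⟪htmul (onb H i) φ, P.1 (htmul (onb H i) ψ)⟫_ℂ)
      ⟪φ, transpose ρ.1 ψ⟫_ℂ)

/-- The swap transposition: the trace-norm continuous linear map with
`X ⊗ Yᵀ ↦ Y ⊗ Xᵀ`. -/
def IsSwapTranspose (S : traceClass (HTensor H (StrongDual ℂ H)) →ₗ[ℂ]
    traceClass (HTensor H (StrongDual ℂ H))) : Prop :=
  IsTraceNormBounded S ∧
    ∀ X Y : traceClass H, S (tensorT X (transposeT Y)) = tensorT Y (transposeT X)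

/-- `v = ω^{-1/2} u`, where `ω^{-1/2}` is the (in general unbounded) pseudo-inverse of `√ω`:
`v ∈ supp ω`, and `√ω v` is the orthogonal projection of `u` to `supp ω`. The domain consists of
the vectors `u` for which such a `v` exists. -/
def IsPinvSqrtApply (ω : H →L[ℂ] H) (u v : H) : Prop :=
  v ∈ supp ω ∧ CFC.sqrt ω v = (supp ω).orthogonalProjectionOnto u

/-- `B` is the bounded operator `ω^{-1/2} X ω^{-1/2}`: on the dense domain of `ω^{-1/2}`,
`B u = ω^{-1/2} (X (ω^{-1/2} u))`. -/
def IsPinvSandwich (ω X B : H →L[ℂ] H) : Prop :=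
  ∀ u v : H, IsPinvSqrtApply ω u v → IsPinvSqrtApply ω (X v) (B u)

/-- The span of the operators `|g⟩⟨g'|` with `g, g'` eigenvectors of `ω` for positive
eigenvalues. It is dense in the trace-class operators on `supp ω`, and equal to all of them if
`ω` has finite rank. -/
def eigenSpan (ω : H →L[ℂ] H) : Submodule ℂ (H →L[ℂ] H) :=
  Submodule.span ℂ {T | ∃ (g g' : H) (μ μ' : ℝ), 0 < μ ∧ 0 < μ' ∧ ω g = (μ : ℂ) • g ∧
    ω g' = (μ' : ℂ) • g' ∧ T = InnerProductSpace.rankOne ℂ g g'}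

/-- `R` is the Petz recovery map of `Φ` and `ρ`, with `ω = Φ(ρ)`: it is trace-norm continuous, and
`R(X) = ρ^{1/2} Φ†(ω^{-1/2} X ω^{-1/2}) ρ^{1/2}` on the span above. -/
def IsPetzRecovery (ρ ω : traceClass H) (Φ : traceClass (supp ρ.1) →ₗ[ℂ] traceClass H)
    (R : traceClass (supp ω.1) →ₗ[ℂ] traceClass H) : Prop :=
  IsTraceNormBounded R ∧
    ∃ D : (H →L[ℂ] H) →ₗ[ℂ] (supp ρ.1 →L[ℂ] supp ρ.1), IsAdjointMap Φ D ∧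
      ∀ X : traceClass (supp ω.1), extendZero (supp ω.1) X.1 ∈ eigenSpan ω.1 →
        ∃ B : H →L[ℂ] H, IsPinvSandwich ω.1 (extendZero (supp ω.1) X.1) B ∧
          (R X).1 = CFC.sqrt ρ.1 ∘L extendZero (supp ρ.1) (D B) ∘L CFC.sqrt ρ.1

end Channels

end QuantumTransport

open QuantumTransport

/-!
A channel and its Petz recovery map have matching Kraus operators, and on these the swap
transposition is the passage from an operator to its adjoint.

Every channel is a Kraus map `Φ(X) = ∑ₖ Aₖ X Aₖ*` (`IsChannel.exists_kraus`). By complete positivity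
the operator-valued kernel `(a, b) ↦ Φ(|a⟩⟨b|)` is positive semidefinite, so its reproducing kernel
Hilbert space factors it as `W a* W b`, and the `Aₖ` are the coordinates of `a ↦ W a*` in an
orthonormal basis. In this form `Φ ⊗ id` has the Kraus operators `Aₖ ⊗ 1`, and
`Π_Φ = ∑ₖ |Aₖ √ρ⟫⟪Aₖ √ρ|` (`IsCouplingOfChannel.hasSum_inner`). Its marginals are
`∑ₖ (Aₖ √ρ)(Aₖ √ρ)* = Φ(ρ) = ω` and the transpose of `∑ₖ (Aₖ √ρ)*(Aₖ √ρ) = ρ`, by the normalization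
`∑ₖ Aₖ* Aₖ = 1`.

Since `∑ₖ ‖(Aₖ √ρ)* x‖² = ⟪x, ω x⟫ = ‖√ω x‖²`, Douglas' factorization gives contractions `Bₖ` on
`supp ω` with `Bₖ √ω = (Aₖ √ρ)* = √ρ Aₖ*`, and the same identity says that the `Bₖ` are again Kraus
operators of a channel (`exists_petz_kraus`). This channel is the Petz recovery map
(`isPetzRecovery_krausMap`): for `X = √ω C √ω` one has `Bₖ X Bₖ* = √ρ Aₖ* C Aₖ √ρ`. It takes `ω` to
`ρ`, and `Π_rec = ∑ₖ |(Aₖ √ρ)*⟫⟪(Aₖ √ρ)*|`.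

The antiunitary involution `J (a ⊗ ⟨b|) = b ⊗ ⟨a|` of `H ⊗ H*` corresponds to `T ↦ T*` for
Hilbert–Schmidt operators (`exists_swap_conj`), and the swap transposition is `Z ↦ J Z* J`
(`exists_isSwapTranspose`). Hence it takes `|T⟫⟪T|` to `|T*⟫⟪T*|`, and `Π_Φ` to `Π_rec`
(`eq_of_swap_conj`).

All uniqueness claims rest on one density fact: a trace-norm continuous map is determined by its
values on `|a⟩⟨b|` for `a`, `b` in a total set (`IsTraceNormBounded.ext_of_dense`). For the Petz
recovery map the total set consists of the eigenvectors of `ω`, by the spectral theorem for compact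
operators. The facts about trace-class operators come from the factorization of such an operator as
a product of two Hilbert–Schmidt operators (`exists_hsSq_factor`).
-/

set_option linter.unusedSectionVars false

namespace QuantumTransport

/-! ### Hilbert–Schmidt operators and the trace norm -/

section HilbertSchmidt

variable {H K L M : Type*}
  [NormedAddCommGroup H] [InnerProductSpace ℂ H] [CompleteSpace H]
  [NormedAddCommGroup K] [InnerProductSpace ℂ K] [CompleteSpace K]
  [NormedAddCommGroup L] [InnerProductSpace ℂ L] [CompleteSpace L]
  [NormedAddCommGroup M] [InnerProductSpace ℂ M] [CompleteSpace M]

/-- The square of the Hilbert–Schmidt norm, with values in `[0, ∞]`. -/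
noncomputable def hsSq (A : K →L[ℂ] H) : ℝ≥0∞ := ∑' i, ‖A (onb K i)‖ₑ ^ 2

theorem hsSq_adjoint (A : K →L[ℂ] H) : hsSq A.adjoint = hsSq A := by
  refine le_antisymm ?_ (tsum_enorm_sq_le A (onb K).orthonormal (onb H))
  have h := tsum_enorm_sq_le A.adjoint (onb H).orthonormal (onb K)
  rwa [ContinuousLinearMap.adjoint_adjoint] at h

theorem tsum_orthonormal_le_hsSq {ι : Type*} (A : K →L[ℂ] H) {e : ι → K}
    (he : Orthonormal ℂ e) : ∑' i, ‖A (e i)‖ₑ ^ 2 ≤ hsSq A := by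
  rw [← hsSq_adjoint]
  exact tsum_enorm_sq_le A he (onb H)

/-- The Hilbert–Schmidt norm may be computed in any Hilbert basis. -/
theorem hsSq_eq_tsum {ι : Type*} (A : K →L[ℂ] H) (b : HilbertBasis ι ℂ K) :
    hsSq A = ∑' i, ‖A (b i)‖ₑ ^ 2 := by
  refine le_antisymm ?_ (tsum_orthonormal_le_hsSq A b.orthonormal)
  rw [← hsSq_adjoint]
  have h := tsum_enorm_sq_le A.adjoint (onb H).orthonormal b
  rwa [ContinuousLinearMap.adjoint_adjoint] at h

theorem hsSq_comp_le (B : H →L[ℂ] L) (A : K →L[ℂ] H) : hsSq (B ∘L A) ≤ ‖B‖ₑ ^ 2 * hsSq A := by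
  rw [hsSq, hsSq, ← ENNReal.tsum_mul_left]
  refine ENNReal.tsum_le_tsum fun i => ?_
  rw [← mul_pow]
  gcongr
  exact ContinuousLinearMap.le_opENorm B _

theorem hsSq_comp_le' (A : H →L[ℂ] L) (B : K →L[ℂ] H) : hsSq (A ∘L B) ≤ ‖B‖ₑ ^ 2 * hsSq A := by
  rw [← hsSq_adjoint, ContinuousLinearMap.adjoint_comp, ← hsSq_adjoint A,
    ← LinearIsometryEquiv.enorm_map ContinuousLinearMap.adjoint B]
  exact hsSq_comp_le _ _

theorem enorm_apply_sq_le_hsSq (A : K →L[ℂ] H) (x : K) : ‖A x‖ₑ ^ 2 ≤ ‖x‖ₑ ^ 2 * hsSq A := by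
  have h1 : ‖A x‖ₑ ^ 2 ≤ ∑' i, ‖⟪A.adjoint (onb H i), x⟫_ℂ‖ₑ ^ 2 := by
    rw [enorm_sq_eq_tsum (onb H)]
    simp_rw [ContinuousLinearMap.adjoint_inner_left]
    rfl
  refine h1.trans ?_
  rw [← hsSq_adjoint, hsSq, ← ENNReal.tsum_mul_left]
  refine ENNReal.tsum_le_tsum fun i => ?_
  rw [← mul_pow, mul_comm]
  gcongr
  rw [← ofReal_norm, ← ofReal_norm, ← ofReal_norm, ← ENNReal.ofReal_mul (norm_nonneg _)]
  exact ENNReal.ofReal_le_ofReal (norm_inner_le_norm _ _)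

theorem enorm_sq_le_hsSq (A : K →L[ℂ] H) : ‖A‖ₑ ^ 2 ≤ hsSq A := by
  by_cases hA : hsSq A = ∞
  · rw [hA]; exact le_top
  lift hsSq A to ℝ≥0 using hA with c hc
  have h : ‖A‖ ≤ Real.sqrt (c : ℝ) := by
    refine A.opNorm_le_bound (Real.sqrt_nonneg _) fun x => ?_
    have h1 := enorm_apply_sq_le_hsSq A x
    rw [← hc, enorm_eq_nnnorm, enorm_eq_nnnorm] at h1
    have h2 : ‖A x‖ ^ 2 ≤ ‖x‖ ^ 2 * (c : ℝ) := by
      have : ‖A x‖₊ ^ 2 ≤ ‖x‖₊ ^ 2 * c := by exact_mod_cast h1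
      exact_mod_cast this
    refine (sq_le_sq₀ (norm_nonneg _) (by positivity)).1 ?_
    rw [mul_pow, Real.sq_sqrt c.coe_nonneg, mul_comm]
    exact h2
  have h2 : ‖A‖ ^ 2 ≤ (c : ℝ) := by
    calc ‖A‖ ^ 2 ≤ Real.sqrt (c : ℝ) ^ 2 := by gcongr
      _ = (c : ℝ) := Real.sq_sqrt c.coe_nonneg
  have h3 : ‖A‖₊ ^ 2 ≤ c := by exact_mod_cast h2
  rw [enorm_eq_nnnorm]
  exact_mod_cast h3

theorem two_mul_enorm_inner_le (x y : H) : 2 * ‖⟪x, y⟫_ℂ‖ₑ ≤ ‖x‖ₑ ^ 2 + ‖y‖ₑ ^ 2 := by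
  have h1 := norm_inner_le_norm (𝕜 := ℂ) x y
  have h2 : 2 * ‖⟪x, y⟫_ℂ‖ ≤ ‖x‖ ^ 2 + ‖y‖ ^ 2 := by
    nlinarith [sq_nonneg (‖x‖ - ‖y‖)]
  have h3 := ENNReal.ofReal_le_ofReal h2
  rw [ENNReal.ofReal_add (by positivity) (by positivity), ENNReal.ofReal_mul (by norm_num),
    ENNReal.ofReal_pow (norm_nonneg _), ENNReal.ofReal_pow (norm_nonneg _)] at h3
  simpa only [ofReal_norm, ENNReal.ofReal_ofNat] using h3

/-- Douglas' factorization lemma. -/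
theorem exists_factor_of_norm_le (T : H →L[ℂ] K) (P : H →L[ℂ] L) (h : ∀ x, ‖T x‖ ≤ ‖P x‖) :
    ∃ U : L →L[ℂ] K, ‖U‖ ≤ 1 ∧ ∀ x, U (P x) = T x := by
  set S : Submodule ℂ L := P.range.topologicalClosure with hS
  have : CompleteSpace S := Submodule.topologicalClosure.completeSpace _
  have hmem : ∀ x, P x ∈ S := fun x =>
    Submodule.le_topologicalClosure _ (LinearMap.mem_range_self _ x)
  let P' : H →ₗ[ℂ] S := P.toLinearMap.codRestrict S hmem
  have hd : DenseRange P' := by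
    rw [DenseRange, Subtype.dense_iff]
    intro x hx
    have : Subtype.val '' Set.range P' = P.range := by
      ext y
      constructor
      · rintro ⟨_, ⟨z, rfl⟩, rfl⟩; exact ⟨z, rfl⟩
      · rintro ⟨z, rfl⟩; exact ⟨_, ⟨z, rfl⟩, rfl⟩
    exact closure_mono this.ge hx
  have hn : ∀ x, ‖T.toLinearMap x‖ ≤ 1 * ‖P' x‖ := fun x => by
    rw [one_mul]; exact h x
  set U' := T.toLinearMap.extendOfNorm P' with hU'
  refine ⟨U' ∘L S.orthogonalProjectionOnto, ?_, fun x => ?_⟩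
  · refine ContinuousLinearMap.opNorm_le_bound _ zero_le_one fun x => ?_
    refine (LinearMap.norm_extendOfNorm_apply_le hd 1 hn _).trans ?_
    gcongr
    exact S.norm_orthogonalProjectionOnto_apply_le x
  · have h1 : S.orthogonalProjectionOnto (P x) = P' x :=
      Submodule.orthogonalProjectionOnto_mem_subspace_eq_self (P' x)
    rw [ContinuousLinearMap.comp_apply, h1]
    exact LinearMap.extendOfNorm_eq hd ⟨1, hn⟩ x

theorem enorm_le_one {U : H →L[ℂ] K} (h : ‖U‖ ≤ 1) : ‖U‖ₑ ≤ 1 := by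
  rw [← ofReal_norm]
  exact ENNReal.ofReal_le_one.2 h

/-- Every operator is a product of two operators whose Hilbert–Schmidt norms are controlled by its
trace norm: `X = (U |X|^{1/2}) |X|^{1/2}` with the polar decomposition `X = U |X|`. -/
theorem exists_hsSq_factor (X : H →L[ℂ] H) :
    ∃ S R : H →L[ℂ] H, X = S ∘L R ∧ hsSq S ≤ traceNorm X ∧ hsSq R ≤ traceNorm X := by
  obtain ⟨R, hRa, hRR, hRt⟩ := exists_sqrt_abs X
  obtain ⟨U, hU, hUX⟩ := exists_factor_of_norm_le X (CFC.abs X) fun x => (norm_abs_apply X x).ge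
  refine ⟨U ∘L R, R, ?_, ?_, hRt.ge⟩
  · ext x
    rw [ContinuousLinearMap.comp_apply, ContinuousLinearMap.comp_apply, hRR, hUX]
  · refine (hsSq_comp_le _ _).trans ?_
    calc _ ≤ 1 ^ 2 * traceNorm X := by
          gcongr
          · exact enorm_le_one hU
          · exact hRt.ge
      _ = _ := by simp

/-- The Cauchy–Schwarz inequality for diagonal matrix elements of a product. -/
theorem sum_enorm_inner_comp_le {ι : Type*} (S : K →L[ℂ] H) (R : H →L[ℂ] K) {e : ι → H}
    (he : Orthonormal ℂ e) {U : H →L[ℂ] H} (hU : ‖U‖ₑ ≤ 1) (F : Finset ι) :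
    2 * ∑ i ∈ F, ‖⟪U (e i), S (R (e i))⟫_ℂ‖ₑ ≤ hsSq S + hsSq R := by
  rw [Finset.mul_sum]
  calc _ ≤ ∑ i ∈ F, (‖(S.adjoint ∘L U) (e i)‖ₑ ^ 2 + ‖R (e i)‖ₑ ^ 2) := by
        refine Finset.sum_le_sum fun i _ => ?_
        rw [← ContinuousLinearMap.adjoint_inner_left]
        exact two_mul_enorm_inner_le _ _
    _ = ∑ i ∈ F, ‖(S.adjoint ∘L U) (e i)‖ₑ ^ 2 + ∑ i ∈ F, ‖R (e i)‖ₑ ^ 2 :=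
        Finset.sum_add_distrib
    _ ≤ hsSq (S.adjoint ∘L U) + hsSq R := by
        gcongr
        · exact (ENNReal.sum_le_tsum F).trans (tsum_orthonormal_le_hsSq _ he)
        · exact (ENNReal.sum_le_tsum F).trans (tsum_orthonormal_le_hsSq _ he)
    _ ≤ 1 ^ 2 * hsSq S.adjoint + hsSq R := by
        gcongr
        refine (hsSq_comp_le' _ _).trans ?_
        gcongr
    _ = _ := by rw [one_pow, one_mul, hsSq_adjoint]

/-- Products of Hilbert–Schmidt operators are trace class. The bound by the arithmetic mean of the
squares, instead of the product of the norms, is enough here and avoids square roots in `[0, ∞]`. -/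
theorem two_mul_traceNorm_comp_le (S : K →L[ℂ] H) (R : H →L[ℂ] K) :
    2 * traceNorm (S ∘L R) ≤ hsSq S + hsSq R := by
  have h : traceNorm (S ∘L R) ≤ (hsSq S + hsSq R) / 2 := by
    refine traceNorm_le_of_forall _ _ fun U hU F => ?_
    rw [ENNReal.le_div_iff_mul_le (by simp) (by simp), mul_comm]
    exact sum_enorm_inner_comp_le S R (onb H).orthonormal hU F
  rwa [ENNReal.le_div_iff_mul_le (by simp) (by simp), mul_comm] at h

theorem traceNorm_comp_le (A : H →L[ℂ] K) (X : H →L[ℂ] H) (B : K →L[ℂ] H) :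
    2 * traceNorm (A ∘L X ∘L B) ≤ (‖A‖ₑ ^ 2 + ‖B‖ₑ ^ 2) * traceNorm X := by
  obtain ⟨S, R, hX, hS, hR⟩ := exists_hsSq_factor X
  have h : A ∘L X ∘L B = (A ∘L S) ∘L (R ∘L B) := by rw [hX]; rfl
  rw [h, add_mul]
  refine (two_mul_traceNorm_comp_le _ _).trans (add_le_add ?_ ?_)
  · exact (hsSq_comp_le _ _).trans (by gcongr)
  · exact (hsSq_comp_le' _ _).trans (by gcongr)

theorem traceNorm_smul_le (c : ℂ) (X : H →L[ℂ] H) : traceNorm (c • X) ≤ ‖c‖ₑ * traceNorm X := by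
  refine traceNorm_le_of_forall _ _ fun U hU F => ?_
  have h := sum_enorm_inner_le X (onb H).orthonormal U (ContinuousLinearMap.id ℂ H) F
  have h1 : ‖U‖ₑ ^ 2 + ‖ContinuousLinearMap.id ℂ H‖ₑ ^ 2 ≤ 2 := by
    calc _ ≤ (1 : ℝ≥0∞) ^ 2 + 1 ^ 2 := by
          gcongr
          exact enorm_le_one ContinuousLinearMap.norm_id_le
      _ = 2 := by norm_num
  have h2 := (ENNReal.mul_le_mul_iff_right (by norm_num) (by norm_num)).1
    (h.trans (mul_le_mul_left h1 _))
  calc _ = ‖c‖ₑ * ∑ i ∈ F, ‖⟪U (onb H i), X (onb H i)⟫_ℂ‖ₑ := by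
        rw [Finset.mul_sum]
        refine Finset.sum_congr rfl fun i _ => ?_
        rw [smul_apply, inner_smul_right, enorm_mul]
    _ ≤ _ := by gcongr; exact h2

theorem enorm_le_traceNorm (X : H →L[ℂ] H) : ‖X‖ₑ ≤ traceNorm X := by
  obtain ⟨S, R, hX, hS, hR⟩ := exists_hsSq_factor X
  have h2 : ‖X‖ₑ ^ 2 ≤ traceNorm X ^ 2 := by
    calc ‖X‖ₑ ^ 2 ≤ (‖S‖ₑ * ‖R‖ₑ) ^ 2 := by
          gcongr; rw [hX]; exact ContinuousLinearMap.opENorm_comp_le _ _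
      _ = ‖S‖ₑ ^ 2 * ‖R‖ₑ ^ 2 := mul_pow _ _ _
      _ ≤ traceNorm X * traceNorm X := by
          gcongr
          · exact (enorm_sq_le_hsSq S).trans hS
          · exact (enorm_sq_le_hsSq R).trans hR
      _ = _ := (sq _).symm
  exact (ENNReal.pow_le_pow_left_iff two_ne_zero).1 h2

/-- For a positive operator the trace norm is the sum of the diagonal elements. -/
theorem traceNorm_eq_of_isPositive {X : H →L[ℂ] H} (hX : X.IsPositive) :
    traceNorm X = ∑' i, ENNReal.ofReal (⟪onb H i, X (onb H i)⟫_ℂ).re := by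
  rw [traceNorm, CFC.abs_of_nonneg X ((ContinuousLinearMap.nonneg_iff_isPositive _).2 hX)]

theorem traceNorm_adjoint_comp_self (Q : H →L[ℂ] K) : traceNorm (Q.adjoint ∘L Q) = hsSq Q := by
  rw [traceNorm_eq_of_isPositive (ContinuousLinearMap.isPositive_adjoint_comp_self Q), hsSq]
  refine tsum_congr fun i => ?_
  rw [ContinuousLinearMap.comp_apply, ContinuousLinearMap.adjoint_inner_right, ← ofReal_norm,
    ← ENNReal.ofReal_pow (norm_nonneg _)]
  congr 1
  exact inner_self_eq_norm_sq (𝕜 := ℂ) _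

theorem two_mul_traceNorm_rankOne_le (a b : H) :
    2 * traceNorm (InnerProductSpace.rankOne ℂ a b) ≤ ‖a‖ₑ ^ 2 + ‖b‖ₑ ^ 2 := by
  have hs : ∀ x : H, hsSq (innerSL ℂ x) = ‖x‖ₑ ^ 2 := by
    intro x
    rw [hsSq, enorm_sq_eq_tsum (onb H)]
    refine tsum_congr fun i => ?_
    rw [innerSL_apply_apply, ← inner_conj_symm, RCLike.enorm_conj]
  have h : InnerProductSpace.rankOne ℂ a b = (innerSL ℂ a).adjoint ∘L innerSL ℂ b := by
    ext x
    refine ext_inner_left ℂ fun y => ?_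
    rw [ContinuousLinearMap.comp_apply, ContinuousLinearMap.adjoint_inner_right]
    simp
  rw [h]
  refine (two_mul_traceNorm_comp_le _ _).trans ?_
  rw [hsSq_adjoint, hs, hs]

/-- The rank-one operator `|a⟩⟨b|` as a trace-class operator. -/
noncomputable def rankOneT (a b : H) : traceClass H :=
  ⟨InnerProductSpace.rankOne ℂ a b, by
    have h : 2 * traceNorm (InnerProductSpace.rankOne ℂ a b) < ∞ :=
      (two_mul_traceNorm_rankOne_le a b).trans_lt
        (ENNReal.add_lt_top.2 ⟨ENNReal.pow_lt_top enorm_lt_top, ENNReal.pow_lt_top enorm_lt_top⟩)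
    exact lt_of_le_of_lt (le_mul_of_one_le_left' one_le_two) h⟩

theorem rankOneT_add_left (a a' b : K) : rankOneT (a + a') b = rankOneT a b + rankOneT a' b :=
  Subtype.ext (by simp [rankOneT])

theorem rankOneT_smul_left (c : ℂ) (a b : K) : rankOneT (c • a) b = c • rankOneT a b :=
  Subtype.ext (by simp [rankOneT])

theorem rankOneT_add_right (a b b' : K) : rankOneT a (b + b') = rankOneT a b + rankOneT a b' :=
  Subtype.ext (by simp [rankOneT])

theorem rankOneT_smul_right (c : ℂ) (a b : K) :
    rankOneT a (c • b) = (starRingEnd ℂ) c • rankOneT a b :=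
  Subtype.ext (by simp [rankOneT])

theorem ketBra_eq_rankOneT (v : H) : ketBra v = rankOneT v v := rfl

end HilbertSchmidt

/-! ### Trace-norm continuous functionals and maps -/

section Functionals

variable {H K L : Type*}
  [NormedAddCommGroup H] [InnerProductSpace ℂ H] [CompleteSpace H]
  [NormedAddCommGroup K] [InnerProductSpace ℂ K] [CompleteSpace K]
  [NormedAddCommGroup L] [InnerProductSpace ℂ L] [CompleteSpace L]

theorem tsum_enorm_inner_le (X : H →L[ℂ] H) :
    ∑' i, ‖⟪onb H i, X (onb H i)⟫_ℂ‖ₑ ≤ traceNorm X := by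
  rw [ENNReal.tsum_eq_iSup_sum]
  refine iSup_le fun F => ?_
  have h := sum_enorm_inner_le X (onb H).orthonormal (ContinuousLinearMap.id ℂ H)
    (ContinuousLinearMap.id ℂ H) F
  have h1 : ‖ContinuousLinearMap.id ℂ H‖ₑ ^ 2 + ‖ContinuousLinearMap.id ℂ H‖ₑ ^ 2 ≤ 2 := by
    calc _ ≤ (1 : ℝ≥0∞) ^ 2 + 1 ^ 2 := by
          gcongr <;> exact enorm_le_one ContinuousLinearMap.norm_id_le
      _ = 2 := by norm_num
  exact (ENNReal.mul_le_mul_iff_right (by norm_num) (by norm_num)).1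
    (h.trans (mul_le_mul_left h1 _))

theorem summable_of_tsum_enorm {ι E : Type*} [NormedAddCommGroup E] [CompleteSpace E] {f : ι → E}
    (h : ∑' i, ‖f i‖ₑ ≠ ∞) : Summable f := by
  refine Summable.of_norm ?_
  have := ENNReal.summable_toReal h
  simpa using this

theorem summable_trace (X : traceClass H) : Summable fun i => ⟪onb H i, X.1 (onb H i)⟫_ℂ :=
  summable_of_tsum_enorm ((tsum_enorm_inner_le X.1).trans_lt X.2).ne

/-- The trace as a linear functional. -/
noncomputable def traceL (H : Type*) [NormedAddCommGroup H] [InnerProductSpace ℂ H]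
    [CompleteSpace H] : traceClass H →ₗ[ℂ] ℂ where
  toFun X := trace X.1
  map_add' X Y := by
    rw [trace, trace, trace, ← (summable_trace X).tsum_add (summable_trace Y)]
    exact tsum_congr fun i => by simp
  map_smul' c X := by
    rw [trace, trace, RingHom.id_apply, smul_eq_mul, ← tsum_mul_left]
    exact tsum_congr fun i => by simp

theorem traceL_apply (X : traceClass H) : traceL H X = trace X.1 := rfl

theorem enorm_trace_le (X : traceClass H) : ‖trace X.1‖ₑ ≤ traceNorm X.1 := by
  refine le_trans ?_ (tsum_enorm_inner_le X.1)
  exact enorm_tsum_le_tsum_enorm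

theorem trace_rankOne (a b : H) : trace (InnerProductSpace.rankOne ℂ a b) = ⟪b, a⟫_ℂ := by
  rw [trace, ← (onb H).tsum_inner_mul_inner b a]
  refine tsum_congr fun i => ?_
  rw [InnerProductSpace.rankOne_apply, inner_smul_right]

/-- Composition with a bounded operator from the right. -/
noncomputable def compRight (A : H →L[ℂ] H) : traceClass H →ₗ[ℂ] traceClass H where
  toFun X := ⟨X.1 ∘L A, by
    have h := traceNorm_comp_lt_top X.2 (ContinuousLinearMap.id ℂ H) A
    exact h⟩
  map_add' X Y := Subtype.ext (ContinuousLinearMap.add_comp _ _ _)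
  map_smul' c X := Subtype.ext (ContinuousLinearMap.smul_comp _ _ _)

/-- Continuity of a functional with respect to the trace norm. -/
def IsBoundedFunctional (f : traceClass H →ₗ[ℂ] ℂ) : Prop :=
  ∃ C : ℝ≥0, ∀ X, ‖f X‖ₑ ≤ C * traceNorm X.1

theorem IsBoundedFunctional.sub {f g : traceClass H →ₗ[ℂ] ℂ} (hf : IsBoundedFunctional f)
    (hg : IsBoundedFunctional g) : IsBoundedFunctional (f - g) := by
  obtain ⟨C, hC⟩ := hf
  obtain ⟨D, hD⟩ := hg
  refine ⟨C + D, fun X => ?_⟩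
  rw [LinearMap.sub_apply, ENNReal.coe_add, add_mul]
  exact enorm_sub_le.trans (add_le_add (hC X) (hD X))

theorem IsBoundedFunctional.comp {f : traceClass H →ₗ[ℂ] ℂ} (hf : IsBoundedFunctional f)
    {Φ : traceClass K →ₗ[ℂ] traceClass H} (hΦ : IsTraceNormBounded Φ) :
    IsBoundedFunctional (f ∘ₗ Φ) := by
  obtain ⟨C, hC⟩ := hf
  obtain ⟨D, hD⟩ := hΦ
  refine ⟨C * D, fun X => (hC (Φ X)).trans ?_⟩
  rw [ENNReal.coe_mul, mul_assoc]
  gcongr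
  exact hD X

theorem isBoundedFunctional_traceL : IsBoundedFunctional (traceL H) :=
  ⟨1, fun X => by simpa [traceL_apply] using enorm_trace_le X⟩

theorem isTraceNormBounded_compRight (A : H →L[ℂ] H) : IsTraceNormBounded (compRight A) := by
  refine ⟨1 + ‖A‖₊ ^ 2, fun X => ?_⟩
  have h := traceNorm_comp_le (ContinuousLinearMap.id ℂ H) X.1 A
  refine (le_mul_of_one_le_left' one_le_two).trans (h.trans ?_)
  push_cast
  gcongr
  · calc _ ≤ (1 : ℝ≥0∞) ^ 2 := by
          gcongr; exact enorm_le_one ContinuousLinearMap.norm_id_le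
      _ = 1 := one_pow _
  · rfl

/-- The matrix element `X ↦ ⟪u, X w⟫` as a functional on trace-class operators. -/
noncomputable def matrixElement (u w : H) : traceClass H →ₗ[ℂ] ℂ where
  toFun X := ⟪u, X.1 w⟫_ℂ
  map_add' X Y := by simp
  map_smul' c X := by simp

theorem isBoundedFunctional_matrixElement (u w : H) :
    IsBoundedFunctional (matrixElement u w) := by
  refine ⟨‖u‖₊ * ‖w‖₊, fun X => ?_⟩
  have h : ‖⟪u, X.1 w⟫_ℂ‖ₑ ≤ ‖u‖ₑ * ‖X.1 w‖ₑ := by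
    rw [← ofReal_norm, ← ofReal_norm, ← ofReal_norm, ← ENNReal.ofReal_mul (norm_nonneg _)]
    exact ENNReal.ofReal_le_ofReal (norm_inner_le_norm _ _)
  calc _ ≤ ‖u‖ₑ * ‖X.1 w‖ₑ := h
    _ ≤ ‖u‖ₑ * (traceNorm X.1 * ‖w‖ₑ) := by
        gcongr
        refine (ContinuousLinearMap.le_opENorm _ _).trans ?_
        gcongr
        exact enorm_le_traceNorm _
    _ = _ := by rw [ENNReal.coe_mul, mul_comm (traceNorm _), mul_assoc]; rfl

/-- A bounded functional on the trace-class operators is determined by its values on rank-one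
operators: with `X = S R`, the finite-rank operators `∑ |S eᵢ⟩⟨R* eᵢ|` converge to `X` in trace
norm, as `S` and `R*` are Hilbert–Schmidt. -/
theorem IsBoundedFunctional.eq_zero {f : traceClass H →ₗ[ℂ] ℂ} (hf : IsBoundedFunctional f)
    (h : ∀ a b, f (rankOneT a b) = 0) : f = 0 := by
  classical
  obtain ⟨C, hC⟩ := hf
  ext X
  obtain ⟨S, R, hX, hS, hR⟩ := exists_hsSq_factor X.1
  set e := onb H with he
  -- `P F` projects onto the span of finitely many basis vectors, and `Q F = 1 - P F`. The error
  -- of the approximation `S (P F) R` of `X` is `(S (Q F)) ((Q F) R)`.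
  let P : Finset (exists_hilbertBasis ℂ H).choose → H →L[ℂ] H := fun F =>
    ∑ i ∈ F, InnerProductSpace.rankOne ℂ (e i) (e i)
  let Q : Finset (exists_hilbertBasis ℂ H).choose → H →L[ℂ] H := fun F => 1 - P F
  have hPe : ∀ F j, P F (e j) = if j ∈ F then e j else 0 := by
    intro F j
    simp only [P, sum_apply, InnerProductSpace.rankOne_apply,
      orthonormal_iff_ite.1 e.orthonormal]
    simp
  have hPP : ∀ F, P F ∘L P F = P F := by
    intro F
    refine ContinuousLinearMap.ext_on (s := Set.range e) ?_ ?_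
    · rw [Submodule.dense_iff_topologicalClosure_eq_top]; exact e.dense_span
    · rintro _ ⟨j, rfl⟩
      rw [ContinuousLinearMap.comp_apply, hPe]
      split_ifs with hj
      · rw [hPe, if_pos hj]
      · simp
  have hPa : ∀ F, (P F).adjoint = P F := by
    intro F
    simp [P, map_sum]
  have hQQ : ∀ F, Q F ∘L Q F = Q F := by
    intro F
    have h1 : P F * P F = P F := hPP F
    change (1 - P F) * (1 - P F) = 1 - P F
    rw [mul_sub, sub_mul, sub_mul, h1]; simp
  have hQa : ∀ F, (Q F).adjoint = Q F := by
    intro F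
    have : (1 : H →L[ℂ] H).adjoint = 1 := star_one (H →L[ℂ] H)
    rw [map_sub, hPa, this]
  have hQs : ∀ (T : H →L[ℂ] H) F, hsSq (T ∘L Q F) = ∑' i : {i // i ∉ F}, ‖T (e i)‖ₑ ^ 2 := by
    intro T F
    rw [hsSq, ← he]
    have h0 : (fun i => ‖(T ∘L Q F) (e i)‖ₑ ^ 2) =
        Set.indicator {i | i ∉ F} fun i => ‖T (e i)‖ₑ ^ 2 := by
      ext i
      rw [ContinuousLinearMap.comp_apply]
      simp only [Q, sub_apply, one_apply_eq_self, hPe, Set.indicator, Set.mem_ofPred_eq]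
      split_ifs <;> simp_all
    rw [h0, ← tsum_subtype]
    rfl
  have hlim : ∀ T : H →L[ℂ] H, hsSq T ≠ ∞ →
      Filter.Tendsto (fun F => hsSq (T ∘L Q F)) Filter.atTop (nhds 0) := by
    intro T hT
    simp_rw [hQs]
    exact ENNReal.tendsto_tsum_compl_atTop_zero hT
  have hbound : ∀ F, 2 * ‖f X‖ₑ ≤ C * (hsSq (S ∘L Q F) + hsSq (R.adjoint ∘L Q F)) := by
    intro F
    have h1 : (X - ∑ i ∈ F, rankOneT (S (e i)) (R.adjoint (e i))).1 =
        (S ∘L Q F) ∘L (Q F ∘L R) := by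
      have h2 : (S ∘L Q F) ∘L (Q F ∘L R) = S ∘L Q F ∘L R := by
        conv_rhs => rw [← hQQ F]
        rfl
      rw [h2, Submodule.coe_sub, Submodule.coe_sum, hX]
      ext x
      simp [Q, P, rankOneT, ContinuousLinearMap.adjoint_inner_left, map_sum, map_smul]
    have h3 : f (X - ∑ i ∈ F, rankOneT (S (e i)) (R.adjoint (e i))) = f X := by
      rw [map_sub, map_sum, Finset.sum_eq_zero fun i _ => h _ _, sub_zero]
    have h4 := hC (X - ∑ i ∈ F, rankOneT (S (e i)) (R.adjoint (e i)))
    rw [h3, h1] at h4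
    have h5 := two_mul_traceNorm_comp_le (S ∘L Q F) (Q F ∘L R)
    rw [← hsSq_adjoint (Q F ∘L R), ContinuousLinearMap.adjoint_comp, hQa] at h5
    calc 2 * ‖f X‖ₑ ≤ 2 * (C * traceNorm ((S ∘L Q F) ∘L (Q F ∘L R))) := by gcongr
      _ = C * (2 * traceNorm ((S ∘L Q F) ∘L (Q F ∘L R))) := by ring
      _ ≤ _ := by gcongr
  have hSf : hsSq S ≠ ∞ := (hS.trans_lt X.2).ne
  have hRf : hsSq R.adjoint ≠ ∞ := by rw [hsSq_adjoint]; exact (hR.trans_lt X.2).ne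
  have h0 : Filter.Tendsto (fun F => (C : ℝ≥0∞) * (hsSq (S ∘L Q F) + hsSq (R.adjoint ∘L Q F)))
      Filter.atTop (nhds 0) := by
    have := ENNReal.Tendsto.const_mul ((hlim S hSf).add (hlim _ hRf)) (a := (C : ℝ≥0∞))
      (Or.inr ENNReal.coe_ne_top)
    simpa using this
  have h1 : 2 * ‖f X‖ₑ ≤ 0 := ge_of_tendsto' h0 hbound
  simpa using h1

/-- A bounded functional is a bounded sesquilinear form on rank-one operators. The bound on unit
vectors extends by homogeneity. -/
theorem IsBoundedFunctional.exists_norm_rankOneT_le {f : traceClass H →ₗ[ℂ] ℂ}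
    (hf : IsBoundedFunctional f) : ∃ C : ℝ, ∀ a b, ‖f (rankOneT a b)‖ ≤ C * ‖a‖ * ‖b‖ := by
  obtain ⟨C, hC⟩ := hf
  have hb : ∀ a b : H, ‖a‖ ≤ 1 → ‖b‖ ≤ 1 → ‖f (rankOneT a b)‖ ≤ C := by
    intro a b ha hb
    have h1 : traceNorm (rankOneT a b).1 ≤ 1 := by
      have h2 : 2 * traceNorm (rankOneT a b).1 ≤ 2 * 1 := by
        refine (two_mul_traceNorm_rankOne_le a b).trans ?_
        have ha' : ‖a‖ₑ ≤ 1 := by rw [← ofReal_norm]; exact ENNReal.ofReal_le_one.2 ha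
        have hb' : ‖b‖ₑ ≤ 1 := by rw [← ofReal_norm]; exact ENNReal.ofReal_le_one.2 hb
        calc _ ≤ (1 : ℝ≥0∞) ^ 2 + 1 ^ 2 := by gcongr
          _ = 2 * 1 := by norm_num
      exact (ENNReal.mul_le_mul_iff_right (by norm_num) (by norm_num)).1 h2
    have h2 : ‖f (rankOneT a b)‖ₑ ≤ C := (hC _).trans (by
      calc _ ≤ (C : ℝ≥0∞) * 1 := by gcongr
        _ = C := mul_one _)
    rw [enorm_eq_nnnorm] at h2
    exact_mod_cast h2
  have hsmul : ∀ (c : ℂ) a b, f (rankOneT (c • a) b) = c * f (rankOneT a b) := by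
    intro c a b
    rw [rankOneT_smul_left, map_smul, smul_eq_mul]
  have hsmul' : ∀ (c : ℂ) a b, f (rankOneT a (c • b)) = (starRingEnd ℂ) c * f (rankOneT a b) := by
    intro c a b
    rw [rankOneT_smul_right, map_smul, smul_eq_mul]
  refine ⟨C, fun a b => ?_⟩
  by_cases ha : a = 0
  · have : f (rankOneT a b) = 0 := by simpa [ha] using hsmul 0 0 b
    rw [this, norm_zero]; positivity
  by_cases hb0 : b = 0
  · have : f (rankOneT a b) = 0 := by simpa [hb0] using hsmul' 0 a 0
    rw [this, norm_zero]; positivity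
  have hna : ‖a‖ ≠ 0 := norm_ne_zero_iff.2 ha
  have hnb : ‖b‖ ≠ 0 := norm_ne_zero_iff.2 hb0
  have h1 := hb (((‖a‖⁻¹ : ℝ) : ℂ) • a) (((‖b‖⁻¹ : ℝ) : ℂ) • b)
    (by simp [norm_smul, hna]) (by simp [norm_smul, hnb])
  rw [hsmul, hsmul', norm_mul, norm_mul, RCLike.norm_conj, Complex.norm_real,
    Complex.norm_real, norm_inv, norm_inv, norm_norm, norm_norm] at h1
  have h2 := mul_le_mul_of_nonneg_right h1 (show 0 ≤ ‖a‖ * ‖b‖ by positivity)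
  calc _ = ‖a‖⁻¹ * (‖b‖⁻¹ * ‖f (rankOneT a b)‖) * (‖a‖ * ‖b‖) := by field_simp
    _ ≤ _ := by rw [mul_assoc (C : ℝ)]; exact h2

theorem trace_rankOne_comp (a b : H) (B : H →L[ℂ] H) :
    trace (InnerProductSpace.rankOne ℂ a b ∘L B) = ⟪b, B a⟫_ℂ := by
  have h : InnerProductSpace.rankOne ℂ a b ∘L B = InnerProductSpace.rankOne ℂ a (B.adjoint b) := by
    ext x
    simp [ContinuousLinearMap.adjoint_inner_left]
  rw [h, trace_rankOne, ContinuousLinearMap.adjoint_inner_left]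

theorem compRight_apply (A : H →L[ℂ] H) (X : traceClass H) : (compRight A X).1 = X.1 ∘L A := rfl

/-- The bounded operators are the dual of the trace-class operators. -/
theorem IsBoundedFunctional.exists_operator {f : traceClass H →ₗ[ℂ] ℂ}
    (hf : IsBoundedFunctional f) : ∃ B : H →L[ℂ] H, ∀ X, f X = trace (X.1 ∘L B) := by
  obtain ⟨C, hC⟩ := hf.exists_norm_rankOneT_le
  let β : H →L⋆[ℂ] H →L[ℂ] ℂ := LinearMap.mkContinuous₂
    (LinearMap.mk₂'ₛₗ (starRingEnd ℂ) (RingHom.id ℂ) (fun b a => f (rankOneT a b))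
      (fun b b' a => by rw [rankOneT_add_right, map_add])
      (fun c b a => by rw [rankOneT_smul_right, map_smul])
      (fun b a a' => by rw [rankOneT_add_left, map_add])
      (fun c b a => by rw [rankOneT_smul_left, map_smul, RingHom.id_apply])) C
    fun b a => by
      refine (hC a b).trans_eq ?_
      ring
  have hβ : ∀ a b, β b a = f (rankOneT a b) := fun a b => rfl
  refine ⟨(InnerProductSpace.continuousLinearMapOfBilin β).adjoint, fun X => ?_⟩
  have h := (hf.sub (isBoundedFunctional_traceL.comp (isTraceNormBounded_compRight
    (InnerProductSpace.continuousLinearMapOfBilin β).adjoint))).eq_zero fun a b => by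
      rw [LinearMap.sub_apply, LinearMap.comp_apply, traceL_apply, compRight_apply]
      refine sub_eq_zero.2 (Eq.symm ?_)
      refine (trace_rankOne_comp a b _).trans ?_
      rw [ContinuousLinearMap.adjoint_inner_right,
        InnerProductSpace.continuousLinearMapOfBilin_apply, hβ]
  exact sub_eq_zero.1 (congrArg (fun f : traceClass H →ₗ[ℂ] ℂ => f X) h)

/-- It suffices to test a bounded functional on `|a⟩⟨b|` with `a`, `b` in a total set. -/
theorem IsBoundedFunctional.eq_zero_of_dense {f : traceClass H →ₗ[ℂ] ℂ}
    (hf : IsBoundedFunctional f) {s : Set H} (hs : (Submodule.span ℂ s).topologicalClosure = ⊤)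
    (h : ∀ a ∈ s, ∀ b ∈ s, f (rankOneT a b) = 0) : f = 0 := by
  have hd : Dense (Submodule.span ℂ s : Set H) :=
    Submodule.dense_iff_topologicalClosure_eq_top.2 hs
  obtain ⟨B, hB⟩ := hf.exists_operator
  have hB' : ∀ a b, f (rankOneT a b) = ⟪b, B a⟫_ℂ := fun a b =>
    (hB _).trans (trace_rankOne_comp a b B)
  have h0 : B = 0 := by
    refine ContinuousLinearMap.ext_on hd fun a ha => ?_
    refine (innerSL_inj (𝕜 := ℂ)).1 (ContinuousLinearMap.ext_on hd fun b hb => ?_)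
    have h1 : ⟪B a, b⟫_ℂ = 0 := by
      rw [← inner_conj_symm, ← hB', h a ha b hb, map_zero]
    simpa using h1
  ext a
  refine hf.eq_zero (fun a b => ?_) ▸ rfl
  rw [hB', h0]; simp

/-- Trace-norm continuous maps that agree on `|a⟩⟨b|` for `a`, `b` in a total set are equal. -/
theorem IsTraceNormBounded.ext_of_dense {Φ Ψ : traceClass K →ₗ[ℂ] traceClass H}
    (hΦ : IsTraceNormBounded Φ) (hΨ : IsTraceNormBounded Ψ) {s : Set K}
    (hs : (Submodule.span ℂ s).topologicalClosure = ⊤)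
    (h : ∀ a ∈ s, ∀ b ∈ s, Φ (rankOneT a b) = Ψ (rankOneT a b)) : Φ = Ψ := by
  ext X : 1
  refine Subtype.ext (ContinuousLinearMap.ext fun w => ext_inner_left ℂ fun u => ?_)
  have hf := (isBoundedFunctional_matrixElement u w).comp hΦ
  have hg := (isBoundedFunctional_matrixElement u w).comp hΨ
  have h0 := (hf.sub hg).eq_zero_of_dense hs fun a ha b hb => by
    simp [h a ha b hb]
  have h1 := congrArg (fun f : traceClass K →ₗ[ℂ] ℂ => f X) h0
  exact sub_eq_zero.1 h1

end Functionals

/-! ### Kraus maps -/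

section Kraus

variable {H K L : Type*}
  [NormedAddCommGroup H] [InnerProductSpace ℂ H] [CompleteSpace H]
  [NormedAddCommGroup K] [InnerProductSpace ℂ K] [CompleteSpace K]
  [NormedAddCommGroup L] [InnerProductSpace ℂ L] [CompleteSpace L]
  {κ : Type*}

/-- Families of Kraus operators of channels: `∑ₖ Aₖ* Aₖ = 1`, stated as `∑ₖ ‖Aₖ x‖² = ‖x‖²`. -/
def IsKraus (A : κ → K →L[ℂ] H) : Prop := ∀ x, ∑' k, ‖A k x‖ₑ ^ 2 = ‖x‖ₑ ^ 2

theorem summable_mul_of_sq {ι : Type*} {f g : ι → ℂ} (hf : ∑' i, ‖f i‖ₑ ^ 2 ≠ ∞)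
    (hg : ∑' i, ‖g i‖ₑ ^ 2 ≠ ∞) : Summable fun i => f i * g i := by
  refine summable_of_tsum_enorm (ne_top_of_le_ne_top (ENNReal.add_ne_top.2 ⟨hf, hg⟩) ?_)
  rw [← ENNReal.tsum_add]
  refine ENNReal.tsum_le_tsum fun i => ?_
  have h := two_mul_enorm_inner_le ((starRingEnd ℂ) (f i)) (g i)
  rw [RCLike.inner_apply, RCLike.enorm_conj, RCLike.conj_conj, mul_comm (g i)] at h
  exact (le_mul_of_one_le_left' one_le_two).trans h

theorem enorm_sq_eq_ofReal (x : H) : ‖x‖ₑ ^ 2 = ENNReal.ofReal (‖x‖ ^ 2) := by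
  rw [ENNReal.ofReal_pow (norm_nonneg _), ofReal_norm]

theorem lp_enorm_sq (v : lp (fun _ : κ => H) 2) : ‖v‖ₑ ^ 2 = ∑' k, ‖v k‖ₑ ^ 2 := by
  have h := Complex.hasSum_re (lp.hasSum_inner (𝕜 := ℂ) v v)
  have e1 : (⟪v, v⟫_ℂ).re = ‖v‖ ^ 2 := inner_self_eq_norm_sq (𝕜 := ℂ) v
  have e2 : ∀ k, (⟪v k, v k⟫_ℂ).re = ‖v k‖ ^ 2 := fun k => inner_self_eq_norm_sq (𝕜 := ℂ) _
  simp only [e1, e2] at h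
  simp_rw [enorm_sq_eq_ofReal]
  rw [← ENNReal.ofReal_tsum_of_nonneg (fun i => by positivity) h.summable, h.tsum_eq]

theorem memℓp_of_tsum_enorm_sq {f : κ → H} (h : ∑' k, ‖f k‖ₑ ^ 2 ≠ ∞) : Memℓp f 2 := by
  rw [memℓp_gen_iff (by norm_num)]
  have := ENNReal.summable_toReal h
  simpa using this

/-- The column operator `x ↦ (Aₖ x)ₖ`. -/
noncomputable def column (A : κ → K →L[ℂ] H) (hA : ∀ x, ∑' k, ‖A k x‖ₑ ^ 2 ≤ ‖x‖ₑ ^ 2) :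
    K →L[ℂ] lp (fun _ : κ => H) 2 :=
  LinearMap.mkContinuous
    { toFun := fun x => ⟨fun k => A k x,
        memℓp_of_tsum_enorm_sq ((hA x).trans_lt (ENNReal.pow_lt_top enorm_lt_top)).ne⟩
      map_add' := fun x y => by ext k; exact map_add (A k) x y
      map_smul' := fun c x => by ext k; exact map_smul (A k) c x } 1 fun x => by
    rw [one_mul]
    have h := lp_enorm_sq (⟨fun k => A k x, memℓp_of_tsum_enorm_sq
      ((hA x).trans_lt (ENNReal.pow_lt_top enorm_lt_top)).ne⟩ : lp (fun _ : κ => H) 2)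
    have h1 := h.le.trans (hA x)
    rw [ENNReal.pow_le_pow_left_iff two_ne_zero, enorm_le_iff_norm_le] at h1
    exact h1

/-- The Kraus condition needs to be checked on a dense set only. -/
theorem isKraus_of_dense (A : κ → K →L[ℂ] H) {s : Set K} (hs : Dense s)
    (h : ∀ x ∈ s, ∑' k, ‖A k x‖ₑ ^ 2 = ‖x‖ₑ ^ 2) : IsKraus A := by
  -- The finite partial sums are continuous, so the upper bound extends from `s`; this defines the
  -- column operator, whose continuity then extends the equality.
  have hA : ∀ x, ∑' k, ‖A k x‖ₑ ^ 2 ≤ ‖x‖ₑ ^ 2 := by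
    intro x
    rw [ENNReal.tsum_eq_iSup_sum]
    refine iSup_le fun F => ?_
    have h1 : ∑ k ∈ F, ‖A k x‖ ^ 2 ≤ ‖x‖ ^ 2 := by
      refine hs.induction (P := fun x => ∑ k ∈ F, ‖A k x‖ ^ 2 ≤ ‖x‖ ^ 2) (fun x hx => ?_) ?_ x
      · have h2 := (ENNReal.sum_le_tsum F).trans (h x hx).le
        simp_rw [enorm_sq_eq_ofReal] at h2
        rw [← ENNReal.ofReal_sum_of_nonneg fun _ _ => by positivity] at h2
        exact (ENNReal.ofReal_le_ofReal_iff (by positivity)).1 h2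
      · exact isClosed_le (by fun_prop) (by fun_prop)
    simp_rw [enorm_sq_eq_ofReal]
    rw [← ENNReal.ofReal_sum_of_nonneg fun _ _ => by positivity]
    exact ENNReal.ofReal_le_ofReal h1
  intro x
  have h1 : ‖column A hA x‖ = ‖x‖ := by
    refine hs.induction (P := fun x => ‖column A hA x‖ = ‖x‖) (fun x hx => ?_) ?_ x
    · have h2 : ‖column A hA x‖ₑ ^ 2 = ‖x‖ₑ ^ 2 := by
        rw [lp_enorm_sq]; exact h x hx
      rw [enorm_sq_eq_ofReal, enorm_sq_eq_ofReal,
        ENNReal.ofReal_eq_ofReal_iff (by positivity) (by positivity)] at h2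
      exact (sq_eq_sq₀ (norm_nonneg _) (norm_nonneg _)).1 h2
    · exact isClosed_eq (by fun_prop) (by fun_prop)
  have h2 := lp_enorm_sq (column A hA x)
  rw [enorm_sq_eq_ofReal, h1, ← enorm_sq_eq_ofReal] at h2
  exact h2.symm

variable {A : κ → K →L[ℂ] H}

theorem IsKraus.hasSum_inner (hA : IsKraus A) (x y : K) :
    HasSum (fun k => ⟪A k x, A k y⟫_ℂ) ⟪x, y⟫_ℂ := by
  let V : K →ₗᵢ[ℂ] lp (fun _ : κ => H) 2 :=
    ⟨(column A fun x => (hA x).le).toLinearMap, fun x => by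
      have h2 := lp_enorm_sq (column A (fun x => (hA x).le) x)
      have h3 : ‖column A (fun x => (hA x).le) x‖ₑ ^ 2 = ‖x‖ₑ ^ 2 := h2.trans (hA x)
      rw [enorm_sq_eq_ofReal, enorm_sq_eq_ofReal,
        ENNReal.ofReal_eq_ofReal_iff (by positivity) (by positivity)] at h3
      exact (sq_eq_sq₀ (norm_nonneg _) (norm_nonneg _)).1 h3⟩
  have h := lp.hasSum_inner (𝕜 := ℂ) (V x) (V y)
  rw [V.inner_map_map] at h
  exact h

theorem IsKraus.tsum_hsSq (hA : IsKraus A) (S : L →L[ℂ] K) :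
    ∑' k, hsSq (A k ∘L S) = hsSq S := by
  simp only [hsSq]
  rw [ENNReal.tsum_comm]
  exact tsum_congr fun i => hA _

theorem IsKraus.tsum_enorm_le (hA : IsKraus A) (X : K →L[ℂ] K) :
    ∑' k, ‖A k ∘L X ∘L (A k).adjoint‖ₑ ≤ 2 * traceNorm X := by
  obtain ⟨S, R, hX, hS, hR⟩ := exists_hsSq_factor X
  have h : ∀ k, ‖A k ∘L X ∘L (A k).adjoint‖ₑ ≤ hsSq (A k ∘L S) + hsSq (A k ∘L R.adjoint) := by
    intro k
    have h1 : A k ∘L X ∘L (A k).adjoint = (A k ∘L S) ∘L (R ∘L (A k).adjoint) := by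
      rw [hX]; rfl
    rw [h1]
    have h2 := (enorm_le_traceNorm ((A k ∘L S) ∘L (R ∘L (A k).adjoint)))
    refine h2.trans ((le_mul_of_one_le_left' one_le_two).trans
      ((two_mul_traceNorm_comp_le _ _).trans ?_))
    rw [← hsSq_adjoint (R ∘L _), ContinuousLinearMap.adjoint_comp,
      ContinuousLinearMap.adjoint_adjoint]
  refine (ENNReal.tsum_le_tsum h).trans ?_
  rw [ENNReal.tsum_add, hA.tsum_hsSq, hA.tsum_hsSq, hsSq_adjoint, two_mul]
  exact add_le_add hS hR

theorem IsKraus.summable (hA : IsKraus A) (X : traceClass K) :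
    Summable fun k => A k ∘L X.1 ∘L (A k).adjoint :=
  summable_of_tsum_enorm
    ((hA.tsum_enorm_le X.1).trans_lt (ENNReal.mul_lt_top (by norm_num) X.2)).ne

theorem IsKraus.hasSum_inner_tsum (hA : IsKraus A) (X : traceClass K) (u w : H) :
    HasSum (fun k => ⟪(A k).adjoint u, X.1 ((A k).adjoint w)⟫_ℂ)
      ⟪u, (∑' k, A k ∘L X.1 ∘L (A k).adjoint) w⟫_ℂ := by
  have h := ((innerSL ℂ u).comp (ContinuousLinearMap.apply ℂ H w)).hasSum (hA.summable X).hasSum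
  refine h.congr_fun ?_
  intro k
  simp [ContinuousLinearMap.adjoint_inner_left]

/-- Kraus maps are contractions in trace norm. -/
theorem IsKraus.traceNorm_tsum_le (hA : IsKraus A) (X : traceClass K) :
    traceNorm (∑' k, A k ∘L X.1 ∘L (A k).adjoint) ≤ traceNorm X.1 := by
  obtain ⟨S, R, hX, hS, hR⟩ := exists_hsSq_factor X.1
  refine traceNorm_le_of_forall _ _ fun U hU F => ?_
  refine (ENNReal.mul_le_mul_iff_right (a := 2) (by norm_num) (by norm_num)).1 ?_
  have h1 : ∀ k i, ⟪(A k).adjoint (U (onb H i)), X.1 ((A k).adjoint (onb H i))⟫_ℂ =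
      ⟪U (onb H i), (A k ∘L S) ((R ∘L (A k).adjoint) (onb H i))⟫_ℂ := by
    intro k i
    rw [ContinuousLinearMap.adjoint_inner_left, hX]; rfl
  calc _ ≤ 2 * ∑ i ∈ F, ∑' k, ‖⟪U (onb H i), (A k ∘L S) ((R ∘L (A k).adjoint) (onb H i))⟫_ℂ‖ₑ := by
        gcongr with i
        rw [← (hA.hasSum_inner_tsum X (U (onb H i)) (onb H i)).tsum_eq]
        refine enorm_tsum_le_tsum_enorm.trans ?_
        simp_rw [h1]
        rfl
    _ = ∑' k, 2 * ∑ i ∈ F, ‖⟪U (onb H i), (A k ∘L S) ((R ∘L (A k).adjoint) (onb H i))⟫_ℂ‖ₑ := by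
        rw [ENNReal.tsum_mul_left, Summable.tsum_finsetSum fun i _ => ENNReal.summable]
    _ ≤ ∑' k, (hsSq (A k ∘L S) + hsSq (A k ∘L R.adjoint)) := by
        refine ENNReal.tsum_le_tsum fun k => ?_
        refine (sum_enorm_inner_comp_le _ _ (onb H).orthonormal hU F).trans ?_
        rw [← hsSq_adjoint (R ∘L _), ContinuousLinearMap.adjoint_comp,
          ContinuousLinearMap.adjoint_adjoint]
    _ ≤ _ := by
        rw [ENNReal.tsum_add, hA.tsum_hsSq, hA.tsum_hsSq, hsSq_adjoint, two_mul]
        exact add_le_add hS hR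

/-- The channel `X ↦ ∑ₖ Aₖ X Aₖ*` with Kraus operators `Aₖ`; the sum converges in operator norm. -/
noncomputable def krausMap (hA : IsKraus A) : traceClass K →ₗ[ℂ] traceClass H where
  toFun X := ⟨∑' k, A k ∘L X.1 ∘L (A k).adjoint, (hA.traceNorm_tsum_le X).trans_lt X.2⟩
  map_add' X Y := by
    refine Subtype.ext ?_
    change ∑' k, A k ∘L (X.1 + Y.1) ∘L (A k).adjoint =
      ∑' k, A k ∘L X.1 ∘L (A k).adjoint + ∑' k, A k ∘L Y.1 ∘L (A k).adjoint
    rw [← (hA.summable X).tsum_add (hA.summable Y)]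
    exact tsum_congr fun k => by
      rw [ContinuousLinearMap.add_comp, ContinuousLinearMap.comp_add]
  map_smul' c X := by
    refine Subtype.ext ?_
    change ∑' k, A k ∘L (c • X.1) ∘L (A k).adjoint = c • ∑' k, A k ∘L X.1 ∘L (A k).adjoint
    rw [← (hA.summable X).tsum_const_smul c]
    exact tsum_congr fun k => by
      rw [ContinuousLinearMap.smul_comp, ContinuousLinearMap.comp_smul]

theorem hasSum_inner_krausMap (hA : IsKraus A) (X : traceClass K) (u w : H) :
    HasSum (fun k => ⟪(A k).adjoint u, X.1 ((A k).adjoint w)⟫_ℂ) ⟪u, (krausMap hA X).1 w⟫_ℂ :=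
  hA.hasSum_inner_tsum X u w

theorem hasSum_inner_krausMap_rankOneT (hA : IsKraus A) (a b : K) (u w : H) :
    HasSum (fun k => ⟪u, A k a⟫_ℂ * ⟪A k b, w⟫_ℂ) ⟪u, (krausMap hA (rankOneT a b)).1 w⟫_ℂ := by
  have h := hasSum_inner_krausMap hA (rankOneT a b) u w
  refine h.congr_fun ?_
  intro k
  simp only [rankOneT, InnerProductSpace.rankOne_apply, inner_smul_right,
    ContinuousLinearMap.adjoint_inner_left, ContinuousLinearMap.adjoint_inner_right]
  ring

theorem isTraceNormBounded_krausMap (hA : IsKraus A) : IsTraceNormBounded (krausMap hA) :=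
  ⟨1, fun X => by rw [ENNReal.coe_one, one_mul]; exact hA.traceNorm_tsum_le X⟩

/-- Exchange of the sum over a Hilbert basis with a square-summable family. -/
theorem hasSum_tsum_inner_mul_inner {ι : Type*} (e : HilbertBasis ι ℂ H) {x y : κ → H}
    (hx : ∑' k, ‖x k‖ₑ ^ 2 ≠ ∞) (hy : ∑' k, ‖y k‖ₑ ^ 2 ≠ ∞) :
    HasSum (fun i => ∑' k, ⟪e i, x k⟫_ℂ * ⟪y k, e i⟫_ℂ) (∑' k, ⟪y k, x k⟫_ℂ) := by
  have hsq : ∀ z : κ → H, ∑' p : ι × κ, ‖⟪e p.1, z p.2⟫_ℂ‖ₑ ^ 2 = ∑' k, ‖z k‖ₑ ^ 2 := by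
    intro z
    calc _ = ∑' i, ∑' k, ‖⟪e i, z k⟫_ℂ‖ₑ ^ 2 :=
          ENNReal.tsum_prod (f := fun i k => ‖⟪e i, z k⟫_ℂ‖ₑ ^ 2)
      _ = ∑' k, ∑' i, ‖⟪e i, z k⟫_ℂ‖ₑ ^ 2 := ENNReal.tsum_comm
      _ = _ := tsum_congr fun k => (enorm_sq_eq_tsum e _).symm
  let f : ι × κ → ℂ := fun p => ⟪e p.1, x p.2⟫_ℂ * ⟪y p.2, e p.1⟫_ℂ
  have hs : Summable f := by
    refine summable_mul_of_sq ?_ ?_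
    · rw [hsq]; exact hx
    · have h1 : ∀ p : ι × κ, ‖⟪y p.2, e p.1⟫_ℂ‖ₑ = ‖⟪e p.1, y p.2⟫_ℂ‖ₑ := fun p => by
        rw [← inner_conj_symm, RCLike.enorm_conj]
      simp_rw [h1]
      rw [hsq]; exact hy
  have h2 : ∑' k, ⟪y k, x k⟫_ℂ = ∑' i, ∑' k, f (i, k) := by
    refine Eq.trans ?_ (Summable.tsum_comm (f := fun i k => f (i, k)) hs)
    refine tsum_congr fun k => ?_
    rw [← e.tsum_inner_mul_inner]
    exact tsum_congr fun i => mul_comm _ _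
  rw [h2]
  exact hs.prod.hasSum

theorem trace_krausMap_rankOneT (hA : IsKraus A) (a b : K) :
    trace (krausMap hA (rankOneT a b)).1 = ⟪b, a⟫_ℂ := by
  have hfin : ∀ x, ∑' k, ‖A k x‖ₑ ^ 2 ≠ ∞ := fun x => by
    rw [hA x]; exact (ENNReal.pow_lt_top enorm_lt_top).ne
  rw [← (hA.hasSum_inner b a).tsum_eq, ← (hasSum_tsum_inner_mul_inner (onb H) (hfin a)
    (hfin b)).tsum_eq]
  exact tsum_congr fun i => (hasSum_inner_krausMap_rankOneT hA a b _ _).tsum_eq.symm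

/-- Kraus maps preserve the trace, since they do so on rank-one operators and both sides are
trace-norm continuous. -/
theorem trace_krausMap (hA : IsKraus A) (X : traceClass K) :
    trace (krausMap hA X).1 = trace X.1 := by
  have h := ((isBoundedFunctional_traceL.comp (isTraceNormBounded_krausMap hA)).sub
    isBoundedFunctional_traceL).eq_zero fun a b => by
      rw [LinearMap.sub_apply, LinearMap.comp_apply, traceL_apply, traceL_apply,
        trace_krausMap_rankOneT]
      exact sub_eq_zero.2 (trace_rankOne a b).symm
  exact sub_eq_zero.1 (congrArg (fun f : traceClass K →ₗ[ℂ] ℂ => f X) h)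

theorem isChannel_krausMap (hA : IsKraus A) : IsChannel (krausMap hA) := by
  refine ⟨fun n X hX w => ?_, trace_krausMap hA⟩
  have h : HasSum (fun k => ∑ i, ∑ j, ⟪(A k).adjoint (w i), (X i j).1 ((A k).adjoint (w j))⟫_ℂ)
      (∑ i, ∑ j, ⟪w i, (krausMap hA (X i j)).1 (w j)⟫_ℂ) :=
    hasSum_sum fun i _ => hasSum_sum fun j _ => hasSum_inner_krausMap hA (X i j) (w i) (w j)
  exact h.nonneg fun k => hX fun i => (A k).adjoint (w i)

theorem isPositive_of_inner_nonneg {X : H →L[ℂ] H} (h : ∀ x, 0 ≤ ⟪x, X x⟫_ℂ) : X.IsPositive := by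
  rw [ContinuousLinearMap.isPositive_iff_complex]
  intro x
  have h1 := Complex.nonneg_iff.1 (h x)
  have h2 : ⟪X x, x⟫_ℂ = (starRingEnd ℂ) ⟪x, X x⟫_ℂ := (inner_conj_symm _ _).symm
  have h3 : ⟪X x, x⟫_ℂ = ⟪x, X x⟫_ℂ := h2.trans (Complex.conj_eq_iff_im.2 h1.2.symm)
  rw [h3]
  exact ⟨Complex.ext rfl h1.2, h1.1⟩

theorem IsCompletelyPositive.isPositive {Φ : traceClass K →ₗ[ℂ] traceClass H}
    (hΦ : IsCompletelyPositive Φ) {X : traceClass K} (hX : X.1.IsPositive) :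
    (Φ X).1.IsPositive := by
  refine isPositive_of_inner_nonneg fun x => ?_
  have h := hΦ 1 (fun _ _ => X) (fun v => by
    simpa using hX.inner_nonneg_right (v 0)) (fun _ => x)
  simpa using h

theorem traceNorm_eq_trace {X : traceClass H} (hX : X.1.IsPositive) :
    traceNorm X.1 = ENNReal.ofReal (trace X.1).re := by
  have h := Complex.hasSum_re (summable_trace X).hasSum
  rw [traceNorm_eq_of_isPositive hX, trace, ← h.tsum_eq]
  exact (ENNReal.ofReal_tsum_of_nonneg (fun i => hX.re_inner_nonneg_right _) h.summable).symm

/-- Channels are continuous in trace norm. The proof writes `X = S R` as the combination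
`∑ₖ iᵏ Qₖ* Qₖ / 4` of positive operators with `Qₖ = R + iᵏ S*`, by polarization. -/
theorem IsChannel.isTraceNormBounded {Φ : traceClass K →ₗ[ℂ] traceClass H} (hΦ : IsChannel Φ) :
    IsTraceNormBounded Φ := by
  have hpos : ∀ X : traceClass K, X.1.IsPositive → traceNorm (Φ X).1 = traceNorm X.1 := by
    intro X hX
    rw [traceNorm_eq_trace (hΦ.1.isPositive hX), traceNorm_eq_trace hX, hΦ.2]
  refine ⟨4, fun X => ?_⟩
  obtain ⟨S, R, hX, hS, hR⟩ := exists_hsSq_factor X.1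
  have hSR : hsSq S + hsSq R ≤ 2 * traceNorm X.1 := by
    rw [two_mul]; exact add_le_add hS hR
  let Q : ℂ → K →L[ℂ] K := fun c => R + c • S.adjoint
  have hQ : ∀ c : ℂ, ‖c‖ₑ = 1 → hsSq (Q c) ≤ 4 * traceNorm X.1 := by
    intro c hc
    have h1 : hsSq (Q c) ≤ 2 * (hsSq R + hsSq S) := by
      rw [← hsSq_adjoint S]
      simp only [hsSq]
      rw [← ENNReal.tsum_add, ← ENNReal.tsum_mul_left]
      refine ENNReal.tsum_le_tsum fun i => ?_
      have h2 : ‖Q c (onb K i)‖ ^ 2 ≤ 2 * (‖R (onb K i)‖ ^ 2 + ‖c • S.adjoint (onb K i)‖ ^ 2) := by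
        have := norm_add_le (R (onb K i)) (c • S.adjoint (onb K i))
        calc _ ≤ (‖R (onb K i)‖ + ‖c • S.adjoint (onb K i)‖) ^ 2 := by
              gcongr; exact this
          _ ≤ _ := by nlinarith [sq_nonneg (‖R (onb K i)‖ - ‖c • S.adjoint (onb K i)‖)]
      have h3 := ENNReal.ofReal_le_ofReal h2
      rw [ENNReal.ofReal_mul (by norm_num), ENNReal.ofReal_add (by positivity) (by positivity),
        ← enorm_sq_eq_ofReal, ← enorm_sq_eq_ofReal, ← enorm_sq_eq_ofReal, enorm_smul, hc,
        one_mul] at h3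
      simpa using h3
    calc _ ≤ 2 * (hsSq R + hsSq S) := h1
      _ ≤ 2 * (2 * traceNorm X.1) := by gcongr; rw [add_comm]; exact hSR
      _ = _ := by ring
  have hQfin : ∀ c : ℂ, ‖c‖ₑ = 1 → traceNorm ((Q c).adjoint ∘L Q c) ≤ 4 * traceNorm X.1 := by
    intro c hc
    rw [traceNorm_adjoint_comp_self]; exact hQ c hc
  let Y : (c : ℂ) → ‖c‖ₑ = 1 → traceClass K := fun c hc =>
    ⟨(Q c).adjoint ∘L Q c, (hQfin c hc).trans_lt (ENNReal.mul_lt_top (by norm_num) X.2)⟩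
  have hY : ∀ c hc, traceNorm (Φ (Y c hc)).1 ≤ 4 * traceNorm X.1 := by
    intro c hc
    rw [hpos _ (ContinuousLinearMap.isPositive_adjoint_comp_self _)]
    exact hQfin c hc
  have e1 : ‖(1 : ℂ)‖ₑ = 1 := by simp
  have e2 : ‖(-1 : ℂ)‖ₑ = 1 := by simp
  have e3 : ‖Complex.I‖ₑ = 1 := by rw [← ofReal_norm]; simp
  have e4 : ‖-Complex.I‖ₑ = 1 := by rw [← ofReal_norm]; simp
  have hpol : X = (1 / 4 : ℂ) • (Y 1 e1 - Y (-1) e2 + Complex.I • Y Complex.I e3 -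
      Complex.I • Y (-Complex.I) e4) := by
    refine Subtype.ext (ContinuousLinearMap.ext fun x => ext_inner_left ℂ fun y => ?_)
    have h1 : ∀ c hc, ⟪y, (Y c hc).1 x⟫_ℂ =
        ⟪R y, R x⟫_ℂ + c * ⟪R y, S.adjoint x⟫_ℂ + (starRingEnd ℂ) c * ⟪S.adjoint y, R x⟫_ℂ +
          (starRingEnd ℂ) c * c * ⟪S.adjoint y, S.adjoint x⟫_ℂ := by
      intro c hc
      have h2 : ⟪y, (Y c hc).1 x⟫_ℂ = ⟪Q c y, Q c x⟫_ℂ :=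
        ContinuousLinearMap.adjoint_inner_right (Q c) _ _
      rw [h2]
      simp only [Q, add_apply, smul_apply, inner_add_left, inner_add_right, inner_smul_left,
        inner_smul_right]
      ring
    rw [Submodule.coe_smul, Submodule.coe_sub, Submodule.coe_add, Submodule.coe_sub,
      Submodule.coe_smul, Submodule.coe_smul]
    simp only [smul_apply, sub_apply, add_apply, inner_smul_right, inner_sub_right,
      inner_add_right, h1]
    rw [hX, ContinuousLinearMap.comp_apply, ← ContinuousLinearMap.adjoint_inner_left]
    simp only [map_neg, map_one, Complex.conj_I]
    linear_combination (1 / 2 * ⟪S.adjoint y, R x⟫_ℂ - 1 / 2 * ⟪R y, S.adjoint x⟫_ℂ) * Complex.I_sq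
  have hneg : ∀ T : H →L[ℂ] H, traceNorm (-T) ≤ traceNorm T := by
    intro T
    have := traceNorm_smul_le (-1) T
    simpa using this
  have hI : ∀ T : H →L[ℂ] H, traceNorm (Complex.I • T) ≤ traceNorm T := by
    intro T
    have := traceNorm_smul_le Complex.I T
    rwa [e3, one_mul] at this
  have hq : ‖(1 / 4 : ℂ)‖ₑ = 4⁻¹ := by
    rw [← ofReal_norm]
    norm_num
    rw [one_div, ENNReal.ofReal_inv_of_pos (by norm_num)]
    norm_num
  have hle : traceNorm (Φ X).1 ≤ 4⁻¹ * (traceNorm (Φ (Y 1 e1)).1 + traceNorm (Φ (Y (-1) e2)).1 +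
      traceNorm (Φ (Y Complex.I e3)).1 + traceNorm (Φ (Y (-Complex.I) e4)).1) := by
    conv_lhs => rw [hpol]
    rw [map_smul, map_sub, map_add, map_sub, map_smul, map_smul, Submodule.coe_smul,
      Submodule.coe_sub, Submodule.coe_add, Submodule.coe_sub, Submodule.coe_smul,
      Submodule.coe_smul]
    refine (traceNorm_smul_le _ _).trans ?_
    rw [hq]
    gcongr
    rw [sub_eq_add_neg, sub_eq_add_neg]
    refine (traceNorm_add_le _ _).trans (add_le_add ?_ ((hneg _).trans (hI _)))
    refine (traceNorm_add_le _ _).trans (add_le_add ?_ (hI _))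
    exact (traceNorm_add_le _ _).trans (add_le_add le_rfl (hneg _))
  refine hle.trans ?_
  calc _ ≤ 4⁻¹ * (4 * traceNorm X.1 + 4 * traceNorm X.1 + 4 * traceNorm X.1 +
        4 * traceNorm X.1) := by
        exact mul_le_mul_right (add_le_add (add_le_add (add_le_add (hY _ e1) (hY _ e2)) (hY _ e3))
          (hY _ e4)) _
    _ = (4⁻¹ * 4) * (4 * traceNorm X.1) := by ring
    _ = _ := by rw [ENNReal.inv_mul_cancel (by norm_num) (by norm_num), one_mul]; rfl

end Kraus

/-! ### The Kraus representation of a channel -/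

section KrausExistence

universe u v

variable {H K : Type*}
  [NormedAddCommGroup H] [InnerProductSpace ℂ H] [CompleteSpace H]
  [NormedAddCommGroup K] [InnerProductSpace ℂ K] [CompleteSpace K]

/-- The operator-valued kernel `(a, b) ↦ Φ(|a⟩⟨b|)` of a map on trace-class operators. -/
noncomputable def channelKernel (Φ : traceClass K →ₗ[ℂ] traceClass H) :
    Matrix K K (H →L[ℂ] H) :=
  Matrix.of fun a b => (Φ (rankOneT a b)).1

theorem IsCompletelyPositive.sum_nonneg {Φ : traceClass K →ₗ[ℂ] traceClass H}
    (hΦ : IsCompletelyPositive Φ) (n : ℕ) (a : Fin n → K) (w : Fin n → H) :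
    0 ≤ ∑ i, ∑ j, ⟪w i, (Φ (rankOneT (a i) (a j))).1 (w j)⟫_ℂ := by
  refine hΦ n (fun i j => rankOneT (a i) (a j)) (fun v => ?_) w
  have h : ∑ i, ∑ j, ⟪v i, (rankOneT (a i) (a j)).1 (v j)⟫_ℂ =
      (starRingEnd ℂ) (∑ j, ⟪a j, v j⟫_ℂ) * ∑ j, ⟪a j, v j⟫_ℂ := by
    rw [map_sum, Finset.sum_mul_sum]
    refine Finset.sum_congr rfl fun i _ => Finset.sum_congr rfl fun j _ => ?_
    rw [inner_conj_symm]
    simp [rankOneT, mul_comm]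
  rw [h, mul_comm]
  exact mul_star_self_nonneg (∑ j, ⟪a j, v j⟫_ℂ)

/-- A completely positive map commutes with the adjoint on `|a⟩⟨b|`: its values on
`|a + c b⟩⟨a + c b|` are positive, hence self-adjoint, and comparing `c = 1` and `c = i` isolates
the mixed terms. -/
theorem IsCompletelyPositive.adjoint_rankOneT {Φ : traceClass K →ₗ[ℂ] traceClass H}
    (hΦ : IsCompletelyPositive Φ) (a b : K) :
    (Φ (rankOneT a b)).1.adjoint = (Φ (rankOneT b a)).1 := by
  have hsa : ∀ c : K, (Φ (rankOneT c c)).1.adjoint = (Φ (rankOneT c c)).1 := fun c =>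
    (hΦ.isPositive (X := rankOneT c c) (InnerProductSpace.isPositive_rankOne_self c)).isSelfAdjoint
  set P := (Φ (rankOneT a b)).1
  set Q := (Φ (rankOneT b a)).1
  have hex : ∀ c : ℂ, c • P.adjoint + (starRingEnd ℂ) c • Q.adjoint =
      (starRingEnd ℂ) c • P + c • Q := by
    intro c
    have h1 : (Φ (rankOneT (a + c • b) (a + c • b))).1 = (Φ (rankOneT a a)).1 +
        (starRingEnd ℂ) c • P + c • Q + (c * (starRingEnd ℂ) c) • (Φ (rankOneT b b)).1 := by
      simp only [rankOneT_add_left, rankOneT_add_right, rankOneT_smul_left, rankOneT_smul_right,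
        map_add, map_smul, Submodule.coe_add, Submodule.coe_smul]
      module
    have h2 := hsa (a + c • b)
    rw [h1] at h2
    simp only [map_add, map_smulₛₗ, hsa, RCLike.conj_conj, map_mul] at h2
    rw [← sub_eq_zero] at h2 ⊢
    refine Eq.trans ?_ h2
    module
  have e1 := hex 1
  have e2 := congrArg (fun T => (-Complex.I) • T) (hex Complex.I)
  simp only [map_one, one_smul, Complex.conj_I, smul_add, smul_smul, neg_mul,
    Complex.I_mul_I, neg_neg, neg_smul, smul_neg] at e1 e2
  calc P.adjoint = (1 / 2 : ℂ) • (P.adjoint + Q.adjoint) + (1 / 2 : ℂ) • (P.adjoint + -Q.adjoint) := by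
        module
    _ = (1 / 2 : ℂ) • (P + Q) + (1 / 2 : ℂ) • (-P + Q) := by rw [e1, e2]
    _ = Q := by module

/-- Complete positivity, tested on the positive matrices `(|aᵢ⟩⟨aⱼ|)`, is positive semidefiniteness
of the kernel. -/
theorem posSemidef_channelKernel {Φ : traceClass K →ₗ[ℂ] traceClass H}
    (hΦ : IsCompletelyPositive Φ) : (channelKernel Φ).PosSemidef := by
  refine ((RKHS.posSemidef_tfae (K := channelKernel Φ)).out 0 2).2
    (show _ ∧ _ from ⟨?_, fun vv => ?_⟩)
  · ext1 a b
    exact hΦ.adjoint_rankOneT b a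
  · let e := vv.support.equivFin
    have h := hΦ.sum_nonneg _ (fun i => (e.symm i : K)) (fun i => vv (e.symm i : K))
    have h2 : (vv.sum fun x w => vv.sum fun x' w' => ⟪channelKernel Φ x' x w, w'⟫_ℂ) =
        (starRingEnd ℂ) (∑ i, ∑ j, ⟪vv (e.symm i : K),
          (Φ (rankOneT (e.symm i : K) (e.symm j : K))).1 (vv (e.symm j : K))⟫_ℂ) := by
      rw [Finset.sum_comm, map_sum]
      simp_rw [map_sum, inner_conj_symm]
      rw [Finsupp.sum, ← Finset.sum_coe_sort, ← e.symm.sum_comp]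
      refine Finset.sum_congr rfl fun j _ => ?_
      rw [Finsupp.sum, ← Finset.sum_coe_sort, ← e.symm.sum_comp]
      rfl
    rw [h2]
    have h3 := (Complex.nonneg_iff.1 h).1
    rw [RCLike.conj_re]
    exact h3

/-- Kolmogorov decomposition of a positive semidefinite operator-valued kernel, through its
reproducing kernel Hilbert space. -/
theorem exists_kolmogorov {H : Type u} [NormedAddCommGroup H] [InnerProductSpace ℂ H]
    [CompleteSpace H] {X : Type v} (k : Matrix X X (H →L[ℂ] H)) (hk : k.PosSemidef) :
    ∃ (E : Type (max u v)) (_ : NormedAddCommGroup E) (_ : InnerProductSpace ℂ E)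
      (_ : CompleteSpace E) (W : X → H →L[ℂ] E), (∀ a b, k a b = (W a).adjoint ∘L W b) ∧
        (Submodule.span ℂ {W b w | (b) (w)}).topologicalClosure = ⊤ := by
  have hfact : Fact k.PosSemidef := ⟨hk⟩
  refine ⟨RKHS.OfKernel k, inferInstance, inferInstance, inferInstance,
    RKHS.kerFun (RKHS.OfKernel k), fun a b => ?_, RKHS.kerFun_dense _⟩
  rw [← RKHS.kernel_apply, RKHS.OfKernel.kernel_ofKernel]

/-- **Kraus representation** of quantum channels. The kernel `(a, b) ↦ Φ(|a⟩⟨b|)` is positive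
semidefinite by complete positivity, so that `Φ(|a⟩⟨b|) = W a* W b` with operators `W a : H → E`;
the Kraus operators are `a ↦ W a* εₖ` for an orthonormal basis `ε` of `E`. -/
theorem IsChannel.exists_kraus {H : Type u} {K : Type v}
    [NormedAddCommGroup H] [InnerProductSpace ℂ H] [CompleteSpace H]
    [NormedAddCommGroup K] [InnerProductSpace ℂ K] [CompleteSpace K]
    {Φ : traceClass K →ₗ[ℂ] traceClass H} (hΦ : IsChannel Φ) :
    ∃ (κ : Type (max u v)) (A : κ → K →L[ℂ] H) (hA : IsKraus A), Φ = krausMap hA := by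
  obtain ⟨E, _, _, _, W, hWk, hWd⟩ := exists_kolmogorov _ (posSemidef_channelKernel hΦ.1)
  have hW : ∀ a b u w, ⟪u, (Φ (rankOneT a b)).1 w⟫_ℂ = ⟪W a u, W b w⟫_ℂ := by
    intro a b u w
    have h : (Φ (rankOneT a b)).1 = (W a).adjoint ∘L W b := hWk a b
    rw [h, ContinuousLinearMap.comp_apply, ContinuousLinearMap.adjoint_inner_right]
  have hext : ∀ f : E, (∀ b w, ⟪f, W b w⟫_ℂ = 0) → f = 0 := by
    intro f hf
    have h1 : innerSL ℂ f = 0 := by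
      refine ContinuousLinearMap.ext_on (s := {W b w | (b) (w)})
        (Submodule.dense_iff_topologicalClosure_eq_top.2 hWd) ?_
      rintro _ ⟨b, w, rfl⟩
      simpa using hf b w
    exact (innerSL_inj (𝕜 := ℂ)).1 (h1.trans (map_zero _).symm)
  -- `W` is conjugate linear, because `Φ` is linear and the vectors `W b w` are total.
  have hWadd : ∀ a a', W (a + a') = W a + W a' := by
    intro a a'
    ext u : 1
    rw [← sub_eq_zero]
    refine hext _ fun b w => ?_
    simp only [add_apply, inner_sub_left, inner_add_left, ← hW]
    rw [rankOneT_add_left, map_add, Submodule.coe_add, add_apply, inner_add_right, sub_self]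
  have hWsmul : ∀ (c : ℂ) a, W (c • a) = (starRingEnd ℂ) c • W a := by
    intro c a
    ext u : 1
    rw [← sub_eq_zero]
    refine hext _ fun b w => ?_
    simp only [smul_apply, inner_sub_left, inner_smul_left, ← hW, RCLike.conj_conj]
    rw [rankOneT_smul_left, map_smul, Submodule.coe_smul, smul_apply, inner_smul_right, sub_self]
  -- `‖W a‖²_HS = tr Φ(|a⟩⟨a|) = ‖a‖²`, as `Φ` preserves the trace.
  have hWn : ∀ a, hsSq (W a) = ‖a‖ₑ ^ 2 := by
    intro a
    have hp : (rankOneT a a).1.IsPositive := InnerProductSpace.isPositive_rankOne_self a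
    have h1 : traceNorm (Φ (rankOneT a a)).1 = ‖a‖ₑ ^ 2 := by
      rw [traceNorm_eq_trace (hΦ.1.isPositive hp), hΦ.2]
      change ENNReal.ofReal (trace (InnerProductSpace.rankOne ℂ a a)).re = _
      rw [trace_rankOne, enorm_sq_eq_ofReal]
      congr 1
      exact inner_self_eq_norm_sq (𝕜 := ℂ) a
    rw [← h1, ← traceNorm_adjoint_comp_self]
    congr 1
    ext w
    refine ext_inner_left ℂ fun u => ?_
    rw [ContinuousLinearMap.comp_apply, ContinuousLinearMap.adjoint_inner_right, hW]
  obtain ⟨s, ε, -⟩ := exists_hilbertBasis ℂ E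
  let A : s → K →L[ℂ] H := fun k => LinearMap.mkContinuous
    { toFun := fun a => (W a).adjoint (ε k)
      map_add' := fun a a' => by rw [hWadd, map_add]; rfl
      map_smul' := fun c a => by
        rw [hWsmul, map_smulₛₗ]
        simp } 1 fun a => by
    rw [one_mul]
    have h1 := (enorm_apply_sq_le_hsSq (W a).adjoint (ε k)).trans_eq
      (by rw [hsSq_adjoint, hWn])
    have h2 : ‖ε k‖ₑ = 1 := by rw [← ofReal_norm, ε.orthonormal.norm_eq_one]; simp
    rw [h2, one_pow, one_mul, ENNReal.pow_le_pow_left_iff two_ne_zero, enorm_le_iff_norm_le] at h1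
    exact h1
  have hAk : ∀ k a, A k a = (W a).adjoint (ε k) := fun k a => rfl
  have hA : IsKraus A := by
    intro a
    simp_rw [hAk]
    rw [← hsSq_eq_tsum, hsSq_adjoint, hWn]
  refine ⟨s, A, hA, ?_⟩
  refine hΦ.isTraceNormBounded.ext_of_dense (isTraceNormBounded_krausMap hA) (s := Set.univ)
    (by rw [Submodule.span_univ, eq_top_iff]; exact Submodule.le_topologicalClosure _)
    fun a _ b _ => ?_
  refine Subtype.ext (ContinuousLinearMap.ext fun w => ext_inner_left ℂ fun u => ?_)
  rw [hW, ← ε.tsum_inner_mul_inner, ← (hasSum_inner_krausMap_rankOneT hA a b u w).tsum_eq]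
  refine tsum_congr fun k => ?_
  rw [hAk, hAk, ContinuousLinearMap.adjoint_inner_left, ContinuousLinearMap.adjoint_inner_right]

end KrausExistence

/-! ### The adjoint map of a channel -/

section AdjointMap

variable {H K : Type*}
  [NormedAddCommGroup H] [InnerProductSpace ℂ H] [CompleteSpace H]
  [NormedAddCommGroup K] [InnerProductSpace ℂ K] [CompleteSpace K]

theorem IsAdjointMap.inner_apply {Φ : traceClass K →ₗ[ℂ] traceClass H}
    {D : (H →L[ℂ] H) →ₗ[ℂ] (K →L[ℂ] K)} (hD : IsAdjointMap Φ D) (T : H →L[ℂ] H) (a b : K) :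
    ⟪b, D T a⟫_ℂ = trace ((Φ (rankOneT a b)).1 ∘L T) := by
  rw [hD, ← trace_rankOne_comp]; rfl

/-- The adjoint map exists because bounded operators are the dual of the trace-class operators. -/
theorem existsUnique_isAdjointMap {Φ : traceClass K →ₗ[ℂ] traceClass H}
    (hΦ : IsTraceNormBounded Φ) : ∃! D, IsAdjointMap Φ D := by
  have hB : ∀ T : H →L[ℂ] H, ∃ B : K →L[ℂ] K, ∀ X, trace ((Φ X).1 ∘L T) = trace (X.1 ∘L B) :=
    fun T => ((isBoundedFunctional_traceL.comp (isTraceNormBounded_compRight T)).comp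
      hΦ).exists_operator
  choose B hB using hB
  have hin : ∀ T a b, ⟪b, B T a⟫_ℂ = traceL H (compRight T (Φ (rankOneT a b))) := by
    intro T a b
    rw [← trace_rankOne_comp]
    exact (hB T (rankOneT a b)).symm
  let D : (H →L[ℂ] H) →ₗ[ℂ] (K →L[ℂ] K) :=
    { toFun := B
      map_add' := fun S T => by
        refine ContinuousLinearMap.ext fun a => ext_inner_left ℂ fun b => ?_
        rw [add_apply, inner_add_right, hin, hin, hin, ← map_add]
        congr 1
        exact Subtype.ext (ContinuousLinearMap.comp_add _ _ _)
      map_smul' := fun c T => by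
        refine ContinuousLinearMap.ext fun a => ext_inner_left ℂ fun b => ?_
        rw [RingHom.id_apply, smul_apply, inner_smul_right, hin, hin, ← smul_eq_mul, ← map_smul]
        congr 1
        exact Subtype.ext (ContinuousLinearMap.comp_smul _ _ _) }
  refine ⟨D, fun X T => hB T X, fun D' hD' => ?_⟩
  refine LinearMap.ext fun T => ContinuousLinearMap.ext fun a => ext_inner_left ℂ fun b => ?_
  rw [hD'.inner_apply]
  exact (hin T a b).symm

end AdjointMap

/-! ### Tensoring with the identity map -/

section TensorId

variable {H K L M : Type*}
  [NormedAddCommGroup H] [InnerProductSpace ℂ H] [CompleteSpace H]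
  [NormedAddCommGroup K] [InnerProductSpace ℂ K] [CompleteSpace K]
  [NormedAddCommGroup L] [InnerProductSpace ℂ L] [CompleteSpace L]
  [NormedAddCommGroup M] [InnerProductSpace ℂ M] [CompleteSpace M]
  {κ : Type*}

/-- An operator between Hilbert tensor products is determined by its matrix elements between
elementary tensors. -/
theorem op_ext_htmul {S T : HTensor K L →L[ℂ] HTensor H M}
    (h : ∀ x y x' y', ⟪htmul x y, S (htmul x' y')⟫_ℂ = ⟪htmul x y, T (htmul x' y')⟫_ℂ) :
    S = T := by
  refine ext_htmul fun x' y' => ext_inner_htmul fun x y => ?_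
  rw [← inner_conj_symm, h, inner_conj_symm]

theorem span_htmul_dense :
    (Submodule.span ℂ {v : HTensor K L | ∃ x y, v = htmul x y}).topologicalClosure = ⊤ := by
  rw [Submodule.topologicalClosure_eq_top_iff, eq_bot_iff]
  intro v hv
  refine ext_inner_htmul fun x y => ?_
  rw [inner_zero_left]
  have h : htmul x y ∈ {v : HTensor K L | ∃ x y, v = htmul x y} := ⟨x, y, rfl⟩
  exact Submodule.inner_left_of_mem_orthogonal (Submodule.subset_span h) hv

/-- The isometry, up to the factor `‖y‖`, that sends `x` to `x ⊗ y`. -/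
noncomputable def htmulRight (K : Type*) [NormedAddCommGroup K] [InnerProductSpace ℂ K]
    [CompleteSpace K] (y : L) : K →L[ℂ] HTensor K L :=
  LinearMap.mkContinuous
    { toFun := fun x => htmul x y
      map_add' := fun x x' => by
        rw [htmul, TensorProduct.add_tmul, map_add]; rfl
      map_smul' := fun c x => by
        rw [htmul, ← TensorProduct.smul_tmul', map_smul]; rfl } ‖y‖ fun x => by
    rw [mul_comm]; exact (norm_htmul x y).le

theorem htmulRight_apply (x : K) (y : L) : htmulRight K y x = htmul x y := rfl

/-- In terms of the components `(1 ⊗ ⟨fⱼ|) v` of `v`, the operator `A ⊗ 1` acts componentwise. -/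
theorem enorm_sq_opTensor_id {ι : Type*} (A : K →L[ℂ] H) (f : HilbertBasis ι ℂ L)
    (v : HTensor K L) : ‖opTensor A (ContinuousLinearMap.id ℂ L) v‖ₑ ^ 2 =
      ∑' j, ‖A ((htmulRight K (f j)).adjoint v)‖ₑ ^ 2 := by
  obtain ⟨g, hg⟩ := exists_tensor_basis (onb H) f
  rw [enorm_sq_eq_tsum g]
  calc _ = ∑' i, ∑' j, ‖⟪g (i, j), opTensor A (ContinuousLinearMap.id ℂ L) v⟫_ℂ‖ₑ ^ 2 :=
        ENNReal.tsum_prod (f := fun i j =>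
          ‖⟪g (i, j), opTensor A (ContinuousLinearMap.id ℂ L) v⟫_ℂ‖ₑ ^ 2)
    _ = ∑' j, ∑' i, ‖⟪g (i, j), opTensor A (ContinuousLinearMap.id ℂ L) v⟫_ℂ‖ₑ ^ 2 :=
        ENNReal.tsum_comm
    _ = _ := by
        refine tsum_congr fun j => ?_
        rw [enorm_sq_eq_tsum (onb H)]
        refine tsum_congr fun i => ?_
        rw [hg, ← ContinuousLinearMap.adjoint_inner_left, adjoint_opTensor, opTensor_htmul,
          ← ContinuousLinearMap.adjoint_inner_left A, ContinuousLinearMap.adjoint_inner_right,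
          htmulRight_apply, ContinuousLinearMap.adjoint_id]
        rfl

theorem opTensor_id_id : opTensor (ContinuousLinearMap.id ℂ K) (ContinuousLinearMap.id ℂ L) =
    ContinuousLinearMap.id ℂ (HTensor K L) := by
  refine ext_htmul fun x y => ?_
  rw [opTensor_htmul]; rfl

theorem IsKraus.opTensor_id {A : κ → K →L[ℂ] H} (hA : IsKraus A) (L : Type*)
    [NormedAddCommGroup L] [InnerProductSpace ℂ L] [CompleteSpace L] :
    IsKraus fun k => opTensor (A k) (ContinuousLinearMap.id ℂ L) := by
  intro v
  simp_rw [enorm_sq_opTensor_id _ (onb L)]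
  rw [ENNReal.tsum_comm]
  simp_rw [hA _]
  have h := enorm_sq_opTensor_id (ContinuousLinearMap.id ℂ K) (onb L) v
  rw [opTensor_id_id] at h
  exact h.symm

/-- `Φ ⊗ id` is the Kraus map with the Kraus operators `Aₖ ⊗ 1`. -/
theorem isTensorId_krausMap {A : κ → K →L[ℂ] H} (hA : IsKraus A) :
    IsTensorId (krausMap hA) (krausMap (hA.opTensor_id L)) := by
  refine ⟨isTraceNormBounded_krausMap _, fun X Y => ?_⟩
  refine Subtype.ext (op_ext_htmul fun x y x' y' => ?_)
  rw [← (hasSum_inner_krausMap (hA.opTensor_id L) (tensorT X Y) _ _).tsum_eq]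
  change _ = ⟪htmul x y, opTensor (krausMap hA X).1 Y.1 (htmul x' y')⟫_ℂ
  rw [opTensor_htmul, inner_htmul, ← ((hasSum_inner_krausMap hA X x x').mul_right _).tsum_eq]
  refine tsum_congr fun k => ?_
  change ⟪_, opTensor X.1 Y.1 _⟫_ℂ = _
  rw [adjoint_opTensor, ContinuousLinearMap.adjoint_id, opTensor_htmul, opTensor_htmul,
    opTensor_htmul, inner_htmul]
  rfl

theorem tensorT_rankOneT (a b : K) (c d : L) :
    tensorT (rankOneT a b) (rankOneT c d) = rankOneT (htmul a c) (htmul b d) := by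
  refine Subtype.ext (op_ext_htmul fun x y x' y' => ?_)
  change ⟪_, opTensor (InnerProductSpace.rankOne ℂ a b) (InnerProductSpace.rankOne ℂ c d) _⟫_ℂ =
    ⟪_, InnerProductSpace.rankOne ℂ _ _ _⟫_ℂ
  rw [opTensor_htmul]
  simp only [InnerProductSpace.rankOne_apply, inner_htmul, inner_smul_right]
  ring

/-- `Φ ⊗ id` is unique, as elementary tensors of rank-one operators are rank-one operators between
elementary tensors, which are total. -/
theorem IsTensorId.unique {Φ : traceClass K →ₗ[ℂ] traceClass H}
    {Ψ Ψ' : traceClass (HTensor K L) →ₗ[ℂ] traceClass (HTensor H L)} (h : IsTensorId Φ Ψ)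
    (h' : IsTensorId Φ Ψ') : Ψ = Ψ' := by
  refine h.1.ext_of_dense h'.1 span_htmul_dense ?_
  rintro _ ⟨a, c, rfl⟩ _ ⟨b, d, rfl⟩
  rw [← tensorT_rankOneT, h.2, h'.2]

end TensorId

/-! ### Hilbert–Schmidt operators as vectors of a tensor product -/

section VectorOf

variable {H K L : Type*}
  [NormedAddCommGroup H] [InnerProductSpace ℂ H] [CompleteSpace H]
  [NormedAddCommGroup K] [InnerProductSpace ℂ K] [CompleteSpace K]
  [NormedAddCommGroup L] [InnerProductSpace ℂ L] [CompleteSpace L]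
  {ι : Type*}

theorem inner_dual (φ ψ : StrongDual ℂ H) :
    ⟪φ, ψ⟫_ℂ = ⟪(InnerProductSpace.toDual ℂ H).symm ψ, (InnerProductSpace.toDual ℂ H).symm φ⟫_ℂ :=
  rfl

theorem inner_toDual_toDual (x y : H) :
    ⟪InnerProductSpace.toDual ℂ H x, InnerProductSpace.toDual ℂ H y⟫_ℂ = ⟪y, x⟫_ℂ := by
  rw [inner_dual, LinearIsometryEquiv.symm_apply_apply, LinearIsometryEquiv.symm_apply_apply]

/-- The Hilbert basis of `H` that corresponds to a Hilbert basis of `H*`. -/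
theorem exists_predual_basis (d : HilbertBasis ι ℂ (StrongDual ℂ H)) :
    ∃ δ : HilbertBasis ι ℂ H, ∀ i, InnerProductSpace.toDual ℂ H (δ i) = d i := by
  classical
  have ho : Orthonormal ℂ fun i => (InnerProductSpace.toDual ℂ H).symm (d i) := by
    rw [orthonormal_iff_ite]
    intro i j
    rw [← inner_dual, orthonormal_iff_ite.1 d.orthonormal]
    simp only [eq_comm]
  refine ⟨HilbertBasis.mkOfOrthogonalEqBot ho ?_, fun i => by
    rw [HilbertBasis.coe_mkOfOrthogonalEqBot, LinearIsometryEquiv.apply_symm_apply]⟩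
  rw [eq_bot_iff]
  intro x hx
  rw [Submodule.mem_bot, ← (InnerProductSpace.toDual ℂ H).map_eq_zero_iff]
  have h0 : innerSL ℂ (InnerProductSpace.toDual ℂ H x) = 0 := by
    refine clm_eq_zero_of_basis d _ fun i => ?_
    rw [innerSL_apply_apply, inner_dual, LinearIsometryEquiv.symm_apply_apply]
    exact Submodule.inner_right_of_mem_orthogonal (Submodule.subset_span (Set.mem_range_self i)) hx
  exact (innerSL_inj (𝕜 := ℂ)).1 (h0.trans (map_zero _).symm)

theorem IsVectorOf.unique {T : H →L[ℂ] K} {v w : HTensor K (StrongDual ℂ H)}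
    (hv : IsVectorOf T v) (hw : IsVectorOf T w) : v = w := by
  refine ext_inner_htmul fun ψ φ => ?_
  rw [← inner_conj_symm v, ← inner_conj_symm w,
    ← (InnerProductSpace.toDual ℂ H).apply_symm_apply φ, hv, hw]

/-- The correspondence of operators and vectors is isometric for the Hilbert–Schmidt norm. -/
theorem IsVectorOf.enorm_sq {T : H →L[ℂ] K} {v : HTensor K (StrongDual ℂ H)}
    (hv : IsVectorOf T v) : ‖v‖ₑ ^ 2 = hsSq T := by
  obtain ⟨δ, hδ⟩ := exists_predual_basis (onb (StrongDual ℂ H))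
  obtain ⟨g, hg⟩ := exists_tensor_basis (onb K) (onb (StrongDual ℂ H))
  rw [enorm_sq_eq_tsum g, hsSq_eq_tsum T δ]
  calc _ = ∑' i, ∑' j, ‖⟪g (i, j), v⟫_ℂ‖ₑ ^ 2 :=
        ENNReal.tsum_prod (f := fun i j => ‖⟪g (i, j), v⟫_ℂ‖ₑ ^ 2)
    _ = ∑' j, ∑' i, ‖⟪g (i, j), v⟫_ℂ‖ₑ ^ 2 := ENNReal.tsum_comm
    _ = _ := by
        refine tsum_congr fun j => ?_
        rw [enorm_sq_eq_tsum (onb K)]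
        refine tsum_congr fun i => ?_
        rw [hg, ← hδ, hv]

/-- Hilbert–Schmidt operators correspond to vectors: `|T⟫ = ∑ᵢ T δᵢ ⊗ ⟨δᵢ|`. -/
theorem exists_isVectorOf (T : H →L[ℂ] K) (hT : hsSq T ≠ ∞) : ∃ v, IsVectorOf T v := by
  set d := onb (StrongDual ℂ H) with hd
  obtain ⟨δ, hδ⟩ := exists_predual_basis d
  let V : ∀ _ : (exists_hilbertBasis ℂ (StrongDual ℂ H)).choose,
      K →ₗᵢ[ℂ] HTensor K (StrongDual ℂ H) := fun i =>
    ⟨(htmulRight K (d i)).toLinearMap, fun x => by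
      change ‖htmul x (d i)‖ = ‖x‖
      rw [norm_htmul, d.orthonormal.norm_eq_one, mul_one]⟩
  have hV : OrthogonalFamily ℂ (fun _ => K) V := by
    intro i j hij x y
    change ⟪htmul x (d i), htmul y (d j)⟫_ℂ = 0
    rw [inner_htmul, d.orthonormal.2 hij, mul_zero]
  have hs : Summable fun i => ‖T (δ i)‖ ^ 2 := by
    rw [hsSq_eq_tsum T δ] at hT
    simpa using ENNReal.summable_toReal hT
  have hsum := (hV.summable_iff_norm_sq_summable fun i => T (δ i)).2 hs
  refine ⟨∑' i, V i (T (δ i)), fun ψ x => ?_⟩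
  have h1 := (innerSL ℂ (htmul ψ (InnerProductSpace.toDual ℂ H x))).hasSum hsum.hasSum
  rw [innerSL_apply_apply] at h1
  refine h1.unique ?_
  rw [← ContinuousLinearMap.adjoint_inner_left]
  refine (δ.hasSum_inner_mul_inner (T.adjoint ψ) x).congr_fun ?_
  intro i
  change ⟪_, htmul (T (δ i)) (d i)⟫_ℂ = _
  rw [inner_htmul, ← hδ, inner_toDual_toDual, ContinuousLinearMap.adjoint_inner_left]

theorem IsVectorOf.opTensor_id {T : H →L[ℂ] K} {v : HTensor K (StrongDual ℂ H)}
    (hv : IsVectorOf T v) (A : K →L[ℂ] L) :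
    IsVectorOf (A ∘L T) (opTensor A (ContinuousLinearMap.id ℂ (StrongDual ℂ H)) v) := by
  intro ψ x
  rw [← ContinuousLinearMap.adjoint_inner_left, adjoint_opTensor, opTensor_htmul,
    ContinuousLinearMap.adjoint_id, ContinuousLinearMap.id_apply, hv,
    ContinuousLinearMap.adjoint_inner_left]
  rfl

end VectorOf

/-! ### Square roots and supports of positive operators -/

section SquareRoot

variable {H : Type*} [NormedAddCommGroup H] [InnerProductSpace ℂ H] [CompleteSpace H]
  {A : H →L[ℂ] H}

theorem sqrt_isPositive (A : H →L[ℂ] H) : (CFC.sqrt A).IsPositive :=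
  (ContinuousLinearMap.nonneg_iff_isPositive _).1 (CFC.sqrt_nonneg A)

theorem adjoint_sqrt (A : H →L[ℂ] H) : (CFC.sqrt A).adjoint = CFC.sqrt A :=
  (sqrt_isPositive A).isSelfAdjoint

theorem sqrt_sqrt_apply (hA : A.IsPositive) (x : H) : CFC.sqrt A (CFC.sqrt A x) = A x :=
  congrArg (fun S : H →L[ℂ] H => S x) (CFC.sqrt_mul_sqrt_self A
    ((ContinuousLinearMap.nonneg_iff_isPositive _).2 hA))

theorem inner_sqrt_sqrt (hA : A.IsPositive) (x y : H) :
    ⟪CFC.sqrt A x, CFC.sqrt A y⟫_ℂ = ⟪x, A y⟫_ℂ := by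
  conv_lhs => rw [← adjoint_sqrt A]
  rw [ContinuousLinearMap.adjoint_inner_left, adjoint_sqrt, sqrt_sqrt_apply hA]

theorem hsSq_sqrt (hA : A.IsPositive) : hsSq (CFC.sqrt A) = traceNorm A := by
  rw [← traceNorm_adjoint_comp_self, adjoint_sqrt]
  congr 1
  exact ContinuousLinearMap.ext fun x => sqrt_sqrt_apply hA x

theorem apply_mem_supp (A : H →L[ℂ] H) (x : H) : A x ∈ supp A :=
  Submodule.le_topologicalClosure _ (LinearMap.mem_range_self _ x)

/-- The orthogonal complement of the support of a positive operator is its kernel. -/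
theorem mem_supp_orthogonal_iff (hA : A.IsPositive) (x : H) : x ∈ (supp A)ᗮ ↔ A x = 0 := by
  rw [supp, Submodule.orthogonal_closure]
  constructor
  · intro h
    refine ext_inner_left ℂ fun y => ?_
    rw [inner_zero_right, ← hA.inner_left_eq_inner_right]
    exact h _ (LinearMap.mem_range_self _ y)
  · rintro h _ ⟨y, rfl⟩
    change ⟪A y, x⟫_ℂ = 0
    rw [hA.inner_left_eq_inner_right, h, inner_zero_right]

theorem sqrt_apply_eq_zero_iff (hA : A.IsPositive) (x : H) : CFC.sqrt A x = 0 ↔ A x = 0 := by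
  constructor
  · intro h
    rw [← sqrt_sqrt_apply hA, h, map_zero]
  · intro h
    rw [← inner_self_eq_zero (𝕜 := ℂ), inner_sqrt_sqrt hA, h, inner_zero_right]

theorem sqrt_apply_mem_supp (hA : A.IsPositive) (x : H) : CFC.sqrt A x ∈ supp A := by
  rw [← Submodule.orthogonal_orthogonal (supp A)]
  intro y hy
  rw [mem_supp_orthogonal_iff hA, ← sqrt_apply_eq_zero_iff hA] at hy
  rw [← (sqrt_isPositive A).inner_left_eq_inner_right, hy, inner_zero_left]

/-- The square root of a positive operator, as an operator into its support. -/
noncomputable def sqrtSupp (A : H →L[ℂ] H) : H →L[ℂ] supp A :=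
  (supp A).orthogonalProjectionOnto ∘L CFC.sqrt A

theorem coe_sqrtSupp (hA : A.IsPositive) (x : H) : (sqrtSupp A x : H) = CFC.sqrt A x :=
  congrArg Subtype.val (Submodule.orthogonalProjectionOnto_mem_subspace_eq_self
    (⟨_, sqrt_apply_mem_supp hA x⟩ : supp A))

theorem adjoint_sqrtSupp_apply (A : H →L[ℂ] H) (x : supp A) :
    (sqrtSupp A).adjoint x = CFC.sqrt A x := by
  refine ext_inner_left ℂ fun y => ?_
  rw [ContinuousLinearMap.adjoint_inner_right, sqrtSupp, ContinuousLinearMap.comp_apply,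
    Submodule.inner_orthogonalProjectionOnto_eq_of_mem_right,
    (sqrt_isPositive A).inner_left_eq_inner_right]

theorem inner_sqrtSupp_sqrtSupp (hA : A.IsPositive) (x y : H) :
    ⟪sqrtSupp A x, sqrtSupp A y⟫_ℂ = ⟪x, A y⟫_ℂ := by
  rw [Submodule.coe_inner, coe_sqrtSupp hA, coe_sqrtSupp hA, inner_sqrt_sqrt hA]

theorem hsSq_sqrtSupp (hA : A.IsPositive) : hsSq (sqrtSupp A) = traceNorm A := by
  rw [← hsSq_sqrt hA]
  refine tsum_congr fun i => ?_
  rw [← coe_sqrtSupp hA]; rfl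

/-- The range of `√A` is dense in `supp A`. -/
theorem sqrtSupp_dense (hA : A.IsPositive) : DenseRange (sqrtSupp A) := by
  have h : (sqrtSupp A).range.topologicalClosure = ⊤ := by
    rw [Submodule.topologicalClosure_eq_top_iff, eq_bot_iff]
    intro y hy
    have h1 : CFC.sqrt A (y : H) = 0 := by
      rw [← adjoint_sqrtSupp_apply]
      refine ext_inner_left ℂ fun z => ?_
      rw [ContinuousLinearMap.adjoint_inner_right, inner_zero_right]
      exact hy _ (LinearMap.mem_range_self _ z)
    rw [sqrt_apply_eq_zero_iff hA, ← mem_supp_orthogonal_iff hA] at h1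
    rw [Submodule.mem_bot, ← inner_self_eq_zero (𝕜 := ℂ)]
    exact h1 _ y.2
  exact Submodule.dense_iff_topologicalClosure_eq_top.2 h

theorem compress_supp_apply {ρ : traceClass H} (hρ : ρ.1.IsPositive) (x : supp ρ.1) :
    (compress (supp ρ.1) ρ).1 x = sqrtSupp ρ.1 ((sqrtSupp ρ.1).adjoint x) := by
  rw [adjoint_sqrtSupp_apply]
  change (supp ρ.1).orthogonalProjectionOnto (ρ.1 x) = _
  rw [← sqrt_sqrt_apply hρ]; rfl

end SquareRoot

/-! ### The coupling of a channel -/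

section Coupling

variable {H : Type*} [NormedAddCommGroup H] [InnerProductSpace ℂ H] [CompleteSpace H]
  {κ : Type*}

theorem existsUnique_isCouplingOfChannel {ρ : traceClass H} (hρ : ρ.1.IsPositive)
    {Φ : traceClass (supp ρ.1) →ₗ[ℂ] traceClass H} (hΦ : IsChannel Φ) :
    ∃! P, IsCouplingOfChannel ρ Φ P := by
  obtain ⟨κ, A, hA, rfl⟩ := hΦ.exists_kraus
  obtain ⟨v, hv⟩ := exists_isVectorOf (sqrtSupp ρ.1) (by rw [hsSq_sqrtSupp hρ]; exact ρ.2.ne)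
  refine ⟨_, ⟨v, _, hv, isTensorId_krausMap hA, rfl⟩, ?_⟩
  rintro _ ⟨w, Ψ, hw, hΨ, rfl⟩
  rw [hΨ.unique (isTensorId_krausMap hA), IsVectorOf.unique hw hv]

/-- A coupling of a channel with Kraus operators `Aₖ` is `∑ₖ |Aₖ √ρ⟫⟪Aₖ √ρ|`. -/
theorem IsCouplingOfChannel.hasSum_inner {ρ : traceClass H} {A : κ → supp ρ.1 →L[ℂ] H}
    {hA : IsKraus A} {P : traceClass (HTensor H (StrongDual ℂ H))}
    (hP : IsCouplingOfChannel ρ (krausMap hA) P) :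
    ∃ v : κ → HTensor H (StrongDual ℂ H), (∀ k, IsVectorOf (A k ∘L sqrtSupp ρ.1) (v k)) ∧
      ∀ u w, HasSum (fun k => ⟪u, v k⟫_ℂ * ⟪v k, w⟫_ℂ) ⟪u, P.1 w⟫_ℂ := by
  obtain ⟨v, Ψ, hv, hΨ, rfl⟩ := hP
  rw [hΨ.unique (isTensorId_krausMap hA), ketBra_eq_rankOneT]
  exact ⟨_, fun k => IsVectorOf.opTensor_id hv (A k), fun u w =>
    hasSum_inner_krausMap_rankOneT (hA.opTensor_id _) v v u w⟩

theorem tsum_enorm_sq_ne_top {x : κ → H} {c : ℂ} (h : HasSum (fun k => ⟪x k, x k⟫_ℂ) c) :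
    ∑' k, ‖x k‖ₑ ^ 2 ≠ ∞ := by
  have h1 := (Complex.hasSum_re h).summable
  have e : ∀ k, (⟪x k, x k⟫_ℂ).re = ‖x k‖ ^ 2 := fun k => inner_self_eq_norm_sq (𝕜 := ℂ) _
  simp only [e] at h1
  simp_rw [enorm_sq_eq_ofReal]
  rw [← ENNReal.ofReal_tsum_of_nonneg (fun i => by positivity) h1]
  exact ENNReal.ofReal_ne_top

/-- `Φ(ρ) = ∑ₖ (Aₖ √ρ) (Aₖ √ρ)*`. -/
theorem krausMap_compress_inner {ρ : traceClass H} (hρ : ρ.1.IsPositive)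
    {A : κ → supp ρ.1 →L[ℂ] H} (hA : IsKraus A) (x y : H) :
    HasSum (fun k => ⟪(A k ∘L sqrtSupp ρ.1).adjoint x, (A k ∘L sqrtSupp ρ.1).adjoint y⟫_ℂ)
      ⟪x, (krausMap hA (compress (supp ρ.1) ρ)).1 y⟫_ℂ := by
  refine (hasSum_inner_krausMap hA (compress (supp ρ.1) ρ) x y).congr_fun ?_
  intro k
  rw [compress_supp_apply hρ, ContinuousLinearMap.adjoint_comp,
    ← ContinuousLinearMap.adjoint_inner_left (sqrtSupp ρ.1)]
  rfl

theorem IsState.traceNorm_eq {ρ : traceClass H} (hρ : IsState ρ) : traceNorm ρ.1 = 1 := by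
  rw [traceNorm_eq_trace hρ.1, hρ.2]; simp

/-- With `Π = ∑ₖ |Aₖ √ρ⟫⟪Aₖ √ρ|`, the marginals are `∑ₖ (Aₖ √ρ) (Aₖ √ρ)* = Φ(ρ)` and the
transpose of `∑ₖ (Aₖ √ρ)* (Aₖ √ρ) = ρ`. -/
theorem IsCouplingOfChannel.isCoupling {ρ ω : traceClass H} (hρ : IsState ρ)
    {Φ : traceClass (supp ρ.1) →ₗ[ℂ] traceClass H} (hΦ : IsChannel Φ)
    (hΦρ : Φ (compress (supp ρ.1) ρ) = ω) {P : traceClass (HTensor H (StrongDual ℂ H))}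
    (hP : IsCouplingOfChannel ρ Φ P) : IsCoupling ρ ω P := by
  obtain ⟨κ, A, hA, rfl⟩ := hΦ.exists_kraus
  obtain ⟨v, hv, hPv⟩ := hP.hasSum_inner
  refine ⟨⟨?_, ?_⟩, fun x y => ?_, fun φ ψ => ?_⟩
  · refine isPositive_of_inner_nonneg fun u => (hPv u u).nonneg fun k => ?_
    rw [← inner_conj_symm u]
    exact star_mul_self_nonneg ⟪v k, u⟫_ℂ
  · obtain ⟨v, Ψ, hv, hΨ, rfl⟩ := hP
    rw [hΨ.unique (isTensorId_krausMap hA), trace_krausMap, ketBra_eq_rankOneT]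
    refine (trace_rankOne v v).trans ?_
    have h : ‖v‖ₑ ^ 2 = 1 := by
      rw [IsVectorOf.enorm_sq hv, ← hρ.traceNorm_eq]
      exact hsSq_sqrtSupp hρ.1
    have h1 : ‖v‖ ^ 2 = 1 := by
      rw [enorm_sq_eq_ofReal, ENNReal.ofReal_eq_one] at h
      exact h
    rw [inner_self_eq_norm_sq_to_K]
    norm_cast
    rw [h1]
    exact Complex.ofReal_one
  · obtain ⟨δ, hδ⟩ := exists_predual_basis (onb (StrongDual ℂ H))
    have hs := fun x y => krausMap_compress_inner hρ.1 hA x y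
    rw [← hΦρ, ← (hs x y).tsum_eq]
    have h := hasSum_tsum_inner_mul_inner δ (tsum_enorm_sq_ne_top (hs y y))
      (tsum_enorm_sq_ne_top (hs x x))
    refine h.congr_fun ?_
    intro i
    rw [← (hPv _ _).tsum_eq]
    refine tsum_congr fun k => ?_
    rw [← hδ, hv, ← inner_conj_symm (v k), hv, inner_conj_symm,
      ContinuousLinearMap.adjoint_inner_left, ContinuousLinearMap.adjoint_inner_right, mul_comm]
  · set b := (InnerProductSpace.toDual ℂ H).symm φ with hb
    set c := (InnerProductSpace.toDual ℂ H).symm ψ with hc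
    have hφ : φ = InnerProductSpace.toDual ℂ H b := by simp [hb]
    have hψ : ψ = InnerProductSpace.toDual ℂ H c := by simp [hc]
    have hs := fun x y => hA.hasSum_inner (sqrtSupp ρ.1 x) (sqrtSupp ρ.1 y)
    have h := hasSum_tsum_inner_mul_inner (onb H) (tsum_enorm_sq_ne_top (hs b b))
      (tsum_enorm_sq_ne_top (hs c c))
    have e : ⟪φ, transpose ρ.1 ψ⟫_ℂ = ⟪sqrtSupp ρ.1 c, sqrtSupp ρ.1 b⟫_ℂ := by
      rw [inner_sqrtSupp_sqrtSupp hρ.1, inner_dual, InnerProductSpace.toDual_symm_apply,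
        transpose_apply, ← hb, hψ, InnerProductSpace.toDual_apply_apply]
    rw [e, ← (hs c b).tsum_eq]
    refine h.congr_fun ?_
    intro i
    rw [← (hPv _ _).tsum_eq]
    refine tsum_congr fun k => ?_
    rw [hφ, hψ, hv, ← inner_conj_symm (v k), hv, inner_conj_symm]
    rfl

end Coupling

/-! ### The swap transposition -/

section Swap

variable {H : Type*} [NormedAddCommGroup H] [InnerProductSpace ℂ H] [CompleteSpace H]

/-- Every vector of `H ⊗ H*` corresponds to a Hilbert–Schmidt operator. -/
theorem exists_operator_of_vector (v : HTensor H (StrongDual ℂ H)) :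
    ∃ T : H →L[ℂ] H, IsVectorOf T v := by
  let T : H →ₗ[ℂ] H :=
    { toFun := fun x => (htmulRight H (InnerProductSpace.toDual ℂ H x)).adjoint v
      map_add' := fun x y => by
        refine ext_inner_left ℂ fun ψ => ?_
        simp only [inner_add_right, ContinuousLinearMap.adjoint_inner_right, htmulRight_apply]
        rw [(InnerProductSpace.toDual ℂ H).map_add, htmul, TensorProduct.tmul_add, map_add,
          inner_add_left]
        rfl
      map_smul' := fun c x => by
        refine ext_inner_left ℂ fun ψ => ?_
        simp only [inner_smul_right, ContinuousLinearMap.adjoint_inner_right, htmulRight_apply,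
          RingHom.id_apply]
        rw [map_smulₛₗ, htmul, TensorProduct.tmul_smul, map_smul, inner_smul_left,
          RCLike.conj_conj]
        rfl }
  refine ⟨T.mkContinuous ‖v‖ fun x => ?_, fun ψ x => ?_⟩
  · change ‖(htmulRight H (InnerProductSpace.toDual ℂ H x)).adjoint v‖ ≤ _
    refine (ContinuousLinearMap.le_opNorm _ _).trans ?_
    rw [mul_comm]
    gcongr
    rw [LinearIsometryEquiv.norm_map]
    refine (LinearMap.mkContinuous_norm_le _ (norm_nonneg _) _).trans ?_
    rw [LinearIsometryEquiv.norm_map]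
  · change _ = ⟪ψ, (htmulRight H (InnerProductSpace.toDual ℂ H x)).adjoint v⟫_ℂ
    rw [ContinuousLinearMap.adjoint_inner_right, htmulRight_apply]

/-- The antiunitary involution `J` of `H ⊗ H*` with `J (a ⊗ ⟨b|) = b ⊗ ⟨a|`. It corresponds to
taking the adjoint of Hilbert–Schmidt operators. -/
theorem exists_swap_conj : ∃ J : HTensor H (StrongDual ℂ H) →L⋆[ℂ] HTensor H (StrongDual ℂ H),
    (∀ T v, IsVectorOf T v → IsVectorOf T.adjoint (J v)) ∧ (∀ v, J (J v) = v) ∧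
      (∀ v w, ⟪v, J w⟫_ℂ = ⟪w, J v⟫_ℂ) ∧ ∀ v, ‖J v‖ = ‖v‖ := by
  have hex : ∀ v : HTensor H (StrongDual ℂ H), ∃ w, ∀ T, IsVectorOf T v →
      IsVectorOf T.adjoint w := by
    intro v
    obtain ⟨T, hT⟩ := exists_operator_of_vector v
    obtain ⟨w, hw⟩ := exists_isVectorOf T.adjoint (by
      rw [hsSq_adjoint, ← hT.enorm_sq]; exact (ENNReal.pow_lt_top enorm_lt_top).ne)
    refine ⟨w, fun S hS => ?_⟩
    have : S = T := by
      refine ContinuousLinearMap.ext fun x => ext_inner_left ℂ fun y => ?_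
      rw [← hS, hT]
    rwa [this]
  choose J hJ using hex
  have hJi : ∀ v a b, ⟪htmul b (InnerProductSpace.toDual ℂ H a), J v⟫_ℂ =
      ⟪v, htmul a (InnerProductSpace.toDual ℂ H b)⟫_ℂ := by
    intro v a b
    obtain ⟨T, hT⟩ := exists_operator_of_vector v
    rw [hJ v T hT, ContinuousLinearMap.adjoint_inner_right, ← inner_conj_symm v, hT,
      inner_conj_symm]
  have hext : ∀ v w : HTensor H (StrongDual ℂ H),
      (∀ a b, ⟪htmul b (InnerProductSpace.toDual ℂ H a), v⟫_ℂ =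
        ⟪htmul b (InnerProductSpace.toDual ℂ H a), w⟫_ℂ) → v = w := by
    intro v w h
    refine ext_inner_htmul fun x φ => ?_
    rw [← inner_conj_symm v, ← inner_conj_symm w,
      ← (InnerProductSpace.toDual ℂ H).apply_symm_apply φ, h]
  have hn : ∀ v, ‖J v‖ = ‖v‖ := by
    intro v
    obtain ⟨T, hT⟩ := exists_operator_of_vector v
    have h1 := (hJ v T hT).enorm_sq
    rw [hsSq_adjoint, ← hT.enorm_sq, enorm_sq_eq_ofReal, enorm_sq_eq_ofReal,
      ENNReal.ofReal_eq_ofReal_iff (by positivity) (by positivity)] at h1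
    exact (sq_eq_sq₀ (norm_nonneg _) (norm_nonneg _)).1 h1
  let J' : HTensor H (StrongDual ℂ H) →L⋆[ℂ] HTensor H (StrongDual ℂ H) :=
    LinearMap.mkContinuous
      { toFun := J
        map_add' := fun v w => hext _ _ fun a b => by
          rw [inner_add_right, hJi, hJi, hJi, inner_add_left]
        map_smul' := fun c v => hext _ _ fun a b => by
          rw [inner_smul_right, hJi, hJi, inner_smul_left] } 1 fun v => by
      rw [one_mul]; exact (hn v).le
  have hsymm : ∀ v w, ⟪v, J w⟫_ℂ = ⟪w, J v⟫_ℂ := by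
    intro v w
    let f : HTensor H (StrongDual ℂ H) →L⋆[ℂ] ℂ := (innerSL ℂ w).comp J'
    let g : HTensor H (StrongDual ℂ H) →L⋆[ℂ] ℂ := (innerSL ℂ).flip (J w)
    have hfg : g = f := by
      refine ContinuousLinearMap.ext_on
        (Submodule.dense_iff_topologicalClosure_eq_top.2 span_htmul_dense) ?_
      rintro _ ⟨x, φ, rfl⟩
      change ⟪htmul x φ, J w⟫_ℂ = ⟪w, J (htmul x φ)⟫_ℂ
      rw [← (InnerProductSpace.toDual ℂ H).apply_symm_apply φ, hJi]
      congr 1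
      refine hext _ _ fun a b => ?_
      rw [hJi, inner_htmul, inner_htmul, inner_toDual_toDual, inner_toDual_toDual, mul_comm]
    exact congrArg (fun f : HTensor H (StrongDual ℂ H) →L⋆[ℂ] ℂ => f v) hfg
  refine ⟨J', fun T v => hJ v T, fun v => hext _ _ fun a b => ?_, hsymm, hn⟩
  change ⟪_, J (J v)⟫_ℂ = _
  rw [hJi, ← inner_conj_symm, hJi, inner_conj_symm]

/-- The swap transposition exists and is given by `⟪u, S(Z) w⟫ = ⟪J w, Z J u⟫`. -/
theorem exists_isSwapTranspose (J : HTensor H (StrongDual ℂ H) →L⋆[ℂ] HTensor H (StrongDual ℂ H))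
    (hJv : ∀ T v, IsVectorOf T v → IsVectorOf T.adjoint (J v)) (hJJ : ∀ v, J (J v) = v)
    (hJs : ∀ v w, ⟪v, J w⟫_ℂ = ⟪w, J v⟫_ℂ) (hJn : ∀ v, ‖J v‖ = ‖v‖) :
    ∃ S : traceClass (HTensor H (StrongDual ℂ H)) →ₗ[ℂ] traceClass (HTensor H (StrongDual ℂ H)),
      IsSwapTranspose S ∧ ∀ Z u w, ⟪u, (S Z).1 w⟫_ℂ = ⟪J w, Z.1 (J u)⟫_ℂ := by
  let S₀ : (HTensor H (StrongDual ℂ H) →L[ℂ] HTensor H (StrongDual ℂ H)) →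
      (HTensor H (StrongDual ℂ H) →L[ℂ] HTensor H (StrongDual ℂ H)) := fun Z =>
    J.comp (Z.adjoint.comp J)
  have hS₀ : ∀ Z u w, ⟪u, S₀ Z w⟫_ℂ = ⟪J w, Z (J u)⟫_ℂ := by
    intro Z u w
    change ⟪u, J (Z.adjoint (J w))⟫_ℂ = _
    rw [hJs, ContinuousLinearMap.adjoint_inner_left]
  have hJin : ∀ v w, ⟪J v, J w⟫_ℂ = ⟪w, v⟫_ℂ := by
    intro v w
    rw [hJs, hJJ]
  have hid : ‖ContinuousLinearMap.id ℂ (HTensor H (StrongDual ℂ H))‖ₑ ≤ 1 :=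
    enorm_le_one ContinuousLinearMap.norm_id_le
  -- `J` takes Hilbert bases to Hilbert bases, so that `S₀` does not increase the trace norm.
  have htn : ∀ Z, traceNorm (S₀ Z) ≤ traceNorm Z := by
    intro Z
    refine traceNorm_le_of_forall _ _ fun U hU F => ?_
    set e := onb (HTensor H (StrongDual ℂ H))
    have he : Orthonormal ℂ fun i => J (e i) := by
      refine ⟨fun i => by rw [hJn, e.orthonormal.norm_eq_one], fun i j hij => ?_⟩
      change ⟪J (e i), J (e j)⟫_ℂ = 0
      rw [hJin, e.orthonormal.2 hij.symm]
    let U' : HTensor H (StrongDual ℂ H) →L[ℂ] HTensor H (StrongDual ℂ H) := J.comp (U.comp J)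
    have hU' : ‖U'‖ₑ ≤ 1 := by
      refine enorm_le_one (U'.opNorm_le_bound zero_le_one fun x => ?_)
      change ‖J (U (J x))‖ ≤ _
      rw [hJn, ← hJn x]
      refine U.le_of_opNorm_le ?_ _
      rw [← ofReal_norm] at hU
      exact ENNReal.ofReal_le_one.1 hU
    have h := sum_enorm_inner_le Z he (ContinuousLinearMap.id ℂ _) U' F
    have h1 : ‖ContinuousLinearMap.id ℂ (HTensor H (StrongDual ℂ H))‖ₑ ^ 2 + ‖U'‖ₑ ^ 2 ≤ 2 := by
      calc _ ≤ (1 : ℝ≥0∞) ^ 2 + 1 ^ 2 := by gcongr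
        _ = 2 := by norm_num
    have h2 := (ENNReal.mul_le_mul_iff_right (by norm_num) (by norm_num)).1
      (h.trans (mul_le_mul_left h1 _))
    refine (Finset.sum_congr rfl fun i _ => ?_).trans_le h2
    rw [hS₀]
    change _ = ‖⟪J (e i), Z (J (U (J (J (e i)))))⟫_ℂ‖ₑ
    rw [hJJ]
  let S : traceClass (HTensor H (StrongDual ℂ H)) →ₗ[ℂ] traceClass (HTensor H (StrongDual ℂ H)) :=
    { toFun := fun Z => ⟨S₀ Z.1, (htn Z.1).trans_lt Z.2⟩
      map_add' := fun Z Z' => by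
        refine Subtype.ext (ContinuousLinearMap.ext fun w => ext_inner_left ℂ fun u => ?_)
        change ⟪u, S₀ (Z.1 + Z'.1) w⟫_ℂ = ⟪u, (S₀ Z.1 + S₀ Z'.1) w⟫_ℂ
        rw [hS₀, add_apply, add_apply, inner_add_right, inner_add_right, hS₀, hS₀]
      map_smul' := fun c Z => by
        refine Subtype.ext (ContinuousLinearMap.ext fun w => ext_inner_left ℂ fun u => ?_)
        change ⟪u, S₀ (c • Z.1) w⟫_ℂ = ⟪u, (c • S₀ Z.1) w⟫_ℂ
        rw [hS₀, smul_apply, smul_apply, inner_smul_right, inner_smul_right, hS₀] }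
  have hSv : ∀ Z u w, ⟪u, (S Z).1 w⟫_ℂ = ⟪J w, Z.1 (J u)⟫_ℂ := fun Z u w => hS₀ Z.1 u w
  refine ⟨S, ⟨⟨1, fun Z => by rw [ENNReal.coe_one, one_mul]; exact htn Z.1⟩, fun X Y => ?_⟩, hSv⟩
  have hJh : ∀ a b, J (htmul a (InnerProductSpace.toDual ℂ H b)) =
      htmul b (InnerProductSpace.toDual ℂ H a) := by
    have hr : ∀ a b : H, IsVectorOf (InnerProductSpace.rankOne ℂ a b)
        (htmul a (InnerProductSpace.toDual ℂ H b)) := by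
      intro a b ψ x
      rw [inner_htmul, inner_toDual_toDual, InnerProductSpace.rankOne_apply, inner_smul_right,
        mul_comm]
    intro a b
    have h := hJv _ _ (hr a b)
    rw [InnerProductSpace.adjoint_rankOne] at h
    exact h.unique (hr b a)
  have htr : ∀ (T : H →L[ℂ] H) (a b : H), ⟪InnerProductSpace.toDual ℂ H a,
      transpose T (InnerProductSpace.toDual ℂ H b)⟫_ℂ = ⟪b, T a⟫_ℂ := by
    intro T a b
    rw [inner_dual, InnerProductSpace.toDual_symm_apply, transpose_apply,
      LinearIsometryEquiv.symm_apply_apply, InnerProductSpace.toDual_apply_apply]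
  refine Subtype.ext (op_ext_htmul fun x φ x' φ' => ?_)
  rw [hSv, ← (InnerProductSpace.toDual ℂ H).apply_symm_apply φ,
    ← (InnerProductSpace.toDual ℂ H).apply_symm_apply φ', hJh, hJh]
  change ⟪_, opTensor X.1 (transpose Y.1) _⟫_ℂ = ⟪_, opTensor Y.1 (transpose X.1) _⟫_ℂ
  rw [opTensor_htmul, opTensor_htmul, inner_htmul, inner_htmul, htr, htr, mul_comm]

theorem rankOne_transpose (a b : H) : transpose (InnerProductSpace.rankOne ℂ a b) =
    InnerProductSpace.rankOne ℂ (InnerProductSpace.toDual ℂ H b)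
      (InnerProductSpace.toDual ℂ H a) := by
  refine ContinuousLinearMap.ext fun φ => ContinuousLinearMap.ext fun x => ?_
  rw [transpose_apply, InnerProductSpace.rankOne_apply, InnerProductSpace.rankOne_apply,
    ← (InnerProductSpace.toDual ℂ H).apply_symm_apply φ, inner_toDual_toDual]
  simp [mul_comm]

/-- The swap transposition is unique, as every rank-one operator on `H*` is a transpose. -/
theorem IsSwapTranspose.unique
    {S S' : traceClass (HTensor H (StrongDual ℂ H)) →ₗ[ℂ] traceClass (HTensor H (StrongDual ℂ H))}
    (h : IsSwapTranspose S) (h' : IsSwapTranspose S') : S = S' := by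
  refine h.1.ext_of_dense h'.1 span_htmul_dense ?_
  rintro _ ⟨a, c, rfl⟩ _ ⟨b, d, rfl⟩
  have e : rankOneT c d = transposeT (rankOneT ((InnerProductSpace.toDual ℂ H).symm d)
      ((InnerProductSpace.toDual ℂ H).symm c)) := by
    refine Subtype.ext ?_
    change InnerProductSpace.rankOne ℂ c d = transpose (InnerProductSpace.rankOne ℂ _ _)
    rw [rankOne_transpose, LinearIsometryEquiv.apply_symm_apply,
      LinearIsometryEquiv.apply_symm_apply]
  rw [← tensorT_rankOneT, e, h.2, h'.2]

theorem existsUnique_isSwapTranspose (H : Type*) [NormedAddCommGroup H] [InnerProductSpace ℂ H]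
    [CompleteSpace H] :
    ∃! S : traceClass (HTensor H (StrongDual ℂ H)) →ₗ[ℂ] traceClass (HTensor H (StrongDual ℂ H)),
      IsSwapTranspose S := by
  obtain ⟨J, hJv, hJJ, hJs, hJn⟩ := exists_swap_conj (H := H)
  obtain ⟨S, hS, -⟩ := exists_isSwapTranspose J hJv hJJ hJs hJn
  exact ⟨S, hS, fun S' hS' => hS'.unique hS⟩

end Swap

/-! ### Eigenvectors of positive trace-class operators -/

section Spectral

variable {H : Type*} [NormedAddCommGroup H] [InnerProductSpace ℂ H] [CompleteSpace H]

/-- Trace-class operators are compact: `X = S R` is the norm limit of the finite sums of the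
`|S eᵢ⟩⟨R* eᵢ|`. -/
theorem isCompactOperator_of_traceClass (X : traceClass H) : IsCompactOperator X.1 := by
  obtain ⟨S, R, hX, hS, hR⟩ := exists_hsSq_factor X.1
  set e := onb H with he
  let f := fun i => InnerProductSpace.rankOne ℂ (S (e i)) (R.adjoint (e i))
  have hf : Summable f := by
    refine summable_of_tsum_enorm (ne_top_of_le_ne_top (b := hsSq S + hsSq R.adjoint) ?_ ?_)
    · rw [hsSq_adjoint]
      exact ENNReal.add_ne_top.2 ⟨(hS.trans_lt X.2).ne, (hR.trans_lt X.2).ne⟩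
    · rw [hsSq, hsSq, ← ENNReal.tsum_add]
      refine ENNReal.tsum_le_tsum fun i => ?_
      exact (enorm_le_traceNorm _).trans ((le_mul_of_one_le_left' one_le_two).trans
        (two_mul_traceNorm_rankOne_le _ _))
  have hsum : HasSum f X.1 := by
    have h1 := hf.hasSum
    have h2 : ∑' i, f i = X.1 := by
      refine ContinuousLinearMap.ext fun x => ?_
      refine ((ContinuousLinearMap.apply ℂ H x).hasSum h1).unique ?_
      rw [hX]
      refine (S.hasSum (e.hasSum_repr (R x))).congr_fun ?_
      intro i
      change ⟪R.adjoint (e i), x⟫_ℂ • S (e i) = _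
      rw [map_smul, e.repr_apply_apply, ContinuousLinearMap.adjoint_inner_left]
    rwa [h2] at h1
  refine isCompactOperator_of_tendsto hsum (Filter.Eventually.of_forall fun F => ?_)
  classical
  induction F using Finset.induction_on with
  | empty => exact isCompactOperator_zero
  | insert i F hi ih =>
    rw [Finset.sum_insert hi]
    refine IsCompactOperator.add ?_ ih
    have h : IsCompactOperator (innerSL ℂ (R.adjoint (e i)) : H →L[ℂ] ℂ) :=
      isCompactOperator_of_locallyCompactSpace_dom _
    exact h.clm_comp (ContinuousLinearMap.toSpanSingleton ℂ (S (e i)))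

theorem mem_supp_of_eigenvector {A : H →L[ℂ] H} {g : H} {μ : ℝ} (hμ : 0 < μ)
    (hg : A g = (μ : ℂ) • g) : g ∈ supp A := by
  have h : g = (μ : ℂ)⁻¹ • A g := by
    rw [hg, smul_smul, inv_mul_cancel₀ (by exact_mod_cast hμ.ne'), one_smul]
  rw [h]
  exact Submodule.smul_mem _ _ (apply_mem_supp A g)

/-- The eigenvectors of a positive trace-class operator for positive eigenvalues span its
support. -/
theorem eigenvectors_dense {ω : traceClass H} (hω : ω.1.IsPositive) :
    (Submodule.span ℂ {a : supp ω.1 | ∃ μ : ℝ, 0 < μ ∧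
      ω.1 (a : H) = (μ : ℂ) • (a : H)}).topologicalClosure = ⊤ := by
  rw [Submodule.topologicalClosure_eq_top_iff, eq_bot_iff]
  intro y hy
  have hcomp := ContinuousLinearMap.orthogonalComplement_iSup_eigenspaces_eq_bot
    (isCompactOperator_of_traceClass ω) hω.isSymmetric
  have hmem : (y : H) ∈ (⨆ μ, Module.End.eigenspace (ω.1 : Module.End ℂ H) μ)ᗮ := by
    rw [← Submodule.iInf_orthogonal, Submodule.mem_iInf]
    intro μ x hx
    have hx' : ω.1 x = μ • x := Module.End.mem_eigenspace_iff.1 hx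
    by_cases hx0 : x = 0
    · rw [hx0, inner_zero_left]
    -- Eigenvalues of `ω` are nonnegative reals, and eigenvectors for `0` are orthogonal to `supp ω`.
    have h1 : 0 ≤ μ * ((‖x‖ ^ 2 : ℝ) : ℂ) := by
      have h2 := hω.inner_nonneg_right x
      rw [hx', inner_smul_right, inner_self_eq_norm_sq_to_K] at h2
      exact_mod_cast h2
    have h2 : (0 : ℝ) < ‖x‖ ^ 2 := by positivity
    obtain ⟨h3, h4⟩ := Complex.nonneg_iff.1 h1
    rw [Complex.re_mul_ofReal] at h3
    rw [Complex.im_mul_ofReal] at h4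
    have h5 : μ.im = 0 := by
      rcases mul_eq_zero.1 h4.symm with h | h
      · exact h
      · exact absurd h h2.ne'
    have h6 : 0 ≤ μ.re := nonneg_of_mul_nonneg_left h3 h2
    have h7 : μ = (μ.re : ℂ) := Complex.ext rfl (by simpa using h5)
    rcases h6.eq_or_lt with h0 | hpos
    · rw [← h0, Complex.ofReal_zero] at h7
      rw [h7, zero_smul, ← mem_supp_orthogonal_iff hω] at hx'
      rw [← inner_conj_symm, hx' _ y.2, map_zero]
    · rw [h7] at hx'
      exact hy _ (Submodule.subset_span (show
        (⟨x, mem_supp_of_eigenvector hpos hx'⟩ : supp ω.1) ∈ {a : supp ω.1 | ∃ μ : ℝ, 0 < μ ∧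
          ω.1 (a : H) = (μ : ℂ) • (a : H)} from ⟨_, hpos, hx'⟩))
  rw [hcomp, Submodule.mem_bot] at hmem
  exact (Submodule.mem_bot ℂ).2 (Subtype.ext hmem)

/-- Eigenvectors of `A` are eigenvectors of `√A`: the vector `h = √A g - √μ g` satisfies
`√A h = -√μ h`, which contradicts positivity of `√A` unless `h = 0`. -/
theorem sqrt_apply_eigenvector {A : H →L[ℂ] H} (hA : A.IsPositive) {g : H} {μ : ℝ} (hμ : 0 < μ)
    (hg : A g = (μ : ℂ) • g) : CFC.sqrt A g = (Real.sqrt μ : ℂ) • g := by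
  set h := CFC.sqrt A g - (Real.sqrt μ : ℂ) • g with hh
  have hsq : (Real.sqrt μ : ℂ) * (Real.sqrt μ : ℂ) = μ := by
    exact_mod_cast Real.mul_self_sqrt hμ.le
  have h1 : CFC.sqrt A h = -((Real.sqrt μ : ℂ) • h) := by
    rw [hh, map_sub, map_smul, sqrt_sqrt_apply hA, hg, smul_sub, smul_smul, hsq]
    abel
  have h2 := (sqrt_isPositive A).inner_nonneg_right h
  have hn : ⟪h, h⟫_ℂ = ((‖h‖ ^ 2 : ℝ) : ℂ) := by
    rw [inner_self_eq_norm_sq_to_K]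
    norm_cast
  rw [h1, inner_neg_right, inner_smul_right, hn, ← Complex.ofReal_mul, ← Complex.ofReal_neg,
    Complex.zero_le_real] at h2
  have h4 : h = 0 := by
    by_contra hne
    have h3 : 0 < Real.sqrt μ * ‖h‖ ^ 2 := by positivity
    linarith
  exact sub_eq_zero.1 h4

end Spectral

/-! ### The Petz recovery map -/

section Petz

universe u

variable {H : Type*} [NormedAddCommGroup H] [InnerProductSpace ℂ H] [CompleteSpace H]
  {κ : Type*}

theorem tsum_enorm_sq_eq {K : Type*} [NormedAddCommGroup K] [InnerProductSpace ℂ K]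
    {x : κ → H} {y : K} (h : HasSum (fun k => ⟪x k, x k⟫_ℂ) ⟪y, y⟫_ℂ) :
    ∑' k, ‖x k‖ₑ ^ 2 = ‖y‖ₑ ^ 2 := by
  have h1 := Complex.hasSum_re h
  have e : ∀ k, (⟪x k, x k⟫_ℂ).re = ‖x k‖ ^ 2 := fun k => inner_self_eq_norm_sq (𝕜 := ℂ) _
  have e' : (⟪y, y⟫_ℂ).re = ‖y‖ ^ 2 := inner_self_eq_norm_sq (𝕜 := ℂ) _
  simp only [e, e'] at h1
  simp_rw [enorm_sq_eq_ofReal]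
  rw [← ENNReal.ofReal_tsum_of_nonneg (fun i => by positivity) h1.summable, h1.tsum_eq,
    ENNReal.ofReal_pow (norm_nonneg _), ofReal_norm]

/-- Kraus operators of the Petz recovery map, `Bₖ = ρ^{1/2} Aₖ* ω^{-1/2}`, which is defined by
`Bₖ ω^{1/2} = ρ^{1/2} Aₖ*`. -/
theorem exists_petz_kraus {ρ ω : traceClass H} (hρ : ρ.1.IsPositive) (hω : ω.1.IsPositive)
    {A : κ → supp ρ.1 →L[ℂ] H} (hA : IsKraus A)
    (hAρ : krausMap hA (compress (supp ρ.1) ρ) = ω) :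
    ∃ B : κ → supp ω.1 →L[ℂ] H, IsKraus B ∧
      ∀ k, B k ∘L sqrtSupp ω.1 = (A k ∘L sqrtSupp ρ.1).adjoint := by
  have hsum : ∀ z, ∑' k, ‖(A k ∘L sqrtSupp ρ.1).adjoint z‖ₑ ^ 2 = ‖sqrtSupp ω.1 z‖ₑ ^ 2 := by
    intro z
    have h := krausMap_compress_inner hρ hA z z
    rw [hAρ, ← inner_sqrtSupp_sqrtSupp hω] at h
    exact tsum_enorm_sq_eq h
  have hle : ∀ k z, ‖(A k ∘L sqrtSupp ρ.1).adjoint z‖ ≤ ‖sqrtSupp ω.1 z‖ := by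
    intro k z
    have h := (ENNReal.le_tsum k).trans (hsum z).le
    rw [ENNReal.pow_le_pow_left_iff two_ne_zero, enorm_le_iff_norm_le] at h
    exact h
  choose B hB using fun k => exists_factor_of_norm_le _ _ (hle k)
  refine ⟨B, isKraus_of_dense B (sqrtSupp_dense hω) ?_, fun k =>
    ContinuousLinearMap.ext fun z => (hB k).2 z⟩
  rintro _ ⟨z, rfl⟩
  rw [← hsum]
  exact tsum_congr fun k => by rw [(hB k).2]

/-- The Petz recovery map takes `ω` to `∑ₖ (Bₖ √ω) (Bₖ √ω)* = ∑ₖ (Aₖ √ρ)* (Aₖ √ρ) = ρ`. -/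
theorem krausMap_petz {ρ ω : traceClass H} (hρ : ρ.1.IsPositive) (hω : ω.1.IsPositive)
    {A : κ → supp ρ.1 →L[ℂ] H} (hA : IsKraus A) {B : κ → supp ω.1 →L[ℂ] H} (hB : IsKraus B)
    (hBA : ∀ k, B k ∘L sqrtSupp ω.1 = (A k ∘L sqrtSupp ρ.1).adjoint) :
    krausMap hB (compress (supp ω.1) ω) = ρ := by
  refine Subtype.ext (ContinuousLinearMap.ext fun y => ext_inner_left ℂ fun x => ?_)
  have h := krausMap_compress_inner hω hB x y
  simp only [hBA, ContinuousLinearMap.adjoint_adjoint] at h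
  rw [← inner_sqrtSupp_sqrtSupp hρ]
  exact h.unique (hA.hasSum_inner _ _)

/-- The operators `B = ω^{-1/2} T ω^{-1/2}` for `T` in the span of the `|g⟩⟨g'|` with eigenvectors
`g`, `g'`, together with the values of the adjoint map on them. -/
theorem exists_sandwich_of_mem_eigenSpan {ω : H →L[ℂ] H} (hω : ω.IsPositive) {K : Type*}
    [NormedAddCommGroup K] [InnerProductSpace ℂ K] [CompleteSpace K]
    {A : κ → K →L[ℂ] H} (hA : IsKraus A) {D : (H →L[ℂ] H) →ₗ[ℂ] (K →L[ℂ] K)}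
    (hD : IsAdjointMap (krausMap hA) D) {T : H →L[ℂ] H} (hT : T ∈ eigenSpan ω) :
    ∃ B : H →L[ℂ] H, ((∀ x, B x ∈ supp ω) ∧
      (∀ x, B ((supp ω).orthogonalProjectionOnto x : H) = B x) ∧
      (∀ x, CFC.sqrt ω (B (CFC.sqrt ω x)) = T x)) ∧
      ∀ a b, HasSum (fun k => ⟪A k b, B (A k a)⟫_ℂ) ⟪b, D B a⟫_ℂ := by
  refine Submodule.span_induction (p := fun T _ => ∃ B : H →L[ℂ] H, ((∀ x, B x ∈ supp ω) ∧
      (∀ x, B ((supp ω).orthogonalProjectionOnto x : H) = B x) ∧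
      (∀ x, CFC.sqrt ω (B (CFC.sqrt ω x)) = T x)) ∧
      ∀ a b, HasSum (fun k => ⟪A k b, B (A k a)⟫_ℂ) ⟪b, D B a⟫_ℂ) ?_ ?_ ?_ ?_ hT
  · rintro _ ⟨g, g', μ, μ', hμ, hμ', hg, hg', rfl⟩
    have hgs := mem_supp_of_eigenvector hμ hg
    have hgs' := mem_supp_of_eigenvector hμ' hg'
    have hc : (Real.sqrt μ : ℂ) ≠ 0 := by exact_mod_cast (Real.sqrt_pos.2 hμ).ne'
    have hc' : (Real.sqrt μ' : ℂ) ≠ 0 := by exact_mod_cast (Real.sqrt_pos.2 hμ').ne'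
    have hD1 : ∀ a b, HasSum (fun k => ⟪A k b, InnerProductSpace.rankOne ℂ g g' (A k a)⟫_ℂ)
        ⟪b, D (InnerProductSpace.rankOne ℂ g g') a⟫_ℂ := by
      intro a b
      rw [hD.inner_apply]
      have h1 : (krausMap hA (rankOneT a b)).1 ∘L InnerProductSpace.rankOne ℂ g g' =
          InnerProductSpace.rankOne ℂ ((krausMap hA (rankOneT a b)).1 g) g' :=
        ContinuousLinearMap.ext fun x => by simp
      rw [h1, trace_rankOne]
      refine (hasSum_inner_krausMap_rankOneT hA a b g' g).congr_fun ?_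
      intro k
      rw [InnerProductSpace.rankOne_apply, inner_smul_right]
    refine ⟨((Real.sqrt μ : ℂ)⁻¹ * (Real.sqrt μ' : ℂ)⁻¹) • InnerProductSpace.rankOne ℂ g g',
      ⟨fun x => ?_, fun x => ?_, fun x => ?_⟩, fun a b => ?_⟩
    · rw [smul_apply, InnerProductSpace.rankOne_apply]
      exact Submodule.smul_mem _ _ (Submodule.smul_mem _ _ hgs)
    · rw [smul_apply, smul_apply, InnerProductSpace.rankOne_apply,
        InnerProductSpace.rankOne_apply]
      congr 2
      exact Submodule.inner_orthogonalProjectionOnto_eq_of_mem_left (⟨g', hgs'⟩ : supp ω) x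
    · rw [smul_apply, InnerProductSpace.rankOne_apply, map_smul, map_smul,
        sqrt_apply_eigenvector hω hμ hg, ← (sqrt_isPositive ω).inner_left_eq_inner_right,
        sqrt_apply_eigenvector hω hμ' hg', inner_smul_left, Complex.conj_ofReal,
        InnerProductSpace.rankOne_apply, smul_smul, smul_smul]
      congr 1
      field_simp
    · rw [map_smul, smul_apply, inner_smul_right]
      refine ((hD1 a b).mul_left _).congr_fun ?_
      intro k
      rw [smul_apply, inner_smul_right]
  · refine ⟨0, ⟨fun x => Submodule.zero_mem _, fun x => rfl, fun x => map_zero _⟩, fun a b => ?_⟩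
    simp [hasSum_zero]
  · rintro S T - - ⟨B, ⟨h1, h2, h3⟩, h4⟩ ⟨C, ⟨h1', h2', h3'⟩, h4'⟩
    refine ⟨B + C, ⟨fun x => Submodule.add_mem _ (h1 x) (h1' x), fun x => ?_, fun x => ?_⟩,
      fun a b => ?_⟩
    · rw [add_apply, add_apply, h2, h2']
    · rw [add_apply, add_apply, map_add, h3, h3']
    · rw [map_add, add_apply, inner_add_right]
      refine ((h4 a b).add (h4' a b)).congr_fun ?_
      intro k
      rw [add_apply, inner_add_right]
  · rintro c T - ⟨B, ⟨h1, h2, h3⟩, h4⟩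
    refine ⟨c • B, ⟨fun x => Submodule.smul_mem _ _ (h1 x), fun x => ?_, fun x => ?_⟩,
      fun a b => ?_⟩
    · rw [smul_apply, smul_apply, h2]
    · rw [smul_apply, smul_apply, map_smul, h3]
    · rw [map_smul, smul_apply, inner_smul_right]
      refine ((h4 a b).mul_left c).congr_fun ?_
      intro k
      rw [smul_apply, inner_smul_right]

/-- An operator `B` that lives on `supp ω` with `√ω B √ω = T` is `ω^{-1/2} T ω^{-1/2}`. -/
theorem isPinvSandwich_of_sqrt_comp {ω T B : H →L[ℂ] H} (hω : ω.IsPositive)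
    (h1 : ∀ x, B x ∈ supp ω) (h2 : ∀ x, B ((supp ω).orthogonalProjectionOnto x : H) = B x)
    (h3 : ∀ x, CFC.sqrt ω (B (CFC.sqrt ω x)) = T x) : IsPinvSandwich ω T B := by
  rintro u v ⟨hv, huv⟩
  refine ⟨h1 u, ?_⟩
  rw [← h3, huv, h2]
  exact (coe_sqrtSupp hω _).symm

/-- The bounded operator `ω^{-1/2} T ω^{-1/2}` is unique, as `ω^{-1/2}` is injective on `supp ω` and
densely defined. -/
theorem IsPinvSandwich.unique {ω T B C : H →L[ℂ] H} (hω : ω.IsPositive)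
    (hB : IsPinvSandwich ω T B) (hC : IsPinvSandwich ω T C) : B = C := by
  have hinj : ∀ x ∈ supp ω, CFC.sqrt ω x = 0 → x = 0 := by
    intro x hx h
    rw [sqrt_apply_eq_zero_iff hω, ← mem_supp_orthogonal_iff hω] at h
    rw [← inner_self_eq_zero (𝕜 := ℂ)]
    exact h x hx
  have key : ∀ u v, IsPinvSqrtApply ω u v → B u = C u := by
    intro u v h
    obtain ⟨hb1, hb2⟩ := hB u v h
    obtain ⟨hc1, hc2⟩ := hC u v h
    refine sub_eq_zero.1 (hinj _ (Submodule.sub_mem _ hb1 hc1) ?_)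
    rw [map_sub, hb2, hc2, sub_self]
  refine ContinuousLinearMap.ext_on (s := {u | ∃ v, IsPinvSqrtApply ω u v}) ?_
    fun u ⟨v, h⟩ => key u v h
  rw [Submodule.dense_iff_topologicalClosure_eq_top, Submodule.topologicalClosure_eq_top_iff,
    eq_bot_iff]
  intro y hy
  have hy1 : y ∈ (supp ω)ᗮᗮ := by
    intro n hn
    refine hy n (Submodule.subset_span (show ∃ v, IsPinvSqrtApply ω n v from
      ⟨0, Submodule.zero_mem _, ?_⟩))
    rw [map_zero, Submodule.orthogonalProjectionOnto_eq_zero_iff.2 hn]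
    rfl
  rw [Submodule.orthogonal_orthogonal] at hy1
  have hy2 : ∀ w ∈ supp ω, ⟪CFC.sqrt ω w, y⟫_ℂ = 0 := by
    intro w hw
    refine hy _ (Submodule.subset_span (show ∃ v, IsPinvSqrtApply ω (CFC.sqrt ω w) v from
      ⟨w, hw, ?_⟩))
    exact (coe_sqrtSupp hω w).symm
  refine (Submodule.mem_bot ℂ).2 (hinj y hy1 ?_)
  rw [← inner_self_eq_zero (𝕜 := ℂ), ← (sqrt_isPositive ω).inner_left_eq_inner_right]
  exact hy2 _ (sqrt_apply_mem_supp hω y)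

/-- The Kraus map with the operators `Bₖ` is the Petz recovery map, because
`Bₖ √ω C √ω Bₖ* = √ρ Aₖ* C Aₖ √ρ`. -/
theorem isPetzRecovery_krausMap {ρ ω : traceClass H} (hρ : ρ.1.IsPositive)
    (hω : ω.1.IsPositive) {A : κ → supp ρ.1 →L[ℂ] H} (hA : IsKraus A)
    {B : κ → supp ω.1 →L[ℂ] H} (hB : IsKraus B)
    (hBA : ∀ k, B k ∘L sqrtSupp ω.1 = (A k ∘L sqrtSupp ρ.1).adjoint) :
    IsPetzRecovery ρ ω (krausMap hA) (krausMap hB) := by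
  refine ⟨isTraceNormBounded_krausMap hB, ?_⟩
  obtain ⟨D, hD, -⟩ := existsUnique_isAdjointMap (isTraceNormBounded_krausMap hA)
  refine ⟨D, hD, fun X hX => ?_⟩
  obtain ⟨C, ⟨h1, h2, h3⟩, h4⟩ := exists_sandwich_of_mem_eigenSpan hω hA hD hX
  refine ⟨C, isPinvSandwich_of_sqrt_comp hω h1 h2 h3, ?_⟩
  refine ContinuousLinearMap.ext fun y => ext_inner_left ℂ fun x => ?_
  have hBk : ∀ k z, CFC.sqrt ω.1 ((B k).adjoint z : H) = A k (sqrtSupp ρ.1 z) := by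
    intro k z
    have e : (B k ∘L sqrtSupp ω.1).adjoint = A k ∘L sqrtSupp ρ.1 := by
      rw [hBA, ContinuousLinearMap.adjoint_adjoint]
    rw [← adjoint_sqrtSupp_apply]
    rw [ContinuousLinearMap.adjoint_comp] at e
    exact congrArg (fun T : H →L[ℂ] H => T z) e
  have hXs : ∀ s t : supp ω.1, ⟪s, X.1 t⟫_ℂ = ⟪CFC.sqrt ω.1 (s : H), C (CFC.sqrt ω.1 (t : H))⟫_ℂ := by
    intro s t
    rw [(sqrt_isPositive ω.1).inner_left_eq_inner_right, h3]
    change _ = ⟪(s : H), (X.1 ((supp ω.1).orthogonalProjectionOnto (t : H)) : H)⟫_ℂ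
    rw [Submodule.orthogonalProjectionOnto_mem_subspace_eq_self, Submodule.coe_inner]
  have e2 : ⟪x, (CFC.sqrt ρ.1 ∘L extendZero (supp ρ.1) (D C) ∘L CFC.sqrt ρ.1) y⟫_ℂ =
      ⟪sqrtSupp ρ.1 x, D C (sqrtSupp ρ.1 y)⟫_ℂ := by
    rw [Submodule.coe_inner, coe_sqrtSupp hρ, (sqrt_isPositive ρ.1).inner_left_eq_inner_right]
    rfl
  rw [e2]
  refine HasSum.unique ?_ (h4 _ _)
  refine (hasSum_inner_krausMap hB X x y).congr_fun ?_
  intro k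
  rw [hXs, hBk, hBk]

/-- The Petz recovery map is unique, as the eigenvectors of `ω` for positive eigenvalues are total in
`supp ω`. -/
theorem IsPetzRecovery.unique {ρ ω : traceClass H} (hω : ω.1.IsPositive)
    {Φ : traceClass (supp ρ.1) →ₗ[ℂ] traceClass H} (hΦ : IsTraceNormBounded Φ)
    {R R' : traceClass (supp ω.1) →ₗ[ℂ] traceClass H} (h : IsPetzRecovery ρ ω Φ R)
    (h' : IsPetzRecovery ρ ω Φ R') : R = R' := by
  obtain ⟨hb, D, hD, hR⟩ := h
  obtain ⟨hb', D', hD', hR'⟩ := h'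
  refine hb.ext_of_dense hb' (eigenvectors_dense hω) ?_
  rintro a ⟨μ, hμ, ha⟩ b ⟨μ', hμ', hb⟩
  have hmem : extendZero (supp ω.1) (rankOneT a b).1 ∈ eigenSpan ω.1 := by
    refine Submodule.subset_span ⟨a, b, μ, μ', hμ, hμ', ha, hb, ?_⟩
    ext x
    change ((InnerProductSpace.rankOne ℂ a b ((supp ω.1).orthogonalProjectionOnto x) :
      supp ω.1) : H) = _
    rw [InnerProductSpace.rankOne_apply, InnerProductSpace.rankOne_apply, Submodule.coe_smul]
    congr 1
    exact Submodule.inner_orthogonalProjectionOnto_eq_of_mem_left b x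
  obtain ⟨B, hB, e⟩ := hR _ hmem
  obtain ⟨B', hB', e'⟩ := hR' _ hmem
  refine Subtype.ext ?_
  rw [e, e', hB.unique hω hB', (existsUnique_isAdjointMap hΦ).unique hD hD']

/-- An antiunitary `J` which implements the adjoint of Hilbert–Schmidt operators exchanges the
vectors of `Aₖ √ρ` with those of `(Aₖ √ρ)* = Bₖ √ω`. -/
theorem eq_of_swap_conj {ρ ω : traceClass H} {A : κ → supp ρ.1 →L[ℂ] H} {hA : IsKraus A}
    {B : κ → supp ω.1 →L[ℂ] H} {hB : IsKraus B}
    (hBA : ∀ k, B k ∘L sqrtSupp ω.1 = (A k ∘L sqrtSupp ρ.1).adjoint)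
    {P P' Q : traceClass (HTensor H (StrongDual ℂ H))}
    (hP : IsCouplingOfChannel ρ (krausMap hA) P) (hP' : IsCouplingOfChannel ω (krausMap hB) P')
    {J : HTensor H (StrongDual ℂ H) →L⋆[ℂ] HTensor H (StrongDual ℂ H)}
    (hJv : ∀ T v, IsVectorOf T v → IsVectorOf T.adjoint (J v))
    (hJs : ∀ v w, ⟪v, J w⟫_ℂ = ⟪w, J v⟫_ℂ)
    (hQ : ∀ u w, ⟪u, Q.1 w⟫_ℂ = ⟪J w, P.1 (J u)⟫_ℂ) : Q = P' := by
  obtain ⟨v, hv, hPv⟩ := hP.hasSum_inner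
  obtain ⟨v', hv', hPv'⟩ := hP'.hasSum_inner
  have hJ : ∀ k, v' k = J (v k) := fun k => by
    refine (hv' k).unique ?_
    rw [hBA]
    exact hJv _ _ (hv k)
  refine Subtype.ext (ContinuousLinearMap.ext fun w => ext_inner_left ℂ fun u => ?_)
  rw [hQ]
  have h1 : ∀ k, ⟪J (v k), w⟫_ℂ = ⟪J w, v k⟫_ℂ := fun k => by
    rw [← inner_conj_symm (J (v k)) w, hJs w (v k), inner_conj_symm]
  have h2 : ∀ k, ⟪u, v' k⟫_ℂ * ⟪v' k, w⟫_ℂ = ⟪J w, v k⟫_ℂ * ⟪v k, J u⟫_ℂ := fun k => by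
    rw [hJ, hJs u (v k), h1, mul_comm]
  have h3 := hPv' u w
  simp only [h2] at h3
  exact (hPv (J w) (J u)).unique h3

/-- The Petz recovery map of a channel is again given by Kraus operators. -/
theorem IsPetzRecovery.exists_kraus {H : Type u} [NormedAddCommGroup H] [InnerProductSpace ℂ H]
    [CompleteSpace H] {ρ ω : traceClass H} (hρ : ρ.1.IsPositive)
    (hω : ω.1.IsPositive) {Φ : traceClass (supp ρ.1) →ₗ[ℂ] traceClass H} (hΦ : IsChannel Φ)
    (hΦρ : Φ (compress (supp ρ.1) ρ) = ω) {R : traceClass (supp ω.1) →ₗ[ℂ] traceClass H}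
    (hR : IsPetzRecovery ρ ω Φ R) :
    ∃ (κ : Type u) (A : κ → supp ρ.1 →L[ℂ] H) (hA : IsKraus A) (B : κ → supp ω.1 →L[ℂ] H)
      (hB : IsKraus B), Φ = krausMap hA ∧ R = krausMap hB ∧
        ∀ k, B k ∘L sqrtSupp ω.1 = (A k ∘L sqrtSupp ρ.1).adjoint := by
  obtain ⟨κ, A, hA, rfl⟩ := hΦ.exists_kraus
  obtain ⟨B, hB, hBA⟩ := exists_petz_kraus hρ hω hA hΦρ
  exact ⟨κ, A, hA, B, hB, rfl, hR.unique hω hΦ.isTraceNormBounded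
    (isPetzRecovery_krausMap hρ hω hA hB hBA), hBA⟩

theorem existsUnique_isPetzRecovery {ρ ω : traceClass H} (hρ : ρ.1.IsPositive)
    (hω : ω.1.IsPositive) {Φ : traceClass (supp ρ.1) →ₗ[ℂ] traceClass H} (hΦ : IsChannel Φ)
    (hΦρ : Φ (compress (supp ρ.1) ρ) = ω) : ∃! R, IsPetzRecovery ρ ω Φ R := by
  obtain ⟨κ, A, hA, rfl⟩ := hΦ.exists_kraus
  obtain ⟨B, hB, hBA⟩ := exists_petz_kraus hρ hω hA hΦρ
  have h := isPetzRecovery_krausMap hρ hω hA hB hBA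
  exact ⟨_, h, fun R hR => hR.unique hω hΦ.isTraceNormBounded h⟩

theorem IsPetzRecovery.isChannel {ρ ω : traceClass H} (hρ : ρ.1.IsPositive)
    (hω : ω.1.IsPositive) {Φ : traceClass (supp ρ.1) →ₗ[ℂ] traceClass H} (hΦ : IsChannel Φ)
    (hΦρ : Φ (compress (supp ρ.1) ρ) = ω) {R : traceClass (supp ω.1) →ₗ[ℂ] traceClass H}
    (hR : IsPetzRecovery ρ ω Φ R) : IsChannel R := by
  obtain ⟨κ, A, hA, B, hB, -, rfl, -⟩ := hR.exists_kraus hρ hω hΦ hΦρ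
  exact isChannel_krausMap hB

theorem IsPetzRecovery.apply_compress {ρ ω : traceClass H} (hρ : ρ.1.IsPositive)
    (hω : ω.1.IsPositive) {Φ : traceClass (supp ρ.1) →ₗ[ℂ] traceClass H} (hΦ : IsChannel Φ)
    (hΦρ : Φ (compress (supp ρ.1) ρ) = ω) {R : traceClass (supp ω.1) →ₗ[ℂ] traceClass H}
    (hR : IsPetzRecovery ρ ω Φ R) : R (compress (supp ω.1) ω) = ρ := by
  obtain ⟨κ, A, hA, B, hB, -, rfl, hBA⟩ := hR.exists_kraus hρ hω hΦ hΦρ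
  exact krausMap_petz hρ hω hA hB hBA

/-- The swap transposition takes the coupling of a channel to that of its Petz recovery map. -/
theorem IsSwapTranspose.apply_coupling {ρ ω : traceClass H} (hρ : ρ.1.IsPositive)
    (hω : ω.1.IsPositive) {Φ : traceClass (supp ρ.1) →ₗ[ℂ] traceClass H} (hΦ : IsChannel Φ)
    (hΦρ : Φ (compress (supp ρ.1) ρ) = ω) {R : traceClass (supp ω.1) →ₗ[ℂ] traceClass H}
    (hR : IsPetzRecovery ρ ω Φ R) {P P' : traceClass (HTensor H (StrongDual ℂ H))}
    (hP : IsCouplingOfChannel ρ Φ P) (hP' : IsCouplingOfChannel ω R P')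
    {S : traceClass (HTensor H (StrongDual ℂ H)) →ₗ[ℂ] traceClass (HTensor H (StrongDual ℂ H))}
    (hS : IsSwapTranspose S) : S P = P' := by
  obtain ⟨κ, A, hA, B, hB, rfl, rfl, hBA⟩ := hR.exists_kraus hρ hω hΦ hΦρ
  obtain ⟨J, hJv, hJJ, hJs, hJn⟩ := exists_swap_conj (H := H)
  obtain ⟨S₀, hS₀, hS₀J⟩ := exists_isSwapTranspose J hJv hJJ hJs hJn
  rw [hS.unique hS₀]
  exact eq_of_swap_conj hBA hP hP' hJv hJs (hS₀J P)

end Petz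

end QuantumTransport

open QuantumTransport

theorem theorem1 {H : Type*} [NormedAddCommGroup H] [InnerProductSpace ℂ H] [CompleteSpace H]
    [TopologicalSpace.SeparableSpace H] (ρ ω : traceClass H) (hρ : IsState ρ) (hω : IsState ω)
    (Φ : traceClass (supp ρ.1) →ₗ[ℂ] traceClass H) (hΦ : IsChannel Φ)
    (hΦρ : Φ (compress (supp ρ.1) ρ) = ω) :
    (∃! D, IsAdjointMap Φ D) ∧
    (∃! P, IsCouplingOfChannel ρ Φ P) ∧
    (∃! S : traceClass (HTensor H (StrongDual ℂ H)) →ₗ[ℂ]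
      traceClass (HTensor H (StrongDual ℂ H)), IsSwapTranspose S) ∧
    (∃! R, IsPetzRecovery ρ ω Φ R) ∧
    ∀ R, IsPetzRecovery ρ ω Φ R →
      IsChannel R ∧ R (compress (supp ω.1) ω) = ρ ∧
      (∃! P', IsCouplingOfChannel ω R P') ∧
      ∀ P P' S, IsCouplingOfChannel ρ Φ P → IsCouplingOfChannel ω R P' → IsSwapTranspose S →
        IsCoupling ρ ω P ∧ IsCoupling ω ρ P' ∧ S P = P' := by
  refine ⟨existsUnique_isAdjointMap hΦ.isTraceNormBounded,
    existsUnique_isCouplingOfChannel hρ.1 hΦ, existsUnique_isSwapTranspose H,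
    existsUnique_isPetzRecovery hρ.1 hω.1 hΦ hΦρ, fun R hR => ?_⟩
  have hRc := hR.isChannel hρ.1 hω.1 hΦ hΦρ
  have hRω := hR.apply_compress hρ.1 hω.1 hΦ hΦρ
  exact ⟨hRc, hRω, existsUnique_isCouplingOfChannel hω.1 hRc, fun P P' S hP hP' hS =>
    ⟨hP.isCoupling hρ hΦ hΦρ, hP'.isCoupling hω hRc hRω,
      hS.apply_coupling hρ.1 hω.1 hΦ hΦρ hR hP hP'⟩⟩
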